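/- Let $d\ge 1$ and let $M$ be a connected smooth manifold of dimension $2d+1$ with a contact sub-Riemannian structure: a distribution $D=\ker\eta$, where $\eta$ is a smooth global one-form such that $d\eta|_D$ is nondegenerate, together with a smooth scalar product on $D$. Put $k=2d$ and let $H(\lambda)=\frac12\sum_{i=1}^{k}\langle\lambda,X_i\rangle^2$ ($X_1,\dots,X_k$ any orthonormal basis of $D_q$, $\lambda\in T_q^*M$) be the sub-Riemannian Hamiltonian, and $\exp_q(t,\lambda)$ the projection to $M$ of the integral curve of the Hamiltonian vector field of $H$ on $T^*M$ that starts at $\lambda$. Let $X_0$ be a smooth vector field with $\eta(X_0)\neq 0$ everywhere and $\mathcal V=\mathrm{span}\{X_0\}$, a complement of $D$. A volume form $\omega$ is a smooth nowhere vanishing $(2d+1)$-form; $\Delta_\omega=\mathrm{div}_\omega\circ\mathrm{grad}$ is its macroscopic Laplacian, where $\mathrm{grad}$ is the horizontal gradient and $\mathcal L_X\omega=\mathrm{div}_\omega(X)\,\omega$. The microscopic Laplacian of $\mathcal V$ is $$ (L^{\mathcal V}\phi)(q)=\lim_{t\to0^+}\frac{2k}{t^2}\int_{\{\lambda\in T_q^*M\,:\,2H(\lambda)=1\}}\bigl(\phi(\exp_q(t,\lambda))-\phi(q)\bigr)\,d\mu_q(\lambda),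 $$ where $\{\mu_q\}_{q\in M}$ is any adapted family of probability measures: $\mu_q$ is the product of the uniform measure on the unit sphere $\{2H=1\}$ of the annihilator of $\mathcal V_q$ and a probability measure with finite second moments on the annihilator of $D_q$, and $q\mapsto\int f^2\,d\mu_q$ is continuous for every continuous fibrewise linear $f:T^*M\to\mathbb R$. Define $$\alpha=\frac{i_{X_0}d\eta}{\eta(X_0)},\qquad g=\frac{d\alpha\wedge\eta\wedge(d\eta)^{d-1}}{\eta\wedge(d\eta)^d},$$ and consider the integrability condition $$ d\alpha-dg\wedge\eta-g\,d\eta=0 . \qquad(*)$$ Then: 1. If there is a volume form $\omega$ on $M$ with $L^{\mathcal V}=\Delta_\omega$, then $(*)$ holds. 2. $(*)$ holds if and only if every point of $M$ has an open neighbourhood $U$ with a volume form $\omega$ on $U$ such that $L^{\mathcal V}=\Delta_\omega$ on $U$. 3. If $M$ is simply connected, a volume form $\omega$ on $M$ with $L^{\mathcal V}=\Delta_\omega$ exists if and only if $(*)$ holds. 4. Such a volume form is unique up to constant rescaling: if $U\subseteq M$ is open and connected (for instance $U=M$) and $\omega,\omega'$ are volume forms on $U$ with $L^{\mathcal V}=\Delta_\omega$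 on $U$, then $L^{\mathcal V}=\Delta_{\omega'}$ on $U$ if and only if $\omega'=c\,\omega$ on $U$ for a constant $c\neq0$. -/

import Mathlib

open Set Filter Topology MeasureTheory Manifold ContDiff

noncomputable section

namespace SubRiem

/-- The model space `ℝⁿ`. -/
abbrev E (n : ℕ) : Type := EuclideanSpace ℝ (Fin n)

/-- Covectors. The tangent space `TangentSpace (𝓡 n) q` of an `n`-manifold is by definition the
vector space `E n` (identified through the preferred chart at `q`), so that `Cov n` is the
cotangent space at every point. -/
abbrev Cov (n : ℕ) : Type := E n →L[ℝ] ℝ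

/-! ### Exterior algebra at a point -/

/-- The wedge product of alternating forms (sum over shuffles, so that
`(a ∧ b)(v, w) = a v * b w - a w * b v` for one-forms). -/
def wedge {W : Type*} [AddCommGroup W] [Module ℝ W] {k l : ℕ}
    (a : W [⋀^Fin k]→ₗ[ℝ] ℝ) (b : W [⋀^Fin l]→ₗ[ℝ] ℝ) : W [⋀^Fin (k + l)]→ₗ[ℝ] ℝ :=
  ((LinearMap.mul' ℝ ℝ).compAlternatingMap (a.domCoprod b)).domDomCongr finSumFinEquiv

/-- The wedge power `b ∧ ⋯ ∧ b` (`m` factors) of a two-form. -/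
def wedgePow {W : Type*} [AddCommGroup W] [Module ℝ W] (b : W [⋀^Fin 2]→ₗ[ℝ] ℝ) :
    (m : ℕ) → W [⋀^Fin (2 * m)]→ₗ[ℝ] ℝ
  | 0 => AlternatingMap.constOfIsEmpty ℝ W (Fin 0) (1 : ℝ)
  | m + 1 => wedge (wedgePow b m) b

/-- The value of a top-degree form on the standard basis. As top-degree forms are a line, the
quotient of two such values is the quotient of the two forms. -/
def topCoeff {n m : ℕ} (h : m = n) (A : E n [⋀^Fin m]→ₗ[ℝ] ℝ) : ℝ :=
  A fun i => EuclideanSpace.single (Fin.cast h i) (1 : ℝ)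

/-! ### Vector fields and differential forms on a manifold -/

section Manifold

variable {n : ℕ} {M : Type*} [TopologicalSpace M] [ChartedSpace (E n) M]

/-- The vector field `X` is smooth on `U`. -/
def SmoothFieldOn [IsManifold (𝓡 n) ∞ M] (U : Set M) (X : ∀ q : M, TangentSpace (𝓡 n) q) : Prop :=
  ContMDiffOn (𝓡 n) (𝓡 n).tangent ∞ (fun q => (⟨q, X q⟩ : TangentBundle (𝓡 n) M)) U

/-- The vector field `X` is continuous. -/
def ContinuousField [IsManifold (𝓡 n) ∞ M] (X : ∀ q : M, TangentSpace (𝓡 n) q) : Prop :=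
  Continuous fun q => (⟨q, X q⟩ : TangentBundle (𝓡 n) M)

/-- The vector field `X` in the chart at `c`. -/
def chartField (c : M) (X : ∀ q : M, TangentSpace (𝓡 n) q) (x : E n) : E n :=
  mfderiv (𝓡 n) 𝓘(ℝ, E n) (extChartAt (𝓡 n) c) ((extChartAt (𝓡 n) c).symm x)
    (X ((extChartAt (𝓡 n) c).symm x))

variable (n M) in
/-- (Not necessarily smooth) differential forms of degree `k`. -/
abbrev DForm (k : ℕ) : Type _ := ∀ q : M, TangentSpace (𝓡 n) q [⋀^Fin k]→L[ℝ] ℝ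

variable {k : ℕ}

/-- The form `Ω` in the chart at `c`, i.e. its pull-back by the inverse of the chart. -/
def chartForm (c : M) (Ω : DForm n M k) (x : E n) : E n [⋀^Fin k]→L[ℝ] ℝ :=
  (Ω ((extChartAt (𝓡 n) c).symm x)).compContinuousLinearMap
    (mfderiv 𝓘(ℝ, E n) (𝓡 n) (extChartAt (𝓡 n) c).symm x)

/-- The form `Ω` is smooth on `U`: it is so in all charts. -/
def SmoothFormOn (U : Set M) (Ω : DForm n M k) : Prop :=
  ∀ c : M, ContDiffOn ℝ ∞ (chartForm c Ω)
    ((extChartAt (𝓡 n) c).target ∩ (extChartAt (𝓡 n) c).symm ⁻¹' U)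

/-- The exterior derivative, computed at `q` in the preferred chart at `q`. -/
def extD (Ω : DForm n M k) : DForm n M (k + 1) := fun q =>
  (extDeriv (chartForm q Ω) (extChartAt (𝓡 n) q q)).compContinuousLinearMap
    (mfderiv (𝓡 n) 𝓘(ℝ, E n) (extChartAt (𝓡 n) q) q)

/-- The differential of a function at a point. -/
def dFun (f : M → ℝ) (q : M) : TangentSpace (𝓡 n) q →L[ℝ] ℝ :=
  mfderiv (𝓡 n) 𝓘(ℝ, ℝ) f q

/-- The differential of a function, as a one-form. -/
def dForm (f : M → ℝ) : DForm n M 1 := fun q =>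
  ContinuousAlternatingMap.ofSubsingleton ℝ (TangentSpace (𝓡 n) q) ℝ (0 : Fin 1) (dFun f q)

/-- The Lie derivative of the form `Ω` along the vector field `X`, evaluated on tangent vectors
`v₁, …, v_k` at `q`, by the usual coordinate formula
`(L_X Ω)(v₁, …, v_k) = (∂_X Ω)(v₁, …, v_k) + ∑ᵢ Ω(v₁, …, ∂_{vᵢ} X, …, v_k)`. -/
def lieDeriv (X : ∀ q : M, TangentSpace (𝓡 n) q) (Ω : DForm n M k) (q : M)
    (v : Fin k → TangentSpace (𝓡 n) q) : ℝ :=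
  let x : E n := extChartAt (𝓡 n) q q
  let w : Fin k → E n := fun i => mfderiv (𝓡 n) 𝓘(ℝ, E n) (extChartAt (𝓡 n) q) q (v i)
  fderiv ℝ (fun y => chartForm q Ω y w) x (chartField q X x) +
    ∑ i, chartForm q Ω x (Function.update w i (fderiv ℝ (chartField q X) x (w i)))

/-- `Ω` is a volume form on the open set `U`: a smooth nowhere vanishing form of top degree. -/
def IsVolumeOn (U : Set M) (Ω : DForm n M n) : Prop :=
  SmoothFormOn U Ω ∧ ∀ q ∈ U, Ω q ≠ 0

/-- The divergence of `X` with respect to `Ω`, i.e. the function with `L_X Ω = div_Ω(X) Ω`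
(both sides are compared on a basis of the tangent space). -/
def divergence (Ω : DForm n M n) (X : ∀ q : M, TangentSpace (𝓡 n) q) (q : M) : ℝ :=
  lieDeriv X Ω q (fun i => (EuclideanSpace.single i (1 : ℝ) : E n)) /
    Ω q (fun i => (EuclideanSpace.single i (1 : ℝ) : E n))

end Manifold

/-! ### Sub-Riemannian structures -/

instance finiteDimensionalTangentSpace {n : ℕ} {M : Type*} [TopologicalSpace M]
    [ChartedSpace (E n) M] (q : M) : FiniteDimensional ℝ (TangentSpace (𝓡 n) q) :=
  inferInstanceAs (FiniteDimensional ℝ (E n))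

/-- A smooth distribution `D` of rank `k` on an `n`-manifold with a smooth scalar product on it.
Smoothness and rank are expressed through the existence of smooth local orthonormal frames.
(The bracket-generating condition is not a field: for the contact distributions to
which this is applied it holds automatically.) -/
structure Structure (n k : ℕ) (M : Type*) [TopologicalSpace M] [ChartedSpace (E n) M]
    [IsManifold (𝓡 n) ∞ M] where
  /-- the distribution -/
  D : ∀ q : M, Submodule ℝ (TangentSpace (𝓡 n) q)
  /-- the scalar product -/
  metric : ∀ q : M, LinearMap.BilinForm ℝ (D q)
  symm : ∀ (q : M) (v w : D q), metric q v w = metric q w v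
  pos : ∀ (q : M) (v : D q), v ≠ 0 → 0 < metric q v v
  frame : ∀ q : M, ∃ U : Set M, IsOpen U ∧ q ∈ U ∧
    ∃ X : Fin k → ∀ p : M, TangentSpace (𝓡 n) p,
      (∀ i, SmoothFieldOn U (X i)) ∧
      ∀ p ∈ U, ∃ b : Module.Basis (Fin k) ℝ (D p),
        (∀ i, (b i : TangentSpace (𝓡 n) p) = X i p) ∧
        ∀ i j, metric p (b i) (b j) = if i = j then 1 else 0

namespace Structure

variable {n k : ℕ} {M : Type*} [TopologicalSpace M] [ChartedSpace (E n) M]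
  [IsManifold (𝓡 n) ∞ M] (S : Structure n k M)

theorem metric_nondegenerate (q : M) : (S.metric q).Nondegenerate := by
  refine ⟨fun v hv => ?_, fun v hv => ?_⟩
  · by_contra hne
    exact absurd (hv v) (S.pos q v hne).ne'
  · by_contra hne
    exact absurd (hv v) (S.pos q v hne).ne'

/-- For a covector `p` at `q`, the unique `ξ ∈ D_q` with `metric ξ v = p v` for all `v ∈ D_q`. -/
def sharp (q : M) (p : TangentSpace (𝓡 n) q →L[ℝ] ℝ) : TangentSpace (𝓡 n) q :=
  (((S.metric q).toDual (S.metric_nondegenerate q)).symm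
    ((p : TangentSpace (𝓡 n) q →ₗ[ℝ] ℝ).comp (S.D q).subtype) : S.D q)

/-- The horizontal gradient. -/
def hgrad (f : M → ℝ) (q : M) : TangentSpace (𝓡 n) q := S.sharp q (dFun f q)

/-- The macroscopic Laplacian `Δ_Ω = div_Ω ∘ grad`. -/
def macroLaplacian (Ω : DForm n M n) (f : M → ℝ) (q : M) : ℝ :=
  divergence Ω (S.hgrad f) q

/-- The sub-Riemannian Hamiltonian `H(p) = ½ ∑ᵢ ⟨p, Xᵢ⟩²` (for any orthonormal basis `Xᵢ` of
`D_q`), written without a basis as `½ ⟨p, ♯p⟩`. -/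
def hamiltonian (q : M) (p : TangentSpace (𝓡 n) q →L[ℝ] ℝ) : ℝ :=
  1 / 2 * p (S.sharp q p)

/-- The Hamiltonian in the canonical coordinates `(x, p)` of the cotangent bundle that are
induced by the chart at `c`. -/
def chartHamiltonian (c : M) (x : E n) (p : Cov n) : ℝ :=
  S.hamiltonian ((extChartAt (𝓡 n) c).symm x)
    (p.comp (mfderiv (𝓡 n) 𝓘(ℝ, E n) (extChartAt (𝓡 n) c) ((extChartAt (𝓡 n) c).symm x)))

/-- The coordinates `p` (induced by the chart at `c`) of a covector at the point `q`. -/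
def chartCovector (c q : M) (p : TangentSpace (𝓡 n) q →L[ℝ] ℝ) : Cov n :=
  ContinuousLinearMap.comp (p : Cov n)
    (mfderiv 𝓘(ℝ, E n) (𝓡 n) (extChartAt (𝓡 n) c).symm (extChartAt (𝓡 n) c q) : E n →L[ℝ] E n)

/-- `t ↦ (γ t, p t)`, where `p t` is a covector at `γ t`, is on `[0, T]` an integral curve of the
Hamiltonian vector field on the cotangent bundle: it satisfies Hamilton's equations
`x' = ∂H/∂p`, `p' = -∂H/∂x` in the canonical coordinates of every chart. -/
def IsNormalExtremal (T : ℝ) (γ : ℝ → M) (p : ℝ → Cov n) : Prop :=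
  ContinuousOn γ (Icc 0 T) ∧
  ∀ t ∈ Icc 0 T, ∀ c : M, γ t ∈ (chartAt (E n) c).source →
    ∃ (x' : E n) (p' : Cov n),
      HasDerivWithinAt (fun s => extChartAt (𝓡 n) c (γ s)) x' (Icc 0 T) t ∧
      HasDerivWithinAt (fun s => chartCovector c (γ s) (p s)) p' (Icc 0 T) t ∧
      (∀ β : Cov n, β x' = fderiv ℝ
        (fun r => S.chartHamiltonian c (extChartAt (𝓡 n) c (γ t)) r)
        (chartCovector c (γ t) (p t)) β) ∧
      (∀ v : E n, p' v = - fderiv ℝ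
        (fun y => S.chartHamiltonian c y (chartCovector c (γ t) (p t)))
        (extChartAt (𝓡 n) c (γ t)) v)

open Classical in
/-- The exponential map at `q`: `(t, p) ↦ γ(t)`, where `γ` is the normal geodesic with initial
covector `p`. If that geodesic is not defined up to time `t`, the value is `q` by convention. -/
def expMap (q : M) (t : ℝ) (p₀ : Cov n) : M :=
  if h : ∃ (γ : ℝ → M) (p : ℝ → Cov n), γ 0 = q ∧ p 0 = p₀ ∧ S.IsNormalExtremal t γ p
  then h.choose t else q

/-- `σ` is the uniform probability measure on the unit sphere of the space of horizontal covectors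
(the annihilator of `V_q`), which is Euclidean for the quadratic form `2H`: the image of the
normalized surface measure of the standard sphere under a linear isometry onto that space. -/
def IsUniformOnSphere (V : ∀ q : M, Submodule ℝ (TangentSpace (𝓡 n) q)) (q : M)
    (σ : Measure (Cov n)) : Prop :=
  ∃ L : E k →L[ℝ] Cov n,
    (∀ p : Cov n, (∀ v ∈ V q, p v = 0) ↔ p ∈ range L) ∧
    (∀ u, 2 * S.hamiltonian q (L u) = ‖u‖ ^ 2) ∧
    σ = Measure.map (fun u : Metric.sphere (0 : E k) 1 => L u)
      (((volume : Measure (E k)).toSphere univ)⁻¹ • (volume : Measure (E k)).toSphere)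

/-- The family of probability measures `μ_q` on the unit cylinders `{2H = 1} ⊆ T*_qM` is adapted
to the splitting `TM = D ⊕ V`: `μ_q` is the product of the uniform measure on the unit sphere of
the horizontal covectors (annihilator of `V`) and a 2-decreasing probability measure on the
vertical covectors (annihilator of `D`), and the integral of the square of a continuous fibrewise
linear function on the cotangent bundle (these are the functions `p ↦ ⟨p, X⟩`, with `X` a
continuous vector field) depends continuously on the point. -/
def IsAdapted (V : ∀ q : M, Submodule ℝ (TangentSpace (𝓡 n) q))
    (μ : M → Measure (Cov n)) : Prop :=
  (∀ q : M, ∃ σ ν : Measure (Cov n),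
    S.IsUniformOnSphere V q σ ∧
    IsProbabilityMeasure ν ∧
    (∀ᵐ p ∂ν, ∀ v ∈ S.D q, p v = 0) ∧
    (∀ w : E n, MemLp (fun p : Cov n => p w) 2 ν) ∧
    μ q = (σ.prod ν).map (fun z => z.1 + z.2)) ∧
  ∀ X : ∀ q : M, TangentSpace (𝓡 n) q, ContinuousField X →
    Continuous fun q => ∫ p, (p (X q)) ^ 2 ∂(μ q)

/-- The value at `q` of the microscopic Laplacian of `f` exists and equals `ℓ`:
`lim_{t → 0⁺} (2k / t²) ∫ (f (exp_q(t, p)) - f q) dμ_q(p) = ℓ`. -/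
def HasMicroLaplacianAt (μ : M → Measure (Cov n)) (f : M → ℝ) (q : M) (ℓ : ℝ) : Prop :=
  Tendsto (fun t : ℝ => 2 * (k : ℝ) / t ^ 2 * ∫ p, (f (S.expMap q t p) - f q) ∂(μ q))
    (𝓝[>] 0) (𝓝 ℓ)

/-- `Ω` is a volume form on the open set `U` for which the microscopic Laplacian (of the adapted
family `μ`) and the macroscopic Laplacian `Δ_Ω` agree on `U`. -/
def IsCompatibleVolumeOn (μ : M → Measure (Cov n)) (U : Set M) (Ω : DForm n M n) : Prop :=
  IsVolumeOn U Ω ∧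
  ∀ f : M → ℝ, ContMDiff (𝓡 n) 𝓘(ℝ, ℝ) ∞ f →
    ∀ q ∈ U, S.HasMicroLaplacianAt μ f q (S.macroLaplacian Ω f q)

end Structure

/-! ### Contact structures -/

section Contact

variable {d : ℕ} {M : Type*} [TopologicalSpace M] [ChartedSpace (E (2 * d + 1)) M]

/-- `η` is a global contact form for the distribution `D` of `S`: it is smooth, `D = ker η`, and
`dη` is nondegenerate on `D` (i.e. the endomorphism `J` of `D` with
`metric X (J Y) = dη(X, Y)` has trivial kernel). -/
structure IsContactForm [IsManifold (𝓡 (2 * d + 1)) ∞ M]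
    (S : Structure (2 * d + 1) (2 * d) M) (η : DForm (2 * d + 1) M 1) : Prop where
  smooth : SmoothFormOn univ η
  ker : ∀ (q : M) (v : TangentSpace (𝓡 (2 * d + 1)) q), v ∈ S.D q ↔ η q ![v] = 0
  nondegenerate : ∀ (q : M), ∀ v ∈ S.D q, (∀ w ∈ S.D q, extD η q ![v, w] = 0) → v = 0

/-- The one-form `α = i_{X₀} dη / η(X₀)`. -/
def alphaForm (η : DForm (2 * d + 1) M 1) (X₀ : ∀ q : M, TangentSpace (𝓡 (2 * d + 1)) q) :
    DForm (2 * d + 1) M 1 := fun q =>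
  (η q ![X₀ q])⁻¹ • ContinuousAlternatingMap.curryLeft (E := E (2 * d + 1)) (extD η q) (X₀ q)

/-- The function `g = (dα ∧ η ∧ (dη)^{d-1}) / (η ∧ (dη)^d)`. -/
def gFun (hd : 1 ≤ d) (η α : DForm (2 * d + 1) M 1) (q : M) : ℝ :=
  topCoeff (n := 2 * d + 1) (m := 1 + 1 + 1 + 2 * (d - 1)) (by omega)
    (wedge (wedge (extD α q).toAlternatingMap (η q).toAlternatingMap)
      (wedgePow (extD η q).toAlternatingMap (d - 1))) /
  topCoeff (n := 2 * d + 1) (m := 1 + 2 * d) (by omega)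
    (wedge (η q).toAlternatingMap (wedgePow (extD η q).toAlternatingMap d))

/-- The integrability condition `dα - dg ∧ η - g dη = 0`. -/
def IntegrabilityCondition (η α : DForm (2 * d + 1) M 1) (g : M → ℝ) : Prop :=
  ∀ q : M, (extD α q).toAlternatingMap
    - wedge (dForm (n := 2 * d + 1) g q).toAlternatingMap (η q).toAlternatingMap
    - g q • (extD η q).toAlternatingMap = 0

end Contact

end SubRiem

end

open Set Filter Topology MeasureTheory Manifold ContDiff

noncomputable section

/-! Complete a local orthonormal frame X_1, …, X_k of D by X_0, and let θ be the dual coframe of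
(X_0, …, X_k). Both Laplacians have second-order part ∑ X_i², so they agree at a point exactly when
their first-order coefficients do.

For L^V, expand φ to second order along the normal geodesics and integrate over the cylinder. Under
μ_q the momenta u_i = λ(X_i) have mean 0 and covariance δ_ij / k, and they are uncorrelated with
λ(X_0). The coefficient of X_i is therefore the sum of θ^j([X_j, X_i]) over j ≥ 1. For Δ_ω it is
div_ω X_i = X_i log |ω(X_0, …, X_k)| + ∑_a θ^a([X_a, X_i]), with a running from 0. The terms a ≥ 1
cancel, and Cartan's formula for θ^0 = η / η(X_0) turns the term a = 0 into - X_i log |η(X_0)| -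
α(X_i). With ρ = ω(X_0, …, X_k) / η(X_0), compatibility thus means that d log |ρ| = α on D
(`compatibleAt_iff`).

As D = ker η, this says d log |ρ| = α + s η for some function s. Its exterior derivative is dα + ds
∧ η + s dη = 0. Wedging with η ∧ (dη)^(d-1) kills the middle term, and η ∧ (dη)^d is nowhere zero
(`contact_power_ne_zero`), so s = -g and the identity becomes (*) (`forward_of_frame`). In
particular d log |ρ| = α - g η is the same for all compatible volumes, which gives uniqueness up to
a constant. Conversely, (*) says that α - g η is closed. If h is a primitive, η ∧ (dη)^d is rescaled
so that |ρ| = e^h (`exists_isCompatibleVolumeOn`); |ρ| does not depend on the orthonormal frame, so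
no choice of frame enters. Primitives exist locally by the Poincaré lemma and glue on a simply
connected manifold as a section of a covering space (`exists_eventually_sub_eq`).

The analytic difficulty is that the cylinder 2H = 1 is unbounded in the vertical direction. All
geodesics starting on it exist up to a common time (`exists_hamField_flow`), and the remainder of
the expansion grows at most linearly in λ (`exists_bound_flowDeriv₂`), so dominated convergence
applies (`tendsto_integral_of_expansion`). The flow is constructed in one chart; a uniqueness
argument on M identifies it with the exponential map (`expMap_eq_of_chart`). -/

namespace SubRiem

/-! ### Forms, fields and functions in charts, and their transformation under changes of chart. -/

section ChartCalculus

variable {n : ℕ} {M : Type*} [TopologicalSpace M] [ChartedSpace (E n) M]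

/-- The differential of the chart at `c`, in the preferred coordinates at `q`. -/
def dphi (c q : M) : E n →L[ℝ] E n := mfderiv (𝓡 n) 𝓘(ℝ, E n) (extChartAt (𝓡 n) c) q

/-- The differential of the inverse of the chart at `c`. -/
def dpsi (c : M) (x : E n) : E n →L[ℝ] E n :=
  mfderiv 𝓘(ℝ, E n) (𝓡 n) (extChartAt (𝓡 n) c).symm x

theorem isOpen_chart_preimage (c : M) {U : Set M} (hU : IsOpen U) :
    IsOpen ((extChartAt (𝓡 n) c).target ∩ (extChartAt (𝓡 n) c).symm ⁻¹' U) :=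
  (continuousOn_extChartAt_symm c).isOpen_inter_preimage (isOpen_extChartAt_target c) hU

theorem chart_preimage_mem_nhds {c : M} {U : Set M} (hU : IsOpen U) {x : E n}
    (hx : x ∈ (extChartAt (𝓡 n) c).target) (hxU : (extChartAt (𝓡 n) c).symm x ∈ U) :
    (extChartAt (𝓡 n) c).target ∩ (extChartAt (𝓡 n) c).symm ⁻¹' U ∈ 𝓝 x :=
  (isOpen_chart_preimage c hU).mem_nhds ⟨hx, hxU⟩

theorem target_mem_nhds {c : M} {x : E n} (hx : x ∈ (extChartAt (𝓡 n) c).target) :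
    (extChartAt (𝓡 n) c).target ∈ 𝓝 x :=
  (isOpen_extChartAt_target c).mem_nhds hx

theorem tangentMap_chartField (c : M) (X : ∀ q : M, TangentSpace (𝓡 n) q) (x : E n) :
    chartField c X x = dphi c ((extChartAt (𝓡 n) c).symm x) (X ((extChartAt (𝓡 n) c).symm x)) :=
  rfl

theorem chartForm_apply {k : ℕ} (c : M) (Ω : DForm n M k) (x : E n) (v : Fin k → E n) :
    chartForm c Ω x v = Ω ((extChartAt (𝓡 n) c).symm x) (fun i => dpsi c x (v i)) :=
  rfl

theorem mem_chart_source_of_target {c : M} {x : E n} (hx : x ∈ (extChartAt (𝓡 n) c).target) :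
    (extChartAt (𝓡 n) c).symm x ∈ (chartAt (E n) c).source := by
  rw [← extChartAt_source (𝓡 n)]
  exact (extChartAt (𝓡 n) c).map_target hx

/-- The change of coordinates from the chart at `c` to the chart at `c'`. -/
def transition (c c' : M) (x : E n) : E n := extChartAt (𝓡 n) c' ((extChartAt (𝓡 n) c).symm x)

theorem psi_transition {c c' : M} {x : E n}
    (hx' : (extChartAt (𝓡 n) c).symm x ∈ (chartAt (E n) c').source) :
    (extChartAt (𝓡 n) c').symm (transition c c' x) = (extChartAt (𝓡 n) c).symm x :=
  (extChartAt (𝓡 n) c').left_inv (by rwa [extChartAt_source])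

theorem transition_mem_target {c c' : M} {x : E n}
    (hx' : (extChartAt (𝓡 n) c).symm x ∈ (chartAt (E n) c').source) :
    transition c c' x ∈ (extChartAt (𝓡 n) c').target :=
  (extChartAt (𝓡 n) c').map_source (by rwa [extChartAt_source])

theorem SmoothFormOn.contDiffAt {k : ℕ} {U : Set M} (hU : IsOpen U) {Ω : DForm n M k}
    (hΩ : SmoothFormOn U Ω) {c : M} {x : E n} (hx : x ∈ (extChartAt (𝓡 n) c).target)
    (hxU : (extChartAt (𝓡 n) c).symm x ∈ U) : ContDiffAt ℝ ∞ (chartForm c Ω) x :=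
  (hΩ c).contDiffAt (chart_preimage_mem_nhds hU hx hxU)

variable [IsManifold (𝓡 n) ∞ M]

theorem mdifferentiableAt_psi {c : M} {x : E n} (hx : x ∈ (extChartAt (𝓡 n) c).target) :
    MDifferentiableAt 𝓘(ℝ, E n) (𝓡 n) (extChartAt (𝓡 n) c).symm x :=
  (mdifferentiableOn_extChartAt_symm x hx).mdifferentiableAt (target_mem_nhds hx)

theorem mdifferentiableAt_phi {c q : M} (hq : q ∈ (chartAt (E n) c).source) :
    MDifferentiableAt (𝓡 n) 𝓘(ℝ, E n) (extChartAt (𝓡 n) c) q :=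
  mdifferentiableAt_extChartAt hq

theorem dpsi_dphi {c : M} {x : E n} (hx : x ∈ (extChartAt (𝓡 n) c).target) (v : E n) :
    dpsi c x (dphi c ((extChartAt (𝓡 n) c).symm x) v) = v := by
  have h := mfderivWithin_extChartAt_symm_comp_mfderiv_extChartAt (I := 𝓡 n) hx
  simp only [modelWithCornersSelf_coe, range_id, mfderivWithin_univ] at h
  exact DFunLike.congr_fun h v

theorem dphi_self (q : M) : dphi q q = ContinuousLinearMap.id ℝ (E n) :=
  mfderiv_extChartAt_self

theorem dpsi_self (q : M) : dpsi q (extChartAt (𝓡 n) q q) = ContinuousLinearMap.id ℝ (E n) := by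
  have h := mfderivWithin_range_extChartAt_symm (I := 𝓡 n) (x := q)
  simp only [modelWithCornersSelf_coe, range_id, mfderivWithin_univ] at h
  exact h

theorem dpsi_chartField {c : M} {x : E n} (hx : x ∈ (extChartAt (𝓡 n) c).target)
    (X : ∀ q : M, TangentSpace (𝓡 n) q) :
    dpsi c x (chartField c X x) = X ((extChartAt (𝓡 n) c).symm x) :=
  dpsi_dphi hx _

theorem chartForm_chartField {k : ℕ} {c : M} {x : E n} (hx : x ∈ (extChartAt (𝓡 n) c).target)
    (Ω : DForm n M k) (X : Fin k → ∀ q : M, TangentSpace (𝓡 n) q) :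
    chartForm c Ω x (fun i => chartField c (X i) x) =
      Ω ((extChartAt (𝓡 n) c).symm x) (fun i => X i ((extChartAt (𝓡 n) c).symm x)) := by
  rw [chartForm_apply]
  congr 1
  funext i
  exact dpsi_chartField hx (X i)

theorem contDiffOn_transition (c c' : M) :
    ContDiffOn ℝ ∞ (transition c c') ((extChartAt (𝓡 n) c).target ∩
      (extChartAt (𝓡 n) c).symm ⁻¹' (chartAt (E n) c').source) := by
  rw [← contMDiffOn_iff_contDiffOn]
  exact (contMDiffOn_extChartAt (I := 𝓡 n) (n := ∞) (x := c')).comp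
    ((contMDiffOn_extChartAt_symm c).mono inter_subset_left) (fun x hx => hx.2)

theorem contDiffAt_transition {c c' : M} {x : E n} (hx : x ∈ (extChartAt (𝓡 n) c).target)
    (hx' : (extChartAt (𝓡 n) c).symm x ∈ (chartAt (E n) c').source) :
    ContDiffAt ℝ ∞ (transition c c') x :=
  (contDiffOn_transition c c').contDiffAt
    (chart_preimage_mem_nhds (chartAt (E n) c').open_source hx hx')

theorem fderiv_transition {c c' : M} {x : E n} (hx : x ∈ (extChartAt (𝓡 n) c).target)
    (hx' : (extChartAt (𝓡 n) c).symm x ∈ (chartAt (E n) c').source) :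
    fderiv ℝ (transition c c') x = (dphi c' ((extChartAt (𝓡 n) c).symm x)).comp (dpsi c x) := by
  rw [← mfderiv_eq_fderiv]
  exact mfderiv_comp x (mdifferentiableAt_phi hx') (mdifferentiableAt_psi hx)

theorem chartForm_transition {k : ℕ} {c c' : M} {x : E n} (hx : x ∈ (extChartAt (𝓡 n) c).target)
    (hx' : (extChartAt (𝓡 n) c).symm x ∈ (chartAt (E n) c').source) (Ω : DForm n M k) :
    chartForm c Ω x = (chartForm c' Ω (transition c c' x)).compContinuousLinearMap
      (fderiv ℝ (transition c c') x) := by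
  ext v
  rw [ContinuousAlternatingMap.compContinuousLinearMap_apply, chartForm_apply, chartForm_apply,
    fderiv_transition hx hx', psi_transition hx']
  congr 1
  funext i
  have := dpsi_dphi (transition_mem_target hx') (dpsi c x (v i))
  rw [psi_transition hx'] at this
  exact this.symm

theorem chartField_transition {c c' : M} {x : E n} (hx : x ∈ (extChartAt (𝓡 n) c).target)
    (hx' : (extChartAt (𝓡 n) c).symm x ∈ (chartAt (E n) c').source)
    (X : ∀ q : M, TangentSpace (𝓡 n) q) :
    chartField c' X (transition c c' x) = fderiv ℝ (transition c c') x (chartField c X x) := by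
  rw [fderiv_transition hx hx', ContinuousLinearMap.comp_apply, dpsi_chartField hx]
  change dphi c' ((extChartAt (𝓡 n) c').symm (transition c c' x)) _ = _
  rw [psi_transition hx']

/-- Over the chart domain at `c`, the coordinate expression of the field is the fibre component of
the section in the tangent bundle trivialization at `c`, so bundle smoothness becomes smoothness in
coordinates. -/
theorem contDiffOn_chartField (c : M) {U : Set M} {X : ∀ q : M, TangentSpace (𝓡 n) q}
    (hX : SmoothFieldOn U X) :
    ContDiffOn ℝ ∞ (chartField c X)
      ((extChartAt (𝓡 n) c).target ∩ (extChartAt (𝓡 n) c).symm ⁻¹' U) := by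
  rw [← contMDiffOn_iff_contDiffOn]
  have key : ∀ y ∈ (extChartAt (𝓡 n) c).target, chartField c X y =
      ((trivializationAt (E n) (TangentSpace (𝓡 n)) c)
        (⟨(extChartAt (𝓡 n) c).symm y, X ((extChartAt (𝓡 n) c).symm y)⟩ :
          TangentBundle (𝓡 n) M)).2 := by
    intro y hy
    have hs := mem_chart_source_of_target hy
    have := TangentBundle.continuousLinearMapAt_trivializationAt (𝕜 := ℝ) (I := 𝓡 n) hs
    rw [← Bundle.Trivialization.continuousLinearMapAt_apply_of_mem (R := ℝ)
      (trivializationAt (E n) (TangentSpace (𝓡 n)) c) hs, this]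
    rfl
  intro x hx
  have hs := mem_chart_source_of_target hx.1
  have h2 := ((trivializationAt (E n) (TangentSpace (𝓡 n)) c).contMDiffWithinAt_section
    (IB := 𝓡 n) (n := ∞) U (s := X) hs).1 (hX _ hx.2)
  have h3 := h2.comp x (((contMDiffOn_extChartAt_symm (I := 𝓡 n) (n := ∞) c) x hx.1).mono
    inter_subset_left) (fun y hy => hy.2)
  exact h3.congr (fun y hy => key y hy.1) (key x hx.1)

/-- `extD` uses a different chart at each point. Naturality of the exterior derivative under the
transition maps shows that it is nevertheless computed by any fixed chart on its whole domain. -/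
theorem chartForm_extD {k : ℕ} {U : Set M} (hU : IsOpen U) {Ω : DForm n M k}
    (hΩ : SmoothFormOn U Ω) {c : M} {x : E n} (hx : x ∈ (extChartAt (𝓡 n) c).target)
    (hxU : (extChartAt (𝓡 n) c).symm x ∈ U) :
    chartForm c (extD Ω) x = extDeriv (chartForm c Ω) x := by
  set q := (extChartAt (𝓡 n) c).symm x with hq
  have hqs : (extChartAt (𝓡 n) c).symm x ∈ (chartAt (E n) q).source := mem_chart_source _ _
  have hev : chartForm c Ω =ᶠ[𝓝 x] fun y => (chartForm q Ω (transition c q y)).compContinuousLinearMap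
      (fderiv ℝ (transition c q) y) := by
    filter_upwards [chart_preimage_mem_nhds (chartAt (E n) q).open_source hx hqs] with y hy
    exact chartForm_transition hy.1 hy.2 Ω
  have hτ : transition c q x = extChartAt (𝓡 n) q q := rfl
  have hmem : q ∈ U := hxU
  have hd : DifferentiableAt ℝ (chartForm q Ω) (transition c q x) := by
    rw [hτ]
    refine ((hΩ q).contDiffAt (chart_preimage_mem_nhds hU (mem_extChartAt_target q) ?_)).differentiableAt
      (by simp)
    rwa [extChartAt_to_inv]
  rw [hev.extDeriv_eq, extDeriv_pullback (r := ∞) hd (contDiffAt_transition hx hqs)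
      (by simpa using (ENat.LEInfty.out : (2 : WithTop ℕ∞) ≤ ∞)),
    fderiv_transition hx hqs, hτ]
  rfl

theorem SmoothFieldOn.contDiffAt {U : Set M} (hU : IsOpen U) {X : ∀ q : M, TangentSpace (𝓡 n) q}
    (hX : SmoothFieldOn U X) {c : M} {x : E n} (hx : x ∈ (extChartAt (𝓡 n) c).target)
    (hxU : (extChartAt (𝓡 n) c).symm x ∈ U) : ContDiffAt ℝ ∞ (chartField c X) x :=
  (contDiffOn_chartField c hX).contDiffAt (chart_preimage_mem_nhds hU hx hxU)

/-- The differential of a function in coordinates. -/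
theorem dFun_eq {f : M → ℝ} {c : M} {x : E n} (hx : x ∈ (extChartAt (𝓡 n) c).target)
    (hf : MDifferentiableAt (𝓡 n) 𝓘(ℝ, ℝ) f ((extChartAt (𝓡 n) c).symm x)) (v : E n) :
    dFun f ((extChartAt (𝓡 n) c).symm x) (dpsi c x v) =
      fderiv ℝ (f ∘ (extChartAt (𝓡 n) c).symm) x v := by
  rw [← mfderiv_eq_fderiv, mfderiv_comp x hf (mdifferentiableAt_psi hx)]
  rfl

theorem dFun_apply_field {f : M → ℝ} {c : M} {x : E n} (hx : x ∈ (extChartAt (𝓡 n) c).target)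
    (hf : MDifferentiableAt (𝓡 n) 𝓘(ℝ, ℝ) f ((extChartAt (𝓡 n) c).symm x))
    (X : ∀ q : M, TangentSpace (𝓡 n) q) :
    dFun f ((extChartAt (𝓡 n) c).symm x) (X ((extChartAt (𝓡 n) c).symm x)) =
      fderiv ℝ (f ∘ (extChartAt (𝓡 n) c).symm) x (chartField c X x) := by
  rw [← dFun_eq hx hf, dpsi_chartField hx]

theorem contMDiffAt_of_chart {f : M → ℝ} {c : M} {x : E n}
    (hx : x ∈ (extChartAt (𝓡 n) c).target)
    (hf : ContDiffAt ℝ ∞ (f ∘ (extChartAt (𝓡 n) c).symm) x) :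
    ContMDiffAt (𝓡 n) 𝓘(ℝ, ℝ) ∞ f ((extChartAt (𝓡 n) c).symm x) := by
  have hs := mem_chart_source_of_target hx
  have h1 : ContMDiffAt (𝓡 n) 𝓘(ℝ, ℝ) ∞ ((f ∘ (extChartAt (𝓡 n) c).symm) ∘ extChartAt (𝓡 n) c)
      ((extChartAt (𝓡 n) c).symm x) := by
    refine ContMDiffAt.comp _ (I' := 𝓘(ℝ, E n)) ?_ (contMDiffAt_extChartAt' hs)
    rw [(extChartAt (𝓡 n) c).right_inv hx]
    exact hf.contMDiffAt
  refine h1.congr_of_eventuallyEq ?_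
  filter_upwards [(chartAt (E n) c).open_source.mem_nhds hs] with y hy
  simp only [Function.comp_apply]
  rw [(extChartAt (𝓡 n) c).left_inv (by rwa [extChartAt_source])]

theorem contDiffAt_chart_of_contMDiffAt {f : M → ℝ} {c : M} {x : E n}
    (hx : x ∈ (extChartAt (𝓡 n) c).target)
    (hf : ContMDiffAt (𝓡 n) 𝓘(ℝ, ℝ) ∞ f ((extChartAt (𝓡 n) c).symm x)) :
    ContDiffAt ℝ ∞ (f ∘ (extChartAt (𝓡 n) c).symm) x := by
  rw [← contMDiffAt_iff_contDiffAt]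
  exact hf.comp x (((contMDiffOn_extChartAt_symm (I := 𝓡 n) (n := ∞) c) x hx).contMDiffAt
    (target_mem_nhds hx))

end ChartCalculus

/-! ### The Hamiltonian flow in coordinates, up to a time uniform over the unit cylinder. -/

section HamiltonianODE

variable {F : Type*} [NormedAddCommGroup F] [NormedSpace ℝ F] {k : ℕ}

theorem exists_lipschitzOnWith_of_contDiffOn {G G' : Type*} [NormedAddCommGroup G]
    [NormedSpace ℝ G] [NormedAddCommGroup G'] [NormedSpace ℝ G'] {f : G → G'} {s K : Set G}
    (hs : IsOpen s) (hf : ContDiffOn ℝ 1 f s) (hK : IsCompact K) (hKs : K ⊆ s) :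
    ∃ C, LipschitzOnWith C f K := by
  refine LocallyLipschitzOn.exists_lipschitzOnWith_of_compact hK fun x hx => ?_
  obtain ⟨C, t, ht, hC⟩ := (hf.contDiffAt (hs.mem_nhds (hKs hx))).exists_lipschitzOnWith
  exact ⟨C, t, mem_nhdsWithin_of_mem_nhds ht, hC⟩

/-- The Hamiltonian vector field of `½ ∑ᵢ ⟨p, Yᵢ⟩²`. -/
def hamField (Y : Fin k → F → F) (z : F × (F →L[ℝ] ℝ)) : F × (F →L[ℝ] ℝ) :=
  (∑ i, z.2 (Y i z.1) • Y i z.1, -∑ i, z.2 (Y i z.1) • z.2.comp (fderiv ℝ (Y i) z.1))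

/-- Twice the Hamiltonian. -/
def energy (Y : Fin k → F → F) (z : F × (F →L[ℝ] ℝ)) : ℝ := ∑ i, z.2 (Y i z.1) ^ 2

/-- The velocity of the Hamiltonian flow, for covectors scaled by `s` and with a modified speed
that agrees with the original one on the unit cylinder and is bounded. -/
def boundedSpeed (Y : Fin k → F → F) (s : ℝ) (z : F × (F →L[ℝ] ℝ)) (i : Fin k) : ℝ :=
  2 * (1 + energy Y (z.1, s • z.2))⁻¹ * (s * z.2 (Y i z.1))

/-- The scaled Hamiltonian field with bounded speed. -/
def boundedField (Y : Fin k → F → F) (s : ℝ) (z : F × (F →L[ℝ] ℝ)) : F × (F →L[ℝ] ℝ) :=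
  (∑ i, boundedSpeed Y s z i • Y i z.1, -∑ i, boundedSpeed Y s z i • z.2.comp (fderiv ℝ (Y i) z.1))

theorem energy_nonneg (Y : Fin k → F → F) (z : F × (F →L[ℝ] ℝ)) : 0 ≤ energy Y z :=
  Finset.sum_nonneg fun _ _ => sq_nonneg _

/-- The energy dominates the square of each momentum x, and 2|x| ≤ 1 + x². The bound does not depend
on the scale `s`, which is what makes the existence time uniform. -/
theorem abs_boundedSpeed_le (Y : Fin k → F → F) (s : ℝ) (z : F × (F →L[ℝ] ℝ)) (i : Fin k) :
    |boundedSpeed Y s z i| ≤ 1 := by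
  have h0 := energy_nonneg Y (z.1, s • z.2)
  have h1 : (s * z.2 (Y i z.1)) ^ 2 ≤ energy Y (z.1, s • z.2) := by
    have := Finset.single_le_sum (f := fun j => ((s • z.2) (Y j z.1)) ^ 2)
      (fun j _ => sq_nonneg _) (Finset.mem_univ i)
    simpa [energy] using this
  rw [boundedSpeed, mul_right_comm, ← div_eq_mul_inv, abs_div, 
    abs_of_pos (by linarith : 0 < 1 + energy Y (z.1, s • z.2)),
    div_le_one (by linarith), abs_le]
  constructor <;> nlinarith [sq_nonneg (s * z.2 (Y i z.1) - 1), sq_nonneg (s * z.2 (Y i z.1) + 1)]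

theorem contDiffOn_boundedField {Y : Fin k → F → F} {V : Set F} (hV : IsOpen V)
    (hY : ∀ i, ContDiffOn ℝ ∞ (Y i) V) (s : ℝ) :
    ContDiffOn ℝ ∞ (boundedField Y s) (V ×ˢ univ) := by
  have hm : MapsTo (Prod.fst : F × (F →L[ℝ] ℝ) → F) (V ×ˢ univ) V := fun z hz => hz.1
  have h1 : ∀ i, ContDiffOn ℝ ∞ (fun z : F × (F →L[ℝ] ℝ) => Y i z.1) (V ×ˢ univ) :=
    fun i => (hY i).comp contDiffOn_fst hm
  have h2 : ∀ i, ContDiffOn ℝ ∞ (fun z : F × (F →L[ℝ] ℝ) => fderiv ℝ (Y i) z.1) (V ×ˢ univ) :=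
    fun i => ((hY i).fderiv_of_isOpen hV (by simp)).comp contDiffOn_fst hm
  have h3 : ∀ i, ContDiffOn ℝ ∞ (fun z : F × (F →L[ℝ] ℝ) => z.2 (Y i z.1)) (V ×ˢ univ) :=
    fun i => contDiffOn_snd.clm_apply (h1 i)
  have h4 : ContDiffOn ℝ ∞ (fun z : F × (F →L[ℝ] ℝ) => energy Y (z.1, s • z.2)) (V ×ˢ univ) := by
    unfold energy
    refine ContDiffOn.sum fun i _ => ContDiffOn.pow ?_ 2
    exact (contDiffOn_const (c := s)).mul (h3 i)
  have h5 : ∀ i, ContDiffOn ℝ ∞ (fun z : F × (F →L[ℝ] ℝ) => boundedSpeed Y s z i) (V ×ˢ univ) := by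
    intro i
    unfold boundedSpeed
    refine ContDiffOn.mul (contDiffOn_const.mul (ContDiffOn.inv (contDiffOn_const.add h4) ?_))
      (contDiffOn_const.mul (h3 i))
    intro z _
    have := energy_nonneg Y (z.1, s • z.2)
    positivity
  unfold boundedField
  refine ContDiffOn.prodMk (ContDiffOn.sum fun i _ => (h5 i).smul (h1 i))
    (ContDiffOn.neg (ContDiffOn.sum fun i _ => (h5 i).smul (contDiffOn_snd.clm_comp (h2 i))))

theorem contDiffOn_hamField {Y : Fin k → F → F} {V : Set F} (hV : IsOpen V)
    (hY : ∀ i, ContDiffOn ℝ ∞ (Y i) V) :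
    ContDiffOn ℝ ∞ (hamField Y) (V ×ˢ univ) := by
  have hm : MapsTo (Prod.fst : F × (F →L[ℝ] ℝ) → F) (V ×ˢ univ) V := fun z hz => hz.1
  have h1 : ∀ i, ContDiffOn ℝ ∞ (fun z : F × (F →L[ℝ] ℝ) => Y i z.1) (V ×ˢ univ) :=
    fun i => (hY i).comp contDiffOn_fst hm
  have h2 : ∀ i, ContDiffOn ℝ ∞ (fun z : F × (F →L[ℝ] ℝ) => fderiv ℝ (Y i) z.1) (V ×ˢ univ) :=
    fun i => ((hY i).fderiv_of_isOpen hV (by simp)).comp contDiffOn_fst hm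
  have h3 : ∀ i, ContDiffOn ℝ ∞ (fun z : F × (F →L[ℝ] ℝ) => z.2 (Y i z.1)) (V ×ˢ univ) :=
    fun i => contDiffOn_snd.clm_apply (h1 i)
  unfold hamField
  exact ContDiffOn.prodMk (ContDiffOn.sum fun i _ => (h3 i).smul (h1 i))
    (ContDiffOn.neg (ContDiffOn.sum fun i _ => (h3 i).smul (contDiffOn_snd.clm_comp (h2 i))))

/-- A curve whose velocity is bounded as long as it stays in a ball stays in the ball. -/
theorem exists_integralCurves {G : Type*} [NormedAddCommGroup G] [NormedSpace ℝ G]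
    [CompleteSpace G] {f : G → G} {z₀ : G} {a L ε : ℝ} (ha : 0 < a) (hε : 0 ≤ ε)
    (hL : 0 ≤ L) (hLε : L * ε ≤ a / 2) {K : NNReal}
    (hf : LipschitzOnWith K f (Metric.closedBall z₀ a))
    (hb : ∀ z ∈ Metric.closedBall z₀ a, ‖f z‖ ≤ L) :
    ∃ α : G → ℝ → G, (∀ z ∈ Metric.closedBall z₀ (a / 2), α z 0 = z ∧
      ∀ t ∈ Icc 0 ε, HasDerivWithinAt (α z) (f (α z t)) (Icc 0 ε) t ∧
        α z t ∈ Metric.closedBall z₀ a) ∧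
      ∀ t ∈ Icc 0 ε, ContinuousOn (α · t) (Metric.closedBall z₀ (a / 2)) := by
  classical
  -- Extending the field by zero gives a bound valid everywhere, so the mean value inequality can be
  -- used before the curve is known to stay in the ball; afterwards `f'` and `f` agree along it.
  set f' : G → G := fun z => if z ∈ Metric.closedBall z₀ a then f z else 0 with hf'
  have hfe : ∀ z ∈ Metric.closedBall z₀ a, f' z = f z := fun z hz => by simp only [hf', if_pos hz]
  have hb' : ∀ z, ‖f' z‖ ≤ L := by
    intro z
    by_cases hz : z ∈ Metric.closedBall z₀ a
    · rw [hfe z hz]; exact hb z hz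
    · simp only [hf', if_neg hz, norm_zero]; exact hL
  have hPL : IsPicardLindelof (fun _ => f') (tmin := 0) (tmax := ε) ⟨0, left_mem_Icc.2 hε⟩ z₀
      ⟨a, ha.le⟩ ⟨a / 2, by positivity⟩ ⟨L, hL⟩ K := by
    refine ⟨fun t _ x hx y hy => ?_, fun x _ => continuousOn_const, fun t _ x _ => hb' x, ?_⟩
    · rw [hfe x hx, hfe y hy]; exact hf hx hy
    · simp only [sub_zero, sub_self, max_eq_left hε]
      change L * ε ≤ a - a / 2
      linarith
  obtain ⟨α, hα, L', hL'⟩ :=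
    hPL.exists_forall_mem_closedBall_eq_hasDerivWithinAt_lipschitzOnWith
  refine ⟨α, fun z hz => ?_, fun t ht => (hL' t ht).continuousOn⟩
  obtain ⟨h0, h1⟩ := hα z hz
  have h0' : α z 0 = z := h0
  have hmem : ∀ t ∈ Icc 0 ε, α z t ∈ Metric.closedBall z₀ a := by
    intro t ht
    have h2 := norm_image_sub_le_of_norm_deriv_le_segment' h1 (fun x _ => hb' _) t ht
    rw [h0', sub_zero] at h2
    rw [Metric.mem_closedBall, dist_eq_norm] at hz ⊢
    have h3 : α z t - z₀ = (α z t - z) + (z - z₀) := by abel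
    have h4 : L * t ≤ L * ε := mul_le_mul_of_nonneg_left ht.2 hL
    have h5 : ‖z - z₀‖ ≤ a / 2 := hz
    calc ‖α z t - z₀‖ ≤ ‖α z t - z‖ + ‖z - z₀‖ := by rw [h3]; exact norm_add_le _ _
      _ ≤ a := by linarith
  refine ⟨h0', fun t ht => ⟨?_, hmem t ht⟩⟩
  rw [← hfe _ (hmem t ht)]
  exact h1 t ht

/-- The derivative is a double sum antisymmetric in the two frame indices, hence zero. The common
factor `c` does not disturb the antisymmetry, so the energy is also conserved by the flow with
modified speed. -/
theorem hasDerivWithinAt_energy {Y : Fin k → F → F} {w : Fin k → ℝ} {s : Set ℝ} {t : ℝ}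
    {z : ℝ → F × (F →L[ℝ] ℝ)} (hY : ∀ i, DifferentiableAt ℝ (Y i) (z t).1) {c : ℝ}
    (hw : ∀ i, w i = c * (z t).2 (Y i (z t).1))
    (hz : HasDerivWithinAt z (∑ i, w i • Y i (z t).1,
      -∑ i, w i • (z t).2.comp (fderiv ℝ (Y i) (z t).1)) s t) :
    HasDerivWithinAt (fun r => energy Y (z r)) 0 s t := by
  have hx := hasFDerivAt_fst.comp_hasDerivWithinAt t hz
  have hp := hasFDerivAt_snd.comp_hasDerivWithinAt t hz
  have h1 : ∀ i, HasDerivWithinAt (fun r => (z r).2 (Y i (z r).1))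
      ((-∑ j, w j • (z t).2.comp (fderiv ℝ (Y j) (z t).1)) (Y i (z t).1) +
        (z t).2 (fderiv ℝ (Y i) (z t).1 (∑ j, w j • Y j (z t).1))) s t := by
    intro i
    have := hp.clm_apply ((hY i).hasFDerivAt.comp_hasDerivWithinAt t hx)
    exact this
  have h2 := HasDerivWithinAt.fun_sum (u := Finset.univ) (fun i _ => (h1 i).pow 2)
  refine h2.congr_deriv ?_
  have h3 : ∀ i, ((-∑ j, w j • (z t).2.comp (fderiv ℝ (Y j) (z t).1)) (Y i (z t).1) +
        (z t).2 (fderiv ℝ (Y i) (z t).1 (∑ j, w j • Y j (z t).1))) =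
      ∑ j, c * (z t).2 (Y j (z t).1) * ((z t).2 (fderiv ℝ (Y i) (z t).1 (Y j (z t).1)) -
        (z t).2 (fderiv ℝ (Y j) (z t).1 (Y i (z t).1))) := by
    intro i
    simp only [map_sum, map_smul, _root_.neg_apply, _root_.sum_apply,
      _root_.smul_apply, ContinuousLinearMap.comp_apply, smul_eq_mul, hw]
    rw [neg_add_eq_sub, ← Finset.sum_sub_distrib]
    exact Finset.sum_congr rfl fun j _ => by ring
  simp only [h3]
  have h4 : ∀ A : Fin k → Fin k → ℝ, (∀ i j, A i j = -A j i) → ∑ i, ∑ j, A i j = 0 := by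
    intro A hA
    have : ∑ i, ∑ j, A i j = -∑ i, ∑ j, A i j := by
      conv_lhs => rw [Finset.sum_comm]
      rw [← Finset.sum_neg_distrib]
      refine Finset.sum_congr rfl fun i _ => ?_
      rw [← Finset.sum_neg_distrib]
      exact Finset.sum_congr rfl fun j _ => hA _ _
    linarith
  simp only [Finset.mul_sum]
  apply h4
  intro i j
  push_cast
  ring

variable [FiniteDimensional ℝ F]

/-- The Hamiltonian flow on the unit cylinder over a point exists up to a time that does not
depend on the initial covector. -/
theorem exists_hamField_flow {Y : Fin k → F → F} {V : Set F} (hV : IsOpen V)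
    (hY : ∀ i, ContDiffOn ℝ ∞ (Y i) V) {x₀ : F} (hx₀ : x₀ ∈ V) :
    ∃ ε > 0, ∃ a > 0, Metric.closedBall x₀ a ⊆ V ∧ ∀ R > 0, ∃ α : (F →L[ℝ] ℝ) → ℝ → F × (F →L[ℝ] ℝ),
      (∀ p : F →L[ℝ] ℝ, ‖p‖ ≤ R → energy Y (x₀, p) = 1 → α p 0 = (x₀, p) ∧
        ∀ t ∈ Icc 0 ε, HasDerivWithinAt (α p) (hamField Y (α p t)) (Icc 0 ε) t ∧
          (α p t).1 ∈ Metric.closedBall x₀ a ∧ ‖(α p t).2‖ ≤ 2 * R ∧ energy Y (α p t) = 1) ∧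
      ∀ t ∈ Icc 0 ε, ContinuousOn (α · t) {p | ‖p‖ ≤ R ∧ energy Y (x₀, p) = 1} := by
  obtain ⟨a, ha, haV⟩ := Metric.nhds_basis_closedBall.mem_iff.1 (hV.mem_nhds hx₀)
  have hcomp : IsCompact (Metric.closedBall x₀ a) := isCompact_closedBall x₀ a
  have hbd : ∃ C, 0 ≤ C ∧ ∀ i, ∀ x ∈ Metric.closedBall x₀ a, ‖Y i x‖ ≤ C ∧ ‖fderiv ℝ (Y i) x‖ ≤ C := by
    have h1 : ∀ i, ∃ C, ∀ x ∈ Metric.closedBall x₀ a, ‖Y i x‖ ≤ C :=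
      fun i => hcomp.exists_bound_of_continuousOn ((hY i).continuousOn.mono haV)
    have h2 : ∀ i, ∃ C, ∀ x ∈ Metric.closedBall x₀ a, ‖fderiv ℝ (Y i) x‖ ≤ C :=
      fun i => hcomp.exists_bound_of_continuousOn
        (((hY i).continuousOn_fderiv_of_isOpen hV (by simp)).mono haV)
    choose C1 hC1 using h1
    choose C2 hC2 using h2
    refine ⟨∑ i, (|C1 i| + |C2 i|), by positivity, fun i x hx => ?_⟩
    have h3 : |C1 i| + |C2 i| ≤ ∑ i, (|C1 i| + |C2 i|) :=
      Finset.single_le_sum (f := fun i => |C1 i| + |C2 i|) (fun j _ => by positivity)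
        (Finset.mem_univ i)
    constructor
    · linarith [hC1 i x hx, le_abs_self (C1 i), abs_nonneg (C2 i)]
    · linarith [hC2 i x hx, le_abs_self (C2 i), abs_nonneg (C1 i)]
  obtain ⟨C, hC0, hC⟩ := hbd
  -- With speeds at most 1 and covectors of norm at most `a`, the two components are bounded by `k *
  -- C` and `k * C * a`; the last `+ 1` only makes `L` positive.
  set L : ℝ := k * C * (1 + a) + 1 with hL
  have hL0 : 0 < L := by positivity
  have hbound : ∀ s, ∀ z ∈ Metric.closedBall ((x₀, 0) : F × (F →L[ℝ] ℝ)) a,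
      ‖boundedField Y s z‖ ≤ L := by
    intro s z hz
    rw [← closedBall_prod_same] at hz
    have hz2 : ‖z.2‖ ≤ a := by simpa using hz.2
    have hk : (k : ℝ) * C * (1 + a) = ∑ i : Fin k, C * (1 + a) := by simp [mul_assoc]
    refine max_le ?_ ?_
    · calc ‖∑ i, boundedSpeed Y s z i • Y i z.1‖ ≤ ∑ i : Fin k, C * (1 + a) := by
            refine norm_sum_le_of_le _ fun i _ => ?_
            rw [norm_smul]
            have := mul_le_mul (abs_boundedSpeed_le Y s z i) (hC i z.1 hz.1).1 (norm_nonneg _)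
              zero_le_one
            rw [Real.norm_eq_abs]
            nlinarith
        _ ≤ L := by linarith
    · change ‖-∑ i, boundedSpeed Y s z i • z.2.comp (fderiv ℝ (Y i) z.1)‖ ≤ L
      rw [norm_neg]
      calc ‖∑ i, boundedSpeed Y s z i • z.2.comp (fderiv ℝ (Y i) z.1)‖
          ≤ ∑ i : Fin k, C * (1 + a) := by
            refine norm_sum_le_of_le _ fun i _ => ?_
            rw [norm_smul]
            have h1 : ‖z.2.comp (fderiv ℝ (Y i) z.1)‖ ≤ a * C :=
              (ContinuousLinearMap.opNorm_comp_le _ _).trans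
                (mul_le_mul hz2 (hC i z.1 hz.1).2 (norm_nonneg _) ha.le)
            have := mul_le_mul (abs_boundedSpeed_le Y s z i) h1 (norm_nonneg _)
              zero_le_one
            rw [Real.norm_eq_abs]
            nlinarith
        _ ≤ L := by linarith
  -- The time is chosen before `R`: since `L` does not depend on the scale, it serves covectors of
  -- every size.
  refine ⟨a / (2 * L), by positivity, a, ha, haV, fun R hR => ?_⟩
  set ε := a / (2 * L) with hε
  -- Dividing covectors of norm at most `R` by `s` brings them into the ball of radius `a / 2`.
  -- Multiplying back from the ball of radius `a` gives the bound `s * a = 2 * R`.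
  set s : ℝ := 2 * R / a with hs
  have hs0 : 0 < s := by positivity
  obtain ⟨K, hK⟩ := exists_lipschitzOnWith_of_contDiffOn (hV.prod isOpen_univ)
    ((contDiffOn_boundedField hV hY s).of_le (by simp))
    (isCompact_closedBall ((x₀, 0) : F × (F →L[ℝ] ℝ)) a) (by
      rw [← closedBall_prod_same]
      exact prod_mono haV (subset_univ _))
  obtain ⟨β, hβ, hβc⟩ := exists_integralCurves (ε := ε) ha (by positivity) hL0.le
    (by rw [hε]; field_simp; rfl) hK (hbound s)
  have hinit : ∀ p : F →L[ℝ] ℝ, ‖p‖ ≤ R →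
      (x₀, s⁻¹ • p) ∈ Metric.closedBall ((x₀, 0) : F × (F →L[ℝ] ℝ)) (a / 2) := by
    intro p hp
    rw [← closedBall_prod_same]
    refine ⟨Metric.mem_closedBall_self (by positivity), ?_⟩
    rw [mem_closedBall_zero_iff, norm_smul, norm_inv, Real.norm_of_nonneg hs0.le, hs, inv_div,
      div_mul_eq_mul_div, div_le_iff₀ (by positivity)]
    nlinarith
  refine ⟨fun p t => ((β (x₀, s⁻¹ • p) t).1, s • (β (x₀, s⁻¹ • p) t).2), fun p hp hE => ?_, ?_⟩
  · obtain ⟨h0, h1⟩ := hβ _ (hinit p hp)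
    set b := β (x₀, s⁻¹ • p) with hb
    have hsc : ∀ t ∈ Icc 0 ε, HasDerivWithinAt (fun t => ((b t).1, s • (b t).2))
        (∑ i, boundedSpeed Y s (b t) i • Y i (b t).1,
          -∑ i, boundedSpeed Y s (b t) i • (s • (b t).2).comp (fderiv ℝ (Y i) (b t).1))
        (Icc 0 ε) t := by
      intro t ht
      have hx := hasFDerivAt_fst.comp_hasDerivWithinAt t (h1 t ht).1
      have hp := hasFDerivAt_snd.comp_hasDerivWithinAt t (h1 t ht).1
      have := hx.prodMk (hp.const_smul s)
      refine this.congr_deriv ?_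
      refine Prod.ext rfl ?_
      change s • (-∑ i, boundedSpeed Y s (b t) i • (b t).2.comp (fderiv ℝ (Y i) (b t).1)) = _
      rw [smul_neg, Finset.smul_sum]
      refine congrArg Neg.neg (Finset.sum_congr rfl fun i _ => ?_)
      rw [ContinuousLinearMap.smul_comp, smul_comm]
    have hmem : ∀ t ∈ Icc 0 ε, (b t).1 ∈ Metric.closedBall x₀ a ∧ ‖(b t).2‖ ≤ a := by
      intro t ht
      have := (h1 t ht).2
      rw [← closedBall_prod_same] at this
      exact ⟨this.1, by simpa using this.2⟩
    have hen : ∀ t ∈ Icc 0 ε, energy Y ((b t).1, s • (b t).2) = 1 := by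
      intro t ht
      have hd : ∀ r ∈ Icc 0 ε, HasDerivWithinAt (fun t => energy Y ((b t).1, s • (b t).2)) 0
          (Icc 0 ε) r := by
        intro r hr
        refine hasDerivWithinAt_energy (z := fun t => ((b t).1, s • (b t).2)) (w := boundedSpeed Y s (b r))
          (c := 2 * (1 + energy Y ((b r).1, s • (b r).2))⁻¹) ?_ ?_ (hsc r hr)
        · exact fun i => ((hY i).contDiffAt (hV.mem_nhds (haV (hmem r hr).1))).differentiableAt
            (by simp)
        · intro i
          rfl
      have h2 := norm_image_sub_le_of_norm_deriv_le_segment' hd (C := 0)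
        (fun x _ => by simp) t ht
      rw [zero_mul, norm_le_zero_iff, sub_eq_zero] at h2
      rw [h2, h0]
      simpa [smul_smul, hs0.ne'] using hE
    refine ⟨?_, fun t ht => ⟨?_, (hmem t ht).1, ?_, hen t ht⟩⟩
    · change ((b 0).1, s • (b 0).2) = _
      rw [h0]
      simp [smul_smul, hs0.ne']
    · refine (hsc t ht).congr_deriv ?_
      -- At energy 1 the factor `2 * (1 + energy)⁻¹` is 1, so along this curve the modified field is
      -- the Hamiltonian field.
      have hsp : ∀ i, boundedSpeed Y s (b t) i = (s • (b t).2) (Y i (b t).1) := by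
        intro i
        rw [boundedSpeed, hen t ht]
        simp
        norm_num
      simp only [hsp]
      rfl
    · change ‖s • (b t).2‖ ≤ _
      rw [norm_smul, Real.norm_of_nonneg hs0.le, hs, div_mul_eq_mul_div, div_le_iff₀ ha]
      have := (hmem t ht).2
      nlinarith
  · intro t ht
    have h1 : ContinuousOn (fun p : F →L[ℝ] ℝ => β (x₀, s⁻¹ • p) t)
        {p | ‖p‖ ≤ R ∧ energy Y (x₀, p) = 1} := by
      refine (hβc t ht).comp (f := fun p : F →L[ℝ] ℝ => ((x₀, s⁻¹ • p) : F × (F →L[ℝ] ℝ)))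
        (by fun_prop) fun p hp => hinit p hp.1
    exact (continuous_fst.comp_continuousOn h1).prodMk
      ((continuous_const_smul s).comp_continuousOn (continuous_snd.comp_continuousOn h1))

end HamiltonianODE

/-! ### Orthonormal frames and Hamilton's equations on the manifold. -/

section Frames

variable {n k : ℕ} {M : Type*} [TopologicalSpace M] [ChartedSpace (E n) M]
  [IsManifold (𝓡 n) ∞ M]

/-- `X` is a smooth orthonormal frame of the distribution on `U`. -/
structure IsOrthoFrame (S : Structure n k M) (U : Set M)
    (X : Fin k → ∀ p : M, TangentSpace (𝓡 n) p) : Prop where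
  smooth : ∀ i, SmoothFieldOn U (X i)
  basis : ∀ p ∈ U, ∃ b : Module.Basis (Fin k) ℝ (S.D p),
    (∀ i, (b i : TangentSpace (𝓡 n) p) = X i p) ∧
      ∀ i j, S.metric p (b i) (b j) = if i = j then 1 else 0

variable {S : Structure n k M} {U : Set M} {X : Fin k → ∀ p : M, TangentSpace (𝓡 n) p}

theorem sharp_eq_sum {p : M} (b : Module.Basis (Fin k) ℝ (S.D p))
    (hb : ∀ i j, S.metric p (b i) (b j) = if i = j then 1 else 0)
    (ξ : TangentSpace (𝓡 n) p →L[ℝ] ℝ) :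
    S.sharp p ξ = ∑ i, ξ (b i) • (b i : TangentSpace (𝓡 n) p) := by
  have h : ((S.metric p).toDual (S.metric_nondegenerate p)).symm
      ((ξ : TangentSpace (𝓡 n) p →ₗ[ℝ] ℝ).comp (S.D p).subtype) = ∑ i, ξ (b i) • b i := by
    rw [LinearEquiv.symm_apply_eq]
    refine b.ext fun j => ?_
    simp [LinearMap.BilinForm.toDual_def, hb]
  rw [Structure.sharp, h]
  simp

namespace IsOrthoFrame

variable (hX : IsOrthoFrame S U X)
include hX

theorem mem_D {p : M} (hp : p ∈ U) (i : Fin k) : X i p ∈ S.D p := by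
  obtain ⟨b, hb, -⟩ := hX.basis p hp
  rw [← hb]
  exact (b i).2

theorem sharp_eq {p : M} (hp : p ∈ U) (ξ : TangentSpace (𝓡 n) p →L[ℝ] ℝ) :
    S.sharp p ξ = ∑ i, ξ (X i p) • X i p := by
  obtain ⟨b, hb, hb'⟩ := hX.basis p hp
  rw [sharp_eq_sum b hb']
  simp only [hb]

theorem hamiltonian_eq {p : M} (hp : p ∈ U) (ξ : TangentSpace (𝓡 n) p →L[ℝ] ℝ) :
    S.hamiltonian p ξ = 1 / 2 * ∑ i, ξ (X i p) ^ 2 := by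
  rw [Structure.hamiltonian, hX.sharp_eq hp, map_sum]
  simp only [map_smul, smul_eq_mul, sq]

theorem chartHamiltonian_eq {c : M} {x : E n} (hxU : (extChartAt (𝓡 n) c).symm x ∈ U) (r : Cov n) :
    S.chartHamiltonian c x r = 1 / 2 * ∑ i, r (chartField c (X i) x) ^ 2 := by
  rw [Structure.chartHamiltonian, hX.hamiltonian_eq hxU]
  rfl

end IsOrthoFrame

theorem hasFDerivAt_half_sum_sq {G : Type*} [NormedAddCommGroup G] [NormedSpace ℝ G]
    {u : Fin k → G → ℝ} {u' : Fin k → G →L[ℝ] ℝ} {x : G}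
    (hu : ∀ i, HasFDerivAt (u i) (u' i) x) :
    HasFDerivAt (fun y => 1 / 2 * ∑ i, u i y ^ 2) (∑ i, u i x • u' i) x := by
  have h := (HasFDerivAt.fun_sum (u := Finset.univ) fun i _ => (hu i).pow 2).const_mul (1 / 2 : ℝ)
  refine h.congr_fderiv ?_
  ext v
  simp only [_root_.smul_apply, _root_.sum_apply, smul_eq_mul, Finset.mul_sum]
  exact Finset.sum_congr rfl fun i _ => by push_cast; ring

theorem fderiv_chartHamiltonian_momentum (hX : IsOrthoFrame S U X) {c : M} {x : E n}
    (hxU : (extChartAt (𝓡 n) c).symm x ∈ U) (r β : Cov n) :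
    fderiv ℝ (fun r => S.chartHamiltonian c x r) r β =
      β (∑ i, r (chartField c (X i) x) • chartField c (X i) x) := by
  have h : (fun r => S.chartHamiltonian c x r) =
      fun r : Cov n => 1 / 2 * ∑ i, r (chartField c (X i) x) ^ 2 :=
    funext fun r => hX.chartHamiltonian_eq hxU r
  have h2 := hasFDerivAt_half_sum_sq (x := r) (u := fun i (r : Cov n) => r (chartField c (X i) x))
    (u' := fun i => ContinuousLinearMap.apply ℝ ℝ (chartField c (X i) x))
    (fun i => (ContinuousLinearMap.apply ℝ ℝ (chartField c (X i) x)).hasFDerivAt)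
  rw [h, h2.fderiv]
  simp

theorem fderiv_chartHamiltonian_position (hU : IsOpen U) (hX : IsOrthoFrame S U X) {c : M} {x : E n}
    (hx : x ∈ (extChartAt (𝓡 n) c).target) (hxU : (extChartAt (𝓡 n) c).symm x ∈ U)
    (r : Cov n) (v : E n) :
    fderiv ℝ (fun y => S.chartHamiltonian c y r) x v =
      ∑ i, r (chartField c (X i) x) * r (fderiv ℝ (chartField c (X i)) x v) := by
  have h : (fun y => S.chartHamiltonian c y r) =ᶠ[𝓝 x]
      fun y => 1 / 2 * ∑ i, r (chartField c (X i) y) ^ 2 := by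
    filter_upwards [chart_preimage_mem_nhds hU hx hxU] with y hy
    exact hX.chartHamiltonian_eq hy.2 r
  have h2 := hasFDerivAt_half_sum_sq (x := x) (u := fun i y => r (chartField c (X i) y))
    (u' := fun i => r.comp (fderiv ℝ (chartField c (X i)) x))
    (fun i => r.hasFDerivAt.comp x
      (((hX.smooth i).contDiffAt hU hx hxU).differentiableAt (by simp)).hasFDerivAt)
  rw [h.fderiv_eq, h2.fderiv]
  simp

/-- A curve of covectors in the coordinates of a chart. -/
def cotangentCoord (c : M) (γ : ℝ → M) (p : ℝ → Cov n) (s : ℝ) : E n × Cov n :=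
  (extChartAt (𝓡 n) c (γ s), Structure.chartCovector c (γ s) (p s))

/-- In a frame, Hamilton's equations in one chart become an ordinary differential equation for a
smooth field; continuous functionals separate points, so testing against all `β` determines the
velocity. -/
theorem exists_hamilton_iff (hU : IsOpen U) (hX : IsOrthoFrame S U X) {c : M} {γ : ℝ → M}
    {p : ℝ → Cov n} {I : Set ℝ} {t : ℝ} (hc : γ t ∈ (chartAt (E n) c).source) (htU : γ t ∈ U) :
    (∃ (x' : E n) (p' : Cov n),
      HasDerivWithinAt (fun s => extChartAt (𝓡 n) c (γ s)) x' I t ∧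
      HasDerivWithinAt (fun s => Structure.chartCovector c (γ s) (p s)) p' I t ∧
      (∀ β : Cov n, β x' = fderiv ℝ
        (fun r => S.chartHamiltonian c (extChartAt (𝓡 n) c (γ t)) r)
        (Structure.chartCovector c (γ t) (p t)) β) ∧
      (∀ v : E n, p' v = - fderiv ℝ
        (fun y => S.chartHamiltonian c y (Structure.chartCovector c (γ t) (p t)))
        (extChartAt (𝓡 n) c (γ t)) v)) ↔
    HasDerivWithinAt (cotangentCoord c γ p)
      (hamField (fun i => chartField c (X i)) (cotangentCoord c γ p t)) I t := by
  have hc' : γ t ∈ (extChartAt (𝓡 n) c).source := by rwa [extChartAt_source]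
  have hx := (extChartAt (𝓡 n) c).map_source hc'
  have hxU : (extChartAt (𝓡 n) c).symm (extChartAt (𝓡 n) c (γ t)) ∈ U := by
    rwa [(extChartAt (𝓡 n) c).left_inv hc']
  constructor
  · rintro ⟨x', p', h1, h2, h3, h4⟩
    have hx' : x' = (hamField (fun i => chartField c (X i)) (cotangentCoord c γ p t)).1 := by
      refine (SeparatingDual.eq_iff_forall_dual_eq (R := ℝ)).2 fun β => ?_
      rw [h3 β, fderiv_chartHamiltonian_momentum hX hxU]
      rfl
    have hp' : p' = (hamField (fun i => chartField c (X i)) (cotangentCoord c γ p t)).2 := by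
      ext v
      rw [h4 v, fderiv_chartHamiltonian_position hU hX hx hxU]
      simp [hamField, cotangentCoord]
    have := h1.prodMk h2
    rw [hx', hp'] at this
    exact this
  · intro h
    have h1 := hasFDerivAt_fst.comp_hasDerivWithinAt t h
    have h2 := hasFDerivAt_snd.comp_hasDerivWithinAt t h
    refine ⟨_, _, h1, h2, fun β => ?_, fun v => ?_⟩
    · rw [fderiv_chartHamiltonian_momentum hX hxU]
      rfl
    · rw [fderiv_chartHamiltonian_position hU hX hx hxU]
      simp [hamField, cotangentCoord]

theorem hamField_fst {F : Type*} [NormedAddCommGroup F] [NormedSpace ℝ F] (Y : Fin k → F → F)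
    (z : F × (F →L[ℝ] ℝ)) : (hamField Y z).1 = ∑ i, z.2 (Y i z.1) • Y i z.1 :=
  rfl

theorem hamField_snd_apply {F : Type*} [NormedAddCommGroup F] [NormedSpace ℝ F]
    (Y : Fin k → F → F) (z : F × (F →L[ℝ] ℝ)) (v : F) :
    (hamField Y z).2 v = -∑ i, z.2 (Y i z.1) * z.2 (fderiv ℝ (Y i) z.1 v) := by
  simp [hamField]

/-- Hamilton's equations are invariant under a change of coordinates. -/
theorem hasDerivWithinAt_hamField_change (hU : IsOpen U) (hX : IsOrthoFrame S U X) {c q : M}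
    {z : ℝ → E n × Cov n} {I : Set ℝ} {t : ℝ}
    (hzt : (z t).1 ∈ (extChartAt (𝓡 n) q).target)
    (hzU : (extChartAt (𝓡 n) q).symm (z t).1 ∈ U)
    (hc : (extChartAt (𝓡 n) q).symm (z t).1 ∈ (chartAt (E n) c).source)
    (hz : HasDerivWithinAt z (hamField (fun i => chartField q (X i)) (z t)) I t) :
    HasDerivWithinAt (fun s => (transition q c (z s).1,
        (z s).2.comp (fderiv ℝ (transition c q) (transition q c (z s).1))))
      (hamField (fun i => chartField c (X i)) (transition q c (z t).1,
        (z t).2.comp (fderiv ℝ (transition c q) (transition q c (z t).1)))) I t := by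
  set y := transition q c (z t).1 with hy
  have hyt : y ∈ (extChartAt (𝓡 n) c).target := transition_mem_target hc
  have hyψ : (extChartAt (𝓡 n) c).symm y = (extChartAt (𝓡 n) q).symm (z t).1 := psi_transition hc
  have hyU : (extChartAt (𝓡 n) c).symm y ∈ U := by rwa [hyψ]
  have hyq : (extChartAt (𝓡 n) c).symm y ∈ (chartAt (E n) q).source := by
    rw [hyψ]; exact mem_chart_source_of_target hzt
  have hτy : transition c q y = (z t).1 := by
    rw [transition, hyψ, (extChartAt (𝓡 n) q).right_inv hzt]
  have hx := hasFDerivAt_fst.comp_hasDerivWithinAt t hz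
  have hp := hasFDerivAt_snd.comp_hasDerivWithinAt t hz
  have hτ := contDiffAt_transition hzt hc
  have hσ := contDiffAt_transition hyt hyq
  have h1 : HasDerivWithinAt (fun s => transition q c (z s).1)
      (fderiv ℝ (transition q c) (z t).1 (hamField (fun i => chartField q (X i)) (z t)).1) I t :=
    HasFDerivAt.comp_hasDerivWithinAt (f := Prod.fst ∘ z) t
      (hτ.differentiableAt (by simp)).hasFDerivAt hx
  have hu : ∀ i, (z t).2 (chartField q (X i) (z t).1) =
      ((z t).2.comp (fderiv ℝ (transition c q) y)) (chartField c (X i) y) := by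
    intro i
    rw [ContinuousLinearMap.comp_apply, ← chartField_transition hyt hyq, hτy]
  have hy' : fderiv ℝ (transition q c) (z t).1 (hamField (fun i => chartField q (X i)) (z t)).1 =
      (hamField (fun i => chartField c (X i))
        (y, (z t).2.comp (fderiv ℝ (transition c q) y))).1 := by
    simp only [hamField, map_sum, map_smul, hu]
    refine Finset.sum_congr rfl fun i _ => ?_
    rw [← chartField_transition hzt hc]
  rw [hy'] at h1
  have hσ2 : HasFDerivAt (fderiv ℝ (transition c q)) (fderiv ℝ (fderiv ℝ (transition c q)) y) y :=
    ((hσ.fderiv_right (m := ∞) (by simp)).differentiableAt (by simp)).hasFDerivAt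
  have h2 := hp.clm_comp (hσ2.comp_hasDerivWithinAt t h1)
  refine h1.prodMk (h2.congr_deriv ?_)
  have hsymm : IsSymmSndFDerivAt ℝ (transition c q) y :=
    hσ.isSymmSndFDerivAt (by simpa using (ENat.LEInfty.out : (2 : WithTop ℕ∞) ≤ ∞))
  -- Differentiating the transformation law of the frame fields produces second derivatives of the
  -- transition map. By symmetry of these derivatives, they cancel the ones that come from
  -- differentiating the transformed covector.
  have hD : ∀ i w, fderiv ℝ (chartField q (X i)) (z t).1 (fderiv ℝ (transition c q) y w) =
      fderiv ℝ (fderiv ℝ (transition c q)) y w (chartField c (X i) y) +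
        fderiv ℝ (transition c q) y (fderiv ℝ (chartField c (X i)) y w) := by
    intro i w
    have hev : (fun v => chartField q (X i) (transition c q v)) =ᶠ[𝓝 y]
        fun v => fderiv ℝ (transition c q) v (chartField c (X i) v) := by
      filter_upwards [chart_preimage_mem_nhds (chartAt (E n) q).open_source hyt hyq] with v hv
      exact chartField_transition hv.1 hv.2 (X i)
    have hq : HasFDerivAt (chartField q (X i)) (fderiv ℝ (chartField q (X i)) (z t).1)
        (transition c q y) := by
      rw [hτy]
      exact (((hX.smooth i).contDiffAt hU hzt hzU).differentiableAt (by simp)).hasFDerivAt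
    have e1 := hq.comp y (hσ.differentiableAt (by simp)).hasFDerivAt
    have e2 := hσ2.clm_apply
      (((hX.smooth i).contDiffAt hU hyt hyU).differentiableAt (by simp)).hasFDerivAt
    have e3 := (e2.congr_of_eventuallyEq hev).unique e1
    have := DFunLike.congr_fun e3 w
    simp only [ContinuousLinearMap.comp_apply, _root_.add_apply,
      ContinuousLinearMap.flip_apply] at this
    rw [← this, add_comm]
  ext w
  change (hamField (fun i => chartField q (X i)) (z t)).2 (fderiv ℝ (transition c q) y w) +
    (z t).2 (fderiv ℝ (fderiv ℝ (transition c q)) y (hamField (fun i => chartField c (X i))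
      (y, (z t).2.comp (fderiv ℝ (transition c q) y))).1 w) =
    (hamField (fun i => chartField c (X i))
      (y, (z t).2.comp (fderiv ℝ (transition c q) y))).2 w
  rw [hamField_snd_apply, hamField_snd_apply]
  simp only [hD, hu, map_add, mul_add, Finset.sum_add_distrib, hamField_fst, map_sum, map_smul,
    _root_.sum_apply, _root_.smul_apply, smul_eq_mul, ContinuousLinearMap.comp_apply]
  have hs : ∀ i, fderiv ℝ (fderiv ℝ (transition c q)) y (chartField c (X i) y) w =
      fderiv ℝ (fderiv ℝ (transition c q)) y w (chartField c (X i) y) :=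
    fun i => hsymm (chartField c (X i) y) w
  simp only [hs]
  ring

end Frames

/-! ### The exponential map computed in a chart. -/

section ExponentialMap

variable {n k : ℕ} {M : Type*} [TopologicalSpace M] [ChartedSpace (E n) M]
  [IsManifold (𝓡 n) ∞ M]
variable {S : Structure n k M} {U : Set M} {X : Fin k → ∀ p : M, TangentSpace (𝓡 n) p}

/-- The definition asks for Hamilton's equations in every chart that meets the curve; their
invariance under coordinate changes supplies this from the solution in a single chart. -/
theorem isNormalExtremal_of_chart (hU : IsOpen U) (hX : IsOrthoFrame S U X) {q : M} {T : ℝ}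
    {z : ℝ → E n × Cov n}
    (hz : ∀ t ∈ Icc 0 T, HasDerivWithinAt z (hamField (fun i => chartField q (X i)) (z t))
      (Icc 0 T) t)
    (hzt : ∀ t ∈ Icc 0 T, (z t).1 ∈ (extChartAt (𝓡 n) q).target ∧
      (extChartAt (𝓡 n) q).symm (z t).1 ∈ U) :
    S.IsNormalExtremal T (fun t => (extChartAt (𝓡 n) q).symm (z t).1)
      (fun t => (z t).2.comp (dphi q ((extChartAt (𝓡 n) q).symm (z t).1))) := by
  have hzc : ContinuousOn (fun t => (z t).1) (Icc 0 T) :=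
    continuous_fst.comp_continuousOn fun t ht => (hz t ht).continuousWithinAt
  have hγ : ContinuousOn (fun t => (extChartAt (𝓡 n) q).symm (z t).1) (Icc 0 T) :=
    (continuousOn_extChartAt_symm q).comp hzc fun t ht => (hzt t ht).1
  refine ⟨hγ, fun t ht c hc => ?_⟩
  rw [exists_hamilton_iff hU hX hc (hzt t ht).2]
  have h := hasDerivWithinAt_hamField_change hU hX (hzt t ht).1 (hzt t ht).2 hc (hz t ht)
  have heq : ∀ s ∈ Icc 0 T, (extChartAt (𝓡 n) q).symm (z s).1 ∈ (chartAt (E n) c).source →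
      cotangentCoord c (fun t => (extChartAt (𝓡 n) q).symm (z t).1)
        (fun t => (z t).2.comp (dphi q ((extChartAt (𝓡 n) q).symm (z t).1))) s =
      (transition q c (z s).1,
        (z s).2.comp (fderiv ℝ (transition c q) (transition q c (z s).1))) := by
    intro s hs hsc
    refine Prod.ext rfl ?_
    have hq : (extChartAt (𝓡 n) c).symm (transition q c (z s).1) ∈ (chartAt (E n) q).source := by
      rw [psi_transition hsc]; exact mem_chart_source_of_target (hzt s hs).1
    change ((z s).2.comp (dphi q ((extChartAt (𝓡 n) q).symm (z s).1))).comp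
      (dpsi c (transition q c (z s).1)) = _
    rw [fderiv_transition (transition_mem_target hsc) hq, psi_transition hsc]
    rfl
  have hev : ∀ᶠ s in 𝓝[Icc 0 T] t,
      (extChartAt (𝓡 n) q).symm (z s).1 ∈ (chartAt (E n) c).source :=
    (hγ t ht).eventually ((chartAt (E n) c).open_source.mem_nhds hc)
  rw [← heq t ht hc] at h
  refine h.congr_of_eventuallyEq ?_ (heq t ht hc)
  filter_upwards [hev, self_mem_nhdsWithin] with s hs hs'
  exact heq s hs' hs

/-- An arbitrary extremal is not known in advance to stay in the chart, so uniqueness for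
differential equations cannot be applied at once. The set of times where the curves and covectors
agree is closed, contains 0 and can be prolonged to the right, hence is the whole interval. -/
theorem extremal_unique [T2Space M] (hU : IsOpen U) (hX : IsOrthoFrame S U X) {q : M} {T : ℝ}
    {z : ℝ → E n × Cov n}
    (hz : ∀ t ∈ Icc 0 T, HasDerivWithinAt z (hamField (fun i => chartField q (X i)) (z t))
      (Icc 0 T) t)
    (hzt : ∀ t ∈ Icc 0 T, (z t).1 ∈ (extChartAt (𝓡 n) q).target ∧
      (extChartAt (𝓡 n) q).symm (z t).1 ∈ U)
    {γ : ℝ → M} {p : ℝ → Cov n} (hγ : S.IsNormalExtremal T γ p) (hγ0 : γ 0 = q)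
    (hz0 : z 0 = (extChartAt (𝓡 n) q q, p 0)) :
    ∀ t ∈ Icc 0 T, γ t = (extChartAt (𝓡 n) q).symm (z t).1 := by
  intro t₁ ht₁
  have hT : (0 : ℝ) ≤ T := ht₁.1.trans ht₁.2
  set w := cotangentCoord q γ p with hw
  have hw' : ∀ t ∈ Icc 0 T, γ t ∈ (chartAt (E n) q).source → γ t ∈ U →
      HasDerivWithinAt w (hamField (fun i => chartField q (X i)) (w t)) (Icc 0 T) t :=
    fun t ht h1 h2 => (exists_hamilton_iff hU hX h1 h2).1 (hγ.2 t ht q h1)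
  have hzc : ContinuousOn z (Icc 0 T) := fun t ht => (hz t ht).continuousWithinAt
  have hψc : ContinuousOn (fun t => (extChartAt (𝓡 n) q).symm (z t).1) (Icc 0 T) :=
    (continuousOn_extChartAt_symm q).comp (continuous_fst.comp_continuousOn hzc)
      fun t ht => (hzt t ht).1
  set A : Set ℝ := {t | γ t = (extChartAt (𝓡 n) q).symm (z t).1 ∧ (w t).2 = (z t).2} with hA
  have hAs : ∀ t ∈ Icc 0 T, γ t = (extChartAt (𝓡 n) q).symm (z t).1 →
      γ t ∈ (chartAt (E n) q).source ∧ γ t ∈ U ∧ (w t).1 = (z t).1 := by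
    intro t ht h
    refine ⟨?_, ?_, ?_⟩
    · rw [h]; exact mem_chart_source_of_target (hzt t ht).1
    · rw [h]; exact (hzt t ht).2
    · change extChartAt (𝓡 n) q (γ t) = _
      rw [h, (extChartAt (𝓡 n) q).right_inv (hzt t ht).1]
  suffices h : Icc 0 T ⊆ A from (h ht₁).1
  refine IsClosed.Icc_subset_of_forall_mem_nhdsWithin ?_ ?_ ?_
  · rw [← isSeqClosed_iff_isClosed]
    intro u t hu hut
    have ht : t ∈ Icc 0 T := isClosed_Icc.mem_of_tendsto hut (Eventually.of_forall fun m => (hu m).2)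
    have hut' : Tendsto u atTop (𝓝[Icc 0 T] t) :=
      tendsto_nhdsWithin_iff.2 ⟨hut, Eventually.of_forall fun m => (hu m).2⟩
    -- The base points are compared first, using that `M` is Hausdorff. This puts `γ t` in the
    -- chart, where the coordinate covector is continuous and can be compared as well.
    have h1 : γ t = (extChartAt (𝓡 n) q).symm (z t).1 := by
      refine tendsto_nhds_unique ((hγ.1 t ht).tendsto.comp hut') ?_
      refine ((hψc t ht).tendsto.comp hut').congr fun m => ?_
      exact ((hu m).1.1).symm
    obtain ⟨h2, h3, -⟩ := hAs t ht h1
    have hwc := ((hw' t ht h2 h3).continuousWithinAt).tendsto.comp hut'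
    refine ⟨⟨h1, ?_⟩, ht⟩
    refine tendsto_nhds_unique ((continuous_snd.tendsto _).comp hwc) ?_
    refine ((continuous_snd.tendsto _).comp ((hzc t ht).tendsto.comp hut')).congr fun m => ?_
    exact ((hu m).1.2).symm
  · have e1 : γ 0 = (extChartAt (𝓡 n) q).symm (z 0).1 := by
      rw [hz0, hγ0]
      exact (extChartAt_to_inv (I := 𝓡 n) q).symm
    have e2 : (w 0).2 = (z 0).2 := by
      rw [hz0]
      change (Structure.chartCovector (n := n) q (γ 0) (p 0)) = p 0
      rw [hγ0]
      change (p 0).comp (dpsi q (extChartAt (𝓡 n) q q)) = p 0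
      rw [dpsi_self, ContinuousLinearMap.comp_id]
    exact ⟨e1, e2⟩
  · rintro t ⟨htA, ht⟩
    have ht' : t ∈ Icc 0 T := Ico_subset_Icc_self ht
    obtain ⟨h2, h3, h4⟩ := hAs t ht' htA.1
    have hwz : w t = z t := Prod.ext h4 htA.2
    have hV := isOpen_chart_preimage (n := n) q hU
    obtain ⟨K, N, hN, hK⟩ := ((contDiffOn_hamField hV fun i =>
      contDiffOn_chartField q (hX.smooth i)).contDiffAt ((hV.prod isOpen_univ).mem_nhds
        (x := z t) ⟨hzt t ht', mem_univ _⟩)).of_le (m := 1) (by simp) |>.exists_lipschitzOnWith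
    have hle : 𝓝[≥] t ≤ 𝓝[Icc 0 T] t := by
      refine nhdsWithin_le_iff.2 ?_
      filter_upwards [Icc_mem_nhdsGE_of_mem ht] with s hs using hs
    have e1 : ∀ᶠ s in 𝓝[≥] t, γ s ∈ (chartAt (E n) q).source :=
      ((hγ.1 t ht').mono_left hle).eventually ((chartAt (E n) q).open_source.mem_nhds h2)
    have e2 : ∀ᶠ s in 𝓝[≥] t, γ s ∈ U :=
      ((hγ.1 t ht').mono_left hle).eventually (hU.mem_nhds h3)
    have e3 : ∀ᶠ s in 𝓝[≥] t, z s ∈ N := ((hzc t ht').mono_left hle).eventually hN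
    have e4 : ∀ᶠ s in 𝓝[≥] t, w s ∈ N := by
      refine (((hw' t ht' h2 h3).continuousWithinAt).tendsto.mono_left hle).eventually ?_
      rw [hwz]; exact hN
    obtain ⟨b, hb, hbs⟩ := mem_nhdsGE_iff_exists_Icc_subset.1
      (e1.and (e2.and (e3.and (e4.and (Icc_mem_nhdsGE_of_mem ht)))))
    have hsub : ∀ s ∈ Ico t b, ∀ v : ℝ → E n × Cov n,
        HasDerivWithinAt v (hamField (fun i => chartField q (X i)) (v s)) (Icc 0 T) s →
        HasDerivWithinAt v (hamField (fun i => chartField q (X i)) (v s)) (Ici s) s := by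
      intro s hs v hv
      have h5 := (hbs (right_mem_Icc.2 (le_of_lt hb))).2.2.2.2
      exact hv.mono_of_mem_nhdsWithin (Icc_mem_nhdsGE_of_mem
        ⟨ht.1.trans hs.1, hs.2.trans_le h5.2⟩)
    have huniq : EqOn w z (Icc t b) := by
      refine ODE_solution_unique_of_mem_Icc_right (v := fun _ => hamField fun i => chartField q (X i))
        (s := fun _ => N) (K := K) (fun _ _ => hK) ?_ ?_ ?_ ?_ ?_ ?_ hwz
      · intro s hs
        have h5 := hbs hs
        exact (hw' s h5.2.2.2.2 h5.1 h5.2.1).continuousWithinAt.mono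
          fun r hr => (hbs hr).2.2.2.2
      · intro s hs
        have h5 := hbs (Ico_subset_Icc_self hs)
        exact hsub s hs w (hw' s h5.2.2.2.2 h5.1 h5.2.1)
      · exact fun s hs => (hbs (Ico_subset_Icc_self hs)).2.2.2.1
      · exact fun s hs => ((hzc s (hbs hs).2.2.2.2)).mono fun r hr => (hbs hr).2.2.2.2
      · exact fun s hs => hsub s hs z (hz s (hbs (Ico_subset_Icc_self hs)).2.2.2.2)
      · exact fun s hs => (hbs (Ico_subset_Icc_self hs)).2.2.1
    filter_upwards [mem_of_superset (Ioo_mem_nhdsGT hb) Ioo_subset_Icc_self] with s hs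
    have h5 := huniq hs
    refine ⟨?_, by rw [h5]⟩
    have h6 : extChartAt (𝓡 n) q (γ s) = (z s).1 := by rw [← h5]; rfl
    rw [← h6, (extChartAt (𝓡 n) q).left_inv]
    rw [extChartAt_source]
    exact (hbs hs).1

/-- `expMap` follows an extremal obtained by choice; uniqueness makes the choice irrelevant, and the
chart solution excludes the default value `q`. -/
theorem expMap_eq_of_chart [T2Space M] (hU : IsOpen U) (hX : IsOrthoFrame S U X) {q : M} {T : ℝ}
    {z : ℝ → E n × Cov n} {p₀ : Cov n}
    (hz : ∀ t ∈ Icc 0 T, HasDerivWithinAt z (hamField (fun i => chartField q (X i)) (z t))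
      (Icc 0 T) t)
    (hzt : ∀ t ∈ Icc 0 T, (z t).1 ∈ (extChartAt (𝓡 n) q).target ∧
      (extChartAt (𝓡 n) q).symm (z t).1 ∈ U)
    (hz0 : z 0 = (extChartAt (𝓡 n) q q, p₀)) {t : ℝ} (ht : t ∈ Icc 0 T) :
    S.expMap q t p₀ = (extChartAt (𝓡 n) q).symm (z t).1 := by
  have hsub : Icc 0 t ⊆ Icc 0 T := Icc_subset_Icc_right ht.2
  have hz' : ∀ s ∈ Icc 0 t, HasDerivWithinAt z (hamField (fun i => chartField q (X i)) (z s))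
      (Icc 0 t) s := fun s hs => (hz s (hsub hs)).mono hsub
  have hex : ∃ (γ : ℝ → M) (p : ℝ → Cov n), γ 0 = q ∧ p 0 = p₀ ∧ S.IsNormalExtremal t γ p := by
    refine ⟨_, _, ?_, ?_, isNormalExtremal_of_chart hU hX hz' fun s hs => hzt s (hsub hs)⟩
    · simp only [hz0]
      exact extChartAt_to_inv q
    · simp only [hz0]
      rw [extChartAt_to_inv, dphi_self, ContinuousLinearMap.comp_id]
  rw [Structure.expMap, dif_pos hex]
  obtain ⟨p, h1, h2, h3⟩ := hex.choose_spec
  exact extremal_unique hU hX hz' (fun s hs => hzt s (hsub hs)) h3 h1 (by rw [hz0, h2]) t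
    (right_mem_Icc.2 ht.1)

end ExponentialMap

/-! ### Second-order Taylor estimates on one side of 0. -/

theorem abs_second_order_remainder_le {y v w : ℝ → ℝ} {ε B : ℝ}
    (hy : ∀ t ∈ Icc 0 ε, HasDerivWithinAt y (v t) (Icc 0 ε) t)
    (hv : ∀ t ∈ Icc 0 ε, HasDerivWithinAt v (w t) (Icc 0 ε) t)
    (hw : ∀ t ∈ Icc 0 ε, |w t| ≤ B) {t : ℝ} (ht : t ∈ Icc 0 ε) :
    |y t - y 0 - t * v 0| ≤ B * t ^ 2 := by
  have hsub : Icc 0 t ⊆ Icc 0 ε := Icc_subset_Icc_right ht.2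
  have h0 : (0 : ℝ) ∈ Icc 0 ε := ⟨le_rfl, ht.1.trans ht.2⟩
  have hB : 0 ≤ B := (abs_nonneg _).trans (hw 0 h0)
  have h1 : ∀ s ∈ Icc 0 t, HasDerivWithinAt (fun r => y r - r * v 0) (v s - 1 * v 0) (Icc 0 t) s :=
    fun s hs => ((hy s (hsub hs)).mono hsub).sub ((hasDerivWithinAt_id s _).mul_const _)
  have h2 : ∀ s ∈ Ico 0 t, ‖v s - 1 * v 0‖ ≤ B * t := by
    intro s hs
    have := norm_image_sub_le_of_norm_deriv_le_segment' hv (fun x hx => hw x (Ico_subset_Icc_self hx))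
      s (hsub (Ico_subset_Icc_self hs))
    rw [one_mul]
    refine this.trans (mul_le_mul_of_nonneg_left ?_ hB)
    linarith [hs.2]
  have h3 := norm_image_sub_le_of_norm_deriv_le_segment' h1 h2 t (right_mem_Icc.2 ht.1)
  rw [Real.norm_eq_abs] at h3
  have h4 : y t - y 0 - t * v 0 = y t - t * v 0 - (y 0 - 0 * v 0) := by ring
  rw [h4]
  refine h3.trans (le_of_eq ?_)
  ring

/-- Only the derivative of `v` at 0 is used: after subtracting the quadratic polynomial, the
velocity is o(s), and the mean value inequality on [0, t] makes the remainder o(t²). -/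
theorem tendsto_second_order_remainder {y v : ℝ → ℝ} {w ε : ℝ} (hε : 0 < ε)
    (hy : ∀ t ∈ Icc 0 ε, HasDerivWithinAt y (v t) (Icc 0 ε) t)
    (hv : HasDerivWithinAt v w (Icc 0 ε) 0) :
    Tendsto (fun t => (y t - y 0 - t * v 0) / t ^ 2) (𝓝[>] 0) (𝓝 (w / 2)) := by
  rw [Metric.tendsto_nhds]
  intro δ hδ
  have h1 := (hasDerivWithinAt_iff_isLittleO.1 hv).bound (half_pos hδ)
  rw [nhdsWithin_Icc_eq_nhdsGE hε] at h1
  obtain ⟨b, hb, hbs⟩ := mem_nhdsGE_iff_exists_Icc_subset.1 (h1.and (Icc_mem_nhdsGE hε))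
  have hb' : (0 : ℝ) < b := hb
  filter_upwards [Ioc_mem_nhdsGT hb'] with t ht
  have hsub : Icc 0 t ⊆ Icc 0 ε :=
    fun s hs => (hbs ⟨hs.1, hs.2.trans ht.2⟩).2
  have h2 : ∀ s ∈ Icc 0 t, HasDerivWithinAt (fun r => y r - r * v 0 - r ^ 2 * (w / 2))
      (v s - 1 * v 0 - (2 * s ^ 1 * 1) * (w / 2)) (Icc 0 t) s :=
    fun s hs => (((hy s (hsub hs)).mono hsub).sub ((hasDerivWithinAt_id s _).mul_const _)).sub
      (((hasDerivWithinAt_id s _).pow 2).mul_const _)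
  have h3 : ∀ s ∈ Ico 0 t, ‖v s - 1 * v 0 - (2 * s ^ 1 * 1) * (w / 2)‖ ≤ δ / 2 * t := by
    intro s hs
    have h4 := (hbs ⟨hs.1, hs.2.le.trans ht.2⟩).1
    simp only [sub_zero, smul_eq_mul, Real.norm_eq_abs, abs_of_nonneg hs.1] at h4
    rw [Real.norm_eq_abs]
    have h5 : v s - 1 * v 0 - (2 * s ^ 1 * 1) * (w / 2) = v s - v 0 - s * w := by ring
    rw [h5]
    exact h4.trans (mul_le_mul_of_nonneg_left hs.2.le (by positivity))
  have h6 := norm_image_sub_le_of_norm_deriv_le_segment' h2 h3 t (right_mem_Icc.2 ht.1.le)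
  have ht0 : 0 < t := ht.1
  have h7 : (y t - y 0 - t * v 0) / t ^ 2 - w / 2 =
      (y t - t * v 0 - t ^ 2 * (w / 2) - (y 0 - 0 * v 0 - 0 ^ 2 * (w / 2))) / t ^ 2 := by
    field_simp
    ring
  rw [Real.dist_eq, h7, abs_div, abs_of_pos (by positivity : 0 < t ^ 2), div_lt_iff₀ (by positivity)]
  rw [Real.norm_eq_abs, sub_zero] at h6
  refine h6.trans_lt ?_
  nlinarith [mul_pos hδ (mul_pos ht0 ht0)]

/-! ### The first two derivatives of a function along the Hamiltonian flow. -/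

section AlongFlow

variable {F : Type*} [NormedAddCommGroup F] [NormedSpace ℝ F] {k : ℕ}

/-- The derivative of `f` along the Hamiltonian flow. -/
def flowDeriv (Y : Fin k → F → F) (f : F → ℝ) (z : F × (F →L[ℝ] ℝ)) : ℝ :=
  ∑ i, z.2 (Y i z.1) * fderiv ℝ f z.1 (Y i z.1)

/-- The second derivative of `f` along the Hamiltonian flow. -/
def flowDeriv₂ (Y : Fin k → F → F) (f : F → ℝ) (z : F × (F →L[ℝ] ℝ)) : ℝ :=
  ∑ i, ∑ j, (z.2 (Y j z.1) * z.2 (fderiv ℝ (Y i) z.1 (Y j z.1) - fderiv ℝ (Y j) z.1 (Y i z.1)) *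
      fderiv ℝ f z.1 (Y i z.1) +
    z.2 (Y i z.1) * z.2 (Y j z.1) *
      fderiv ℝ (fun x => fderiv ℝ f x (Y i x)) z.1 (Y j z.1))

variable {Y : Fin k → F → F} {V : Set F} {f : F → ℝ}

theorem contDiffOn_fderiv_apply (hV : IsOpen V) (hY : ∀ i, ContDiffOn ℝ ∞ (Y i) V)
    (hf : ContDiffOn ℝ ∞ f V) (i : Fin k) : ContDiffOn ℝ ∞ (fun x => fderiv ℝ f x (Y i x)) V :=
  (hf.fderiv_of_isOpen hV (by simp)).clm_apply (hY i)

theorem hasDerivWithinAt_flow (hV : IsOpen V) (hf : ContDiffOn ℝ ∞ f V)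
    {z : ℝ → F × (F →L[ℝ] ℝ)} {I : Set ℝ} {t : ℝ} (hzV : (z t).1 ∈ V)
    (hz : HasDerivWithinAt z (hamField Y (z t)) I t) :
    HasDerivWithinAt (fun s => f (z s).1) (flowDeriv Y f (z t)) I t := by
  have hx := hasFDerivAt_fst.comp_hasDerivWithinAt t hz
  have h := HasFDerivAt.comp_hasDerivWithinAt (f := Prod.fst ∘ z) t
    ((hf.contDiffAt (hV.mem_nhds hzV)).differentiableAt (by simp)).hasFDerivAt hx
  refine h.congr_deriv ?_
  change fderiv ℝ f (z t).1 (hamField Y (z t)).1 = _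
  rw [hamField_fst, map_sum]
  simp only [map_smul, smul_eq_mul]
  rfl

theorem hasDerivWithinAt_flowDeriv (hV : IsOpen V) (hY : ∀ i, ContDiffOn ℝ ∞ (Y i) V)
    (hf : ContDiffOn ℝ ∞ f V)
    {z : ℝ → F × (F →L[ℝ] ℝ)} {I : Set ℝ} {t : ℝ} (hzV : (z t).1 ∈ V)
    (hz : HasDerivWithinAt z (hamField Y (z t)) I t) :
    HasDerivWithinAt (fun s => flowDeriv Y f (z s)) (flowDeriv₂ Y f (z t)) I t := by
  have hx := hasFDerivAt_fst.comp_hasDerivWithinAt t hz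
  have hp := hasFDerivAt_snd.comp_hasDerivWithinAt t hz
  have h1 : ∀ i, HasDerivWithinAt (fun r => (z r).2 (Y i (z r).1))
      ((hamField Y (z t)).2 (Y i (z t).1) +
        (z t).2 (fderiv ℝ (Y i) (z t).1 (hamField Y (z t)).1)) I t := fun i =>
    hp.clm_apply (HasFDerivAt.comp_hasDerivWithinAt (f := Prod.fst ∘ z) t
      (((hY i).contDiffAt (hV.mem_nhds hzV)).differentiableAt (by simp)).hasFDerivAt hx)
  have h2 : ∀ i, HasDerivWithinAt (fun r => fderiv ℝ f (z r).1 (Y i (z r).1))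
      (fderiv ℝ (fun x => fderiv ℝ f x (Y i x)) (z t).1 (hamField Y (z t)).1) I t := fun i =>
    HasFDerivAt.comp_hasDerivWithinAt (f := Prod.fst ∘ z) t
      (((contDiffOn_fderiv_apply hV hY hf i).contDiffAt
        (hV.mem_nhds hzV)).differentiableAt (by simp)).hasFDerivAt hx
  have h3 := HasDerivWithinAt.fun_sum (u := Finset.univ) (fun i _ => (h1 i).mul (h2 i))
  refine h3.congr_deriv ?_
  unfold flowDeriv₂
  refine Finset.sum_congr rfl fun i _ => ?_
  rw [hamField_snd_apply, hamField_fst, map_sum, map_sum, map_sum, neg_add_eq_sub,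
    ← Finset.sum_sub_distrib, Finset.sum_mul, Finset.mul_sum, ← Finset.sum_add_distrib]
  refine Finset.sum_congr rfl fun j _ => ?_
  simp only [map_smul, smul_eq_mul, map_sub]
  ring

theorem abs_apply_le_one_of_energy {z : F × (F →L[ℝ] ℝ)} (hz : energy Y z = 1) (i : Fin k) :
    |z.2 (Y i z.1)| ≤ 1 := by
  have := Finset.single_le_sum (f := fun j => z.2 (Y j z.1) ^ 2)
    (fun j _ => sq_nonneg _) (Finset.mem_univ i)
  rw [← sq_le_one_iff_abs_le_one]
  exact this.trans hz.le

/-- On the unit cylinder every momentum is at most 1 in absolute value, so only the factor pairing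
the covector with a Lie bracket is unbounded, and it occurs linearly. Linear growth is integrable
for an adapted measure. -/
theorem exists_bound_flowDeriv₂ (hV : IsOpen V) (hY : ∀ i, ContDiffOn ℝ ∞ (Y i) V)
    (hf : ContDiffOn ℝ ∞ f V) {K : Set F} (hK : IsCompact K) (hKV : K ⊆ V) :
    ∃ C, 0 ≤ C ∧ ∀ z : F × (F →L[ℝ] ℝ), z.1 ∈ K → energy Y z = 1 →
      |flowDeriv₂ Y f z| ≤ C * (1 + ‖z.2‖) := by
  have hg := contDiffOn_fderiv_apply hV hY hf
  have hYc : ∀ i, ContinuousOn (Y i) K := fun i => (hY i).continuousOn.mono hKV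
  have hDY : ∀ i, ContinuousOn (fderiv ℝ (Y i)) K := fun i =>
    ((hY i).continuousOn_fderiv_of_isOpen hV (by simp)).mono hKV
  have h1 : ∀ i j, ∃ C, ∀ x ∈ K,
      ‖fderiv ℝ (Y i) x (Y j x) - fderiv ℝ (Y j) x (Y i x)‖ ≤ C := fun i j =>
    hK.exists_bound_of_continuousOn
      (((hDY i).clm_apply (hYc j)).sub ((hDY j).clm_apply (hYc i)))
  have h2 : ∀ i, ∃ C, ∀ x ∈ K, ‖fderiv ℝ f x (Y i x)‖ ≤ C := fun i =>
    hK.exists_bound_of_continuousOn ((hg i).continuousOn.mono hKV)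
  have h3 : ∀ i j, ∃ C, ∀ x ∈ K, ‖fderiv ℝ (fun x => fderiv ℝ f x (Y i x)) x (Y j x)‖ ≤ C :=
    fun i j => hK.exists_bound_of_continuousOn
      ((((hg i).continuousOn_fderiv_of_isOpen hV (by simp)).mono hKV).clm_apply (hYc j))
  choose C1 hC1 using h1
  choose C2 hC2 using h2
  choose C3 hC3 using h3
  refine ⟨∑ i, ∑ j, (|C1 i j| * |C2 i| + |C3 i j|), by positivity, fun z hzK hz => ?_⟩
  rw [Finset.sum_mul]
  refine (Finset.abs_sum_le_sum_abs _ _).trans (Finset.sum_le_sum fun i _ => ?_)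
  rw [Finset.sum_mul]
  refine (Finset.abs_sum_le_sum_abs _ _).trans (Finset.sum_le_sum fun j _ => ?_)
  have hui := abs_apply_le_one_of_energy hz i
  have huj := abs_apply_le_one_of_energy hz j
  refine (abs_add_le _ _).trans ?_
  simp only [abs_mul]
  have e1 : |z.2 (fderiv ℝ (Y i) z.1 (Y j z.1) - fderiv ℝ (Y j) z.1 (Y i z.1))| ≤
      ‖z.2‖ * |C1 i j| := (z.2.le_opNorm _).trans (mul_le_mul_of_nonneg_left
        ((hC1 i j z.1 hzK).trans (le_abs_self _)) (norm_nonneg _))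
  have e2 : |fderiv ℝ f z.1 (Y i z.1)| ≤ |C2 i| := (hC2 i z.1 hzK).trans (le_abs_self _)
  have e3 : |fderiv ℝ (fun x => fderiv ℝ f x (Y i x)) z.1 (Y j z.1)| ≤ |C3 i j| :=
    (hC3 i j z.1 hzK).trans (le_abs_self _)
  have e4 : |z.2 (Y j z.1)| * |z.2 (fderiv ℝ (Y i) z.1 (Y j z.1) - fderiv ℝ (Y j) z.1 (Y i z.1))| *
      |fderiv ℝ f z.1 (Y i z.1)| ≤ 1 * (‖z.2‖ * |C1 i j|) * |C2 i| := by gcongr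
  have e5 : |z.2 (Y i z.1)| * |z.2 (Y j z.1)| *
      |fderiv ℝ (fun x => fderiv ℝ f x (Y i x)) z.1 (Y j z.1)| ≤ 1 * 1 * |C3 i j| := by gcongr
  have e6 : 0 ≤ |C1 i j| * |C2 i| := by positivity
  have e7 : 0 ≤ |C3 i j| * ‖z.2‖ := by positivity
  nlinarith

end AlongFlow

/-! ### Expansion of a function along all geodesics of the unit cylinder. -/

section Expansion

variable {n k : ℕ} {M : Type*} [TopologicalSpace M] [T2Space M] [ChartedSpace (E n) M]
  [IsManifold (𝓡 n) ∞ M]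
variable {S : Structure n k M} {U : Set M} {X : Fin k → ∀ p : M, TangentSpace (𝓡 n) p}

/-- The second order expansion of a function along the normal geodesics starting on the unit
cylinder over `q`. -/
theorem exists_expMap_expansion (hU : IsOpen U) (hX : IsOrthoFrame S U X) {q : M} (hq : q ∈ U)
    {f : M → ℝ} (hf : ContMDiff (𝓡 n) 𝓘(ℝ, ℝ) ∞ f) :
    let x₀ := extChartAt (𝓡 n) q q
    let Y := fun i => chartField q (X i)
    let fq := f ∘ (extChartAt (𝓡 n) q).symm
    ∃ ε > 0, ∃ C, 0 ≤ C ∧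
      (∀ p : Cov n, energy Y (x₀, p) = 1 → ∀ t ∈ Icc 0 ε,
        |f (S.expMap q t p) - f q - t * flowDeriv Y fq (x₀, p)| ≤ C * (1 + ‖p‖) * t ^ 2) ∧
      (∀ p : Cov n, energy Y (x₀, p) = 1 →
        Tendsto (fun t => (f (S.expMap q t p) - f q - t * flowDeriv Y fq (x₀, p)) / t ^ 2)
          (𝓝[>] 0) (𝓝 (flowDeriv₂ Y fq (x₀, p) / 2))) ∧
      ∀ t ∈ Icc 0 ε, ContinuousOn (fun p => f (S.expMap q t p)) {p | energy Y (x₀, p) = 1} := by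
  intro x₀ Y fq
  set V := (extChartAt (𝓡 n) q).target ∩ (extChartAt (𝓡 n) q).symm ⁻¹' U with hVdef
  have hV : IsOpen V := isOpen_chart_preimage q hU
  have hY : ∀ i, ContDiffOn ℝ ∞ (Y i) V := fun i => contDiffOn_chartField q (hX.smooth i)
  have hx₀ : x₀ ∈ V := ⟨mem_extChartAt_target q, by
    change (extChartAt (𝓡 n) q).symm (extChartAt (𝓡 n) q q) ∈ U
    rwa [extChartAt_to_inv]⟩
  have hfq : ContDiffOn ℝ ∞ fq V := fun x hx =>
    (contDiffAt_chart_of_contMDiffAt hx.1 (hf _)).contDiffWithinAt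
  obtain ⟨ε, hε, a, ha, haV, hflow⟩ := exists_hamField_flow hV hY hx₀
  obtain ⟨C, hC0, hC⟩ := exists_bound_flowDeriv₂ hV hY hfq (isCompact_closedBall x₀ a) haV
  have hfx₀ : fq x₀ = f q := congrArg f (extChartAt_to_inv q)
  have hexp : ∀ {z : ℝ → E n × Cov n} {p : Cov n}, z 0 = (x₀, p) →
      (∀ t ∈ Icc 0 ε, HasDerivWithinAt z (hamField Y (z t)) (Icc 0 ε) t ∧
        (z t).1 ∈ Metric.closedBall x₀ a) → ∀ t ∈ Icc 0 ε,
      S.expMap q t p = (extChartAt (𝓡 n) q).symm (z t).1 := fun h0 hz t ht =>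
    expMap_eq_of_chart hU hX (fun s hs => (hz s hs).1) (fun s hs => haV (hz s hs).2) h0 ht
  -- The flow bounds the covector by twice `1 + ‖p‖`, and 1 + 2(1 + ‖p‖) ≤ 4(1 + ‖p‖).
  refine ⟨ε, hε, C * 4, by positivity, fun p hp t ht => ?_, fun p hp => ?_, fun t ht => ?_⟩
  · obtain ⟨α, hα, -⟩ := hflow (1 + ‖p‖) (by positivity)
    obtain ⟨h0, h1⟩ := hα p (by linarith) hp
    rw [hexp h0 (fun s hs => ⟨(h1 s hs).1, (h1 s hs).2.1⟩) t ht]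
    have h2 := abs_second_order_remainder_le (ε := ε) (y := fun s => fq (α p s).1)
      (v := fun s => flowDeriv Y fq (α p s)) (w := fun s => flowDeriv₂ Y fq (α p s))
      (B := C * (1 + 2 * (1 + ‖p‖)))
      (fun s hs => hasDerivWithinAt_flow hV hfq (haV (h1 s hs).2.1) (h1 s hs).1)
      (fun s hs => hasDerivWithinAt_flowDeriv hV hY hfq (haV (h1 s hs).2.1) (h1 s hs).1)
      (fun s hs => (hC _ (h1 s hs).2.1 (h1 s hs).2.2.2).trans
        (mul_le_mul_of_nonneg_left (by linarith [(h1 s hs).2.2.1]) hC0)) ht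
    simp only [h0, hfx₀] at h2
    refine h2.trans ?_
    have h3 : C * (1 + 2 * (1 + ‖p‖)) ≤ C * 4 * (1 + ‖p‖) := by
      rw [mul_assoc]
      exact mul_le_mul_of_nonneg_left (by linarith [norm_nonneg p]) hC0
    exact mul_le_mul_of_nonneg_right h3 (sq_nonneg t)
  · obtain ⟨α, hα, -⟩ := hflow (1 + ‖p‖) (by positivity)
    obtain ⟨h0, h1⟩ := hα p (by linarith) hp
    have h2 := tendsto_second_order_remainder (y := fun s => fq (α p s).1)
      (v := fun s => flowDeriv Y fq (α p s)) hε
      (fun s hs => hasDerivWithinAt_flow hV hfq (haV (h1 s hs).2.1) (h1 s hs).1)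
      (hasDerivWithinAt_flowDeriv hV hY hfq (haV (h1 0 (left_mem_Icc.2 hε.le)).2.1)
        (h1 0 (left_mem_Icc.2 hε.le)).1)
    simp only [h0, hfx₀] at h2
    refine h2.congr' ?_
    filter_upwards [Ioc_mem_nhdsGT hε] with t ht
    rw [hexp h0 (fun s hs => ⟨(h1 s hs).1, (h1 s hs).2.1⟩) t (Ioc_subset_Icc_self ht)]
    rfl
  · intro p hp
    -- The radius `1 + ‖p‖` leaves room around `p`: one flow map serves all nearby covectors, which
    -- gives continuity.
    obtain ⟨α, hα, hαc⟩ := hflow (1 + ‖p‖) (by positivity)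
    have h1 : ContinuousOn (fun p' => fq (α p' t).1)
        {p' | ‖p'‖ ≤ 1 + ‖p‖ ∧ energy Y (x₀, p') = 1} :=
      hfq.continuousOn.comp (continuous_fst.comp_continuousOn (hαc t ht))
        fun p' hp' => haV ((hα p' hp'.1 hp'.2).2 t ht).2.1
    have hball : ∀ᶠ p' in 𝓝[{p' | energy Y (x₀, p') = 1}] p, ‖p'‖ ≤ 1 + ‖p‖ := by
      have : ∀ᶠ p' in 𝓝 p, ‖p'‖ < 1 + ‖p‖ :=
        continuous_norm.continuousAt.eventually_lt continuousAt_const (by linarith)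
      exact nhdsWithin_le_nhds (this.mono fun _ h => h.le)
    have h2 : ContinuousWithinAt (fun p' => fq (α p' t).1) {p' | energy Y (x₀, p') = 1} p := by
      refine (h1 p ⟨by linarith, hp⟩).mono_of_mem_nhdsWithin ?_
      filter_upwards [hball, self_mem_nhdsWithin] with p' h3 h4 using ⟨h3, h4⟩
    have heq : ∀ p', ‖p'‖ ≤ 1 + ‖p‖ → energy Y (x₀, p') = 1 →
        f (S.expMap q t p') = fq (α p' t).1 := by
      intro p' h3 h4
      obtain ⟨h0, h1⟩ := hα p' h3 h4
      rw [hexp h0 (fun s hs => ⟨(h1 s hs).1, (h1 s hs).2.1⟩) t ht]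
      rfl
    refine h2.congr_of_eventuallyEq ?_ (heq p (by linarith) hp)
    filter_upwards [hball, self_mem_nhdsWithin] with p' h3 h4 using heq p' h3 h4

end Expansion

/-! ### First and second moments of the uniform measure on the sphere. -/

section SphereMoments

variable {k : ℕ}

/-- The uniform probability measure on the unit sphere of `ℝᵏ`. -/
def sphereProb (k : ℕ) : Measure (Metric.sphere (0 : E k) 1) :=
  ((volume : Measure (E k)).toSphere univ)⁻¹ • (volume : Measure (E k)).toSphere

theorem isProbabilityMeasure_sphereProb (hk : k ≠ 0) : IsProbabilityMeasure (sphereProb k) := by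
  have : Nonempty (Fin k) := ⟨⟨0, Nat.pos_of_ne_zero hk⟩⟩
  have hne : (volume : Measure (E k)).toSphere ≠ 0 := Measure.toSphere_ne_zero _
  refine ⟨?_⟩
  rw [sphereProb, Measure.smul_apply, smul_eq_mul]
  exact ENNReal.inv_mul_cancel (Measure.measure_univ_ne_zero.2 hne) (measure_ne_top _ _)

/-- The action of a linear isometry on the unit sphere. -/
def sphereMap (e : E k ≃ₗᵢ[ℝ] E k) (u : Metric.sphere (0 : E k) 1) : Metric.sphere (0 : E k) 1 :=
  ⟨e u, by simp⟩

theorem continuous_sphereMap (e : E k ≃ₗᵢ[ℝ] E k) : Continuous (sphereMap e) :=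
  (e.continuous.comp continuous_subtype_val).subtype_mk _

-- The spherical measure of a set is, up to a constant, the volume of the cone over it. A linear
-- isometry maps cones to cones and preserves volume.
open scoped Pointwise in
theorem map_sphereMap (e : E k ≃ₗᵢ[ℝ] E k) :
    (sphereProb k).map (sphereMap e) = sphereProb k := by
  rw [sphereProb, Measure.map_smul]
  congr 1
  ext s hs
  have hm := (continuous_sphereMap e).measurable
  rw [Measure.map_apply hm hs, Measure.toSphere_apply' _ hs, Measure.toSphere_apply' _ (hm hs)]
  congr 1
  have hset : (Ioo (0 : ℝ) 1 • (Subtype.val '' (sphereMap e ⁻¹' s)) : Set (E k)) =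
      e ⁻¹' (Ioo (0 : ℝ) 1 • (Subtype.val '' s)) := by
    ext x
    simp only [Set.mem_smul, mem_image, mem_preimage]
    constructor
    · rintro ⟨r, hr, y, ⟨u, hu, rfl⟩, rfl⟩
      exact ⟨r, hr, e u, ⟨sphereMap e u, hu, rfl⟩, by simp⟩
    · rintro ⟨r, hr, y, ⟨u, hu, rfl⟩, hx⟩
      refine ⟨r, hr, e.symm u, ⟨⟨e.symm u, by simp⟩, ?_, rfl⟩, ?_⟩
      · have : sphereMap e ⟨e.symm u, by simp⟩ = u := Subtype.ext (by simp [sphereMap])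
        rw [this]; exact hu
      · apply e.injective
        rw [← hx]; simp
  rw [hset]
  exact (LinearIsometryEquiv.measurePreserving e).measure_preimage_equiv
    (f := e.toMeasurableEquiv) _

theorem integral_sphereMap (e : E k ≃ₗᵢ[ℝ] E k) {F : E k → ℝ} (hF : Continuous F) :
    ∫ u, F (e u) ∂(sphereProb k) = ∫ u, F u ∂(sphereProb k) := by
  have h := integral_map (μ := sphereProb k) (continuous_sphereMap e).aemeasurable
    (f := fun u : Metric.sphere (0 : E k) 1 => F u)
    (hF.comp continuous_subtype_val).aestronglyMeasurable
  rw [map_sphereMap] at h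
  exact h.symm

theorem integrable_sphereProb (hk : k ≠ 0) {F : E k → ℝ} (hF : Continuous F) :
    Integrable (fun u : Metric.sphere (0 : E k) 1 => F u) (sphereProb k) := by
  have := isProbabilityMeasure_sphereProb hk
  exact (hF.comp continuous_subtype_val).integrable_of_hasCompactSupport
    (HasCompactSupport.of_compactSpace _)

/-- By reflection invariance the integral depends only on the norm of `v`. Replacing `v` by
multiples of the `k` coordinate vectors and summing gives ‖v‖², because the squared coordinates of a
unit vector sum to 1. -/
theorem integral_inner_sq_sphere (hk : k ≠ 0) (v : E k) :
    ∫ u : Metric.sphere (0 : E k) 1, inner ℝ (u : E k) v ^ 2 ∂(sphereProb k) = ‖v‖ ^ 2 / k := by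
  have := isProbabilityMeasure_sphereProb hk
  have hc : ∀ w : E k, Continuous fun u : E k => inner ℝ u w ^ 2 := fun w => by fun_prop
  have h1 : ∀ w : E k, ‖v‖ = ‖w‖ →
      ∫ u : Metric.sphere (0 : E k) 1, inner ℝ (u : E k) v ^ 2 ∂(sphereProb k) =
        ∫ u : Metric.sphere (0 : E k) 1, inner ℝ (u : E k) w ^ 2 ∂(sphereProb k) := by
    intro w hw
    have h2 := Submodule.reflection_sub hw
    rw [← integral_sphereMap (Submodule.reflection (ℝ ∙ (v - w))ᗮ) (hc w)]
    refine integral_congr_ae (Eventually.of_forall fun u => ?_)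
    simp only
    have h3 := LinearIsometryEquiv.inner_map_map (Submodule.reflection (ℝ ∙ (v - w))ᗮ) (u : E k) v
    rw [h2] at h3
    rw [h3]
  have h3 : ∀ i : Fin k, ∫ u : Metric.sphere (0 : E k) 1, inner ℝ (u : E k) v ^ 2 ∂(sphereProb k) =
      ‖v‖ ^ 2 * ∫ u : Metric.sphere (0 : E k) 1, (u : E k) i ^ 2 ∂(sphereProb k) := by
    intro i
    rw [h1 (‖v‖ • EuclideanSpace.single i (1 : ℝ)) (by simp [norm_smul]), ← integral_const_mul]
    refine integral_congr_ae (Eventually.of_forall fun u => ?_)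
    simp only [inner_smul_right, EuclideanSpace.inner_single_right]
    simp
    ring
  have h4 : ∑ i, ∫ u : Metric.sphere (0 : E k) 1, (u : E k) i ^ 2 ∂(sphereProb k) = 1 := by
    rw [← integral_finsetSum _ fun i _ => integrable_sphereProb hk (F := fun u => u i ^ 2)
      (by fun_prop)]
    have : ∀ u : Metric.sphere (0 : E k) 1, ∑ i, (u : E k) i ^ 2 = 1 := by
      intro u
      have h5 := EuclideanSpace.real_norm_sq_eq (u : E k)
      rw [← h5, norm_eq_of_mem_sphere]
      norm_num
    simp [this]
  have h5 : (k : ℝ) * ∫ u : Metric.sphere (0 : E k) 1, inner ℝ (u : E k) v ^ 2 ∂(sphereProb k) =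
      ‖v‖ ^ 2 := by
    calc _ = ∑ i : Fin k, ∫ u : Metric.sphere (0 : E k) 1, inner ℝ (u : E k) v ^ 2 ∂(sphereProb k) := by
          simp
      _ = ∑ i : Fin k, ‖v‖ ^ 2 * ∫ u : Metric.sphere (0 : E k) 1, (u : E k) i ^ 2 ∂(sphereProb k) :=
          Finset.sum_congr rfl fun i _ => h3 i
      _ = _ := by rw [← Finset.mul_sum, h4, mul_one]
  have hk' : (k : ℝ) ≠ 0 := by exact_mod_cast hk
  rw [eq_div_iff hk', mul_comm]
  exact h5

/-- Polarization of the preceding formula. -/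
theorem integral_inner_mul_inner_sphere (hk : k ≠ 0) (v w : E k) :
    ∫ u : Metric.sphere (0 : E k) 1, inner ℝ (u : E k) v * inner ℝ (u : E k) w ∂(sphereProb k) =
      inner ℝ v w / k := by
  have hi : ∀ w : E k, Integrable (fun u : Metric.sphere (0 : E k) 1 => inner ℝ (u : E k) w ^ 2)
    (sphereProb k) := fun w => integrable_sphereProb hk (F := fun u => inner ℝ u w ^ 2) (by fun_prop)
  have h : ∀ u : Metric.sphere (0 : E k) 1, inner ℝ (u : E k) v * inner ℝ (u : E k) w =
      (inner ℝ (u : E k) (v + w) ^ 2 - inner ℝ (u : E k) (v - w) ^ 2) / 4 := by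
    intro u
    rw [inner_add_right, inner_sub_right]
    ring
  simp_rw [h]
  rw [integral_div, integral_sub (hi _) (hi _), integral_inner_sq_sphere hk,
    integral_inner_sq_sphere hk, norm_add_sq_real, norm_sub_sq_real]
  ring

/-- The measure is invariant under the antipodal map and the integrand is odd. -/
theorem integral_linear_sphere (ℓ : E k →L[ℝ] ℝ) :
    ∫ u : Metric.sphere (0 : E k) 1, ℓ u ∂(sphereProb k) = 0 := by
  have h := integral_sphereMap (LinearIsometryEquiv.neg ℝ (E := E k)) ℓ.continuous
  simp only [LinearIsometryEquiv.coe_neg, map_neg, integral_neg] at h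
  linarith

end SphereMoments

/-! ### Moments of adapted measures. -/

section AdaptedMeasure

variable {n k : ℕ} {M : Type*} [TopologicalSpace M] [ChartedSpace (E n) M]
  [IsManifold (𝓡 n) ∞ M]

instance secondCountableTopology_cov : SecondCountableTopology (Cov n) :=
  have : ProperSpace (Cov n) := FiniteDimensional.proper ℝ _
  secondCountable_of_proper

theorem cov_norm_le (p : Cov n) : ‖p‖ ≤ ∑ i, |p (EuclideanSpace.single i 1)| := by
  refine p.opNorm_le_bound (Finset.sum_nonneg fun i _ => abs_nonneg _) fun x => ?_
  have hx : x = ∑ i, x i • EuclideanSpace.single i (1 : ℝ) := by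
    have := (EuclideanSpace.basisFun (Fin n) ℝ).sum_repr x
    simpa using this.symm
  conv_lhs => rw [hx]
  rw [map_sum, Finset.sum_mul]
  refine norm_sum_le_of_le _ fun i _ => ?_
  rw [map_smul, smul_eq_mul, norm_mul, mul_comm, Real.norm_eq_abs]
  exact mul_le_mul_of_nonneg_left (PiLp.norm_apply_le x i) (abs_nonneg _)

/-- The moments of an adapted probability measure. -/
structure AdaptedMoments (X : Fin k → E n) (X₀ : E n) (m : Measure (Cov n)) : Prop where
  prob : IsProbabilityMeasure m
  cylinder : ∀ᵐ p ∂m, ∑ i, p (X i) ^ 2 = 1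
  memLp : ∀ w, MemLp (fun p : Cov n => p w) 2 m
  first : ∀ i, ∫ p, p (X i) ∂m = 0
  second : ∀ i j, ∫ p, p (X i) * p (X j) ∂m = if i = j then (k : ℝ)⁻¹ else 0
  mixed : ∀ i, ∫ p, p (X i) * p X₀ ∂m = 0

/-- The vertical part does not see the `X i` and the horizontal part does not see `X₀`. The first
and second frame moments are thus those of the sphere, and the mixed moment factors into a product
with the vanishing horizontal mean. No symmetry of the vertical measure is needed. -/
theorem adaptedMoments_of_frame (hk : k ≠ 0) {X : Fin k → E n} {X₀ : E n}
    {σ ν m : Measure (Cov n)} [IsProbabilityMeasure ν] {L : E k →L[ℝ] Cov n}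
    (hL0 : ∀ u, L u X₀ = 0) (hsum : ∀ u, ∑ i, L u (X i) ^ 2 = ‖u‖ ^ 2)
    (hσ : σ = Measure.map (fun u : Metric.sphere (0 : E k) 1 => L u) (sphereProb k))
    (hνD : ∀ᵐ p ∂ν, ∀ i, p (X i) = 0) (hν2 : ∀ w : E n, MemLp (fun p : Cov n => p w) 2 ν)
    (hm : m = (σ.prod ν).map (fun z => z.1 + z.2)) : AdaptedMoments X X₀ m := by
  have := isProbabilityMeasure_sphereProb hk
  have hLc : Continuous fun u : Metric.sphere (0 : E k) 1 => L u :=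
    L.continuous.comp continuous_subtype_val
  have hσp : IsProbabilityMeasure σ := by
    rw [hσ]; exact Measure.isProbabilityMeasure_map hLc.aemeasurable
  have hadd : Measurable fun z : Cov n × Cov n => z.1 + z.2 := measurable_fst.add measurable_snd
  -- the horizontal part, read off in the frame, is an isometry
  let A : E k →ₗᵢ[ℝ] E k :=
    { toFun := fun u => WithLp.toLp 2 fun i => L u (X i)
      map_add' := fun u v => by ext i; simp
      map_smul' := fun c u => by ext i; simp
      norm_map' := fun u => by
        have h : ‖(WithLp.toLp 2 fun i => L u (X i) : E k)‖ ^ 2 = ‖u‖ ^ 2 := by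
          rw [EuclideanSpace.real_norm_sq_eq, ← hsum u]
        exact (sq_eq_sq₀ (norm_nonneg _) (norm_nonneg _)).1 h }
  let e : E k ≃ₗᵢ[ℝ] E k := A.toLinearIsometryEquiv rfl
  have he : ∀ u i, L u (X i) = inner ℝ (e u) (EuclideanSpace.single i 1) := by
    intro u i
    rw [EuclideanSpace.inner_single_right]
    simp [e, A]
  have hνX : ∀ᵐ z ∂(σ.prod ν), ∀ i, z.2 (X i) = 0 := by
    have := (Measure.quasiMeasurePreserving_snd (μ := σ) (ν := ν)).ae hνD
    filter_upwards [this] with z hz i using hz i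
  have hσX : ∀ᵐ p ∂σ, p X₀ = 0 := by
    rw [hσ, ae_map_iff hLc.aemeasurable
      (measurableSet_eq_fun (by fun_prop) measurable_const)]
    exact Eventually.of_forall fun u => hL0 u
  have hσX' : ∀ᵐ z ∂(σ.prod ν), z.1 (X₀) = 0 :=
    (Measure.quasiMeasurePreserving_fst (μ := σ) (ν := ν)).ae hσX
  have hint : ∀ {G : Cov n → ℝ}, Continuous G → ∫ p, G p ∂m =
      ∫ z, G (z.1 + z.2) ∂(σ.prod ν) := by
    intro G hG
    rw [hm, integral_map hadd.aemeasurable hG.aestronglyMeasurable]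
  have hfst : ∀ {G : Cov n → ℝ}, Continuous G → ∫ z, G z.1 ∂(σ.prod ν) =
      ∫ u : Metric.sphere (0 : E k) 1, G (L u) ∂(sphereProb k) := by
    intro G hG
    have h1 : ∫ z, G z.1 ∂(σ.prod ν) = ∫ p, G p ∂σ := by
      have h := integral_map (μ := σ.prod ν) measurable_fst.aemeasurable
        (hG.aestronglyMeasurable (μ := (σ.prod ν).map Prod.fst))
      rw [(measurePreserving_fst (μ := σ) (ν := ν)).map_eq] at h
      exact h.symm
    rw [h1, hσ, integral_map hLc.aemeasurable hG.aestronglyMeasurable]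
  have hev : ∀ w : E n, Continuous fun p : Cov n => p w := fun w => by fun_prop
  refine ⟨?_, ?_, ?_, ?_, ?_, ?_⟩
  · rw [hm]; exact Measure.isProbabilityMeasure_map hadd.aemeasurable
  · rw [hm, ae_map_iff hadd.aemeasurable
      (measurableSet_eq_fun (Continuous.measurable (by fun_prop)) measurable_const)]
    have hσ1 : ∀ᵐ p ∂σ, ∑ i, p (X i) ^ 2 = 1 := by
      rw [hσ, ae_map_iff hLc.aemeasurable
        (measurableSet_eq_fun (Continuous.measurable (by fun_prop)) measurable_const)]
      refine Eventually.of_forall fun u => ?_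
      rw [hsum u, norm_eq_of_mem_sphere]
      norm_num
    filter_upwards [hνX, (Measure.quasiMeasurePreserving_fst (μ := σ) (ν := ν)).ae hσ1] with z h1 h2
    simpa [h1] using h2
  · intro w
    rw [hm, memLp_map_measure_iff (hev w).aestronglyMeasurable hadd.aemeasurable]
    have h1 : MemLp (fun p : Cov n => p w) 2 σ := by
      rw [hσ, memLp_map_measure_iff (hev w).aestronglyMeasurable hLc.aemeasurable]
      refine MemLp.of_bound ((hev w).comp hLc).aestronglyMeasurable (‖L‖ * ‖w‖)
        (Eventually.of_forall fun u => ?_)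
      have h2 := L.le_opNorm (u : E k)
      rw [norm_eq_of_mem_sphere, mul_one] at h2
      exact ((L u).le_opNorm w).trans (mul_le_mul_of_nonneg_right h2 (norm_nonneg _))
    exact (h1.comp_measurePreserving measurePreserving_fst).add
      ((hν2 w).comp_measurePreserving measurePreserving_snd)
  · intro i
    rw [hint (hev (X i))]
    have h1 : ∫ z, (z.1 + z.2) (X i) ∂(σ.prod ν) = ∫ z, (z.1 : Cov n) (X i) ∂(σ.prod ν) := by
      refine integral_congr_ae ?_
      filter_upwards [hνX] with z hz
      rw [_root_.add_apply, hz i, add_zero]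
    rw [h1, hfst (hev (X i))]
    exact integral_linear_sphere ((ContinuousLinearMap.apply ℝ ℝ (X i : E n)).comp L)
  · intro i j
    rw [hint (G := fun p => p (X i) * p (X j)) (by fun_prop)]
    have h1 : ∫ z, (z.1 + z.2) (X i) * (z.1 + z.2) (X j) ∂(σ.prod ν) =
        ∫ z, (z.1 : Cov n) (X i) * (z.1 : Cov n) (X j) ∂(σ.prod ν) := by
      refine integral_congr_ae ?_
      filter_upwards [hνX] with z hz
      rw [_root_.add_apply, _root_.add_apply, hz i, hz j, add_zero, add_zero]
    rw [h1, hfst (G := fun p => p (X i) * p (X j)) (by fun_prop)]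
    simp only [he]
    rw [integral_sphereMap e (F := fun u => inner ℝ u (EuclideanSpace.single i 1) *
      inner ℝ u (EuclideanSpace.single j 1)) (by fun_prop), integral_inner_mul_inner_sphere hk]
    by_cases hij : i = j
    · subst hij; simp
    · simp [hij, EuclideanSpace.inner_single_right]
  · intro i
    rw [hint (G := fun p => p (X i) * p X₀) (by fun_prop)]
    have h1 : ∫ z, (z.1 + z.2) (X i) * (z.1 + z.2) X₀ ∂(σ.prod ν) =
        ∫ z, (z.1 : Cov n) (X i) * (z.2 : Cov n) (X₀) ∂(σ.prod ν) := by
      refine integral_congr_ae ?_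
      filter_upwards [hνX, hσX'] with z hz hz'
      rw [_root_.add_apply, _root_.add_apply, hz i, hz', add_zero, zero_add]
    rw [h1, integral_prod_mul (fun p : Cov n => p (X i)) (fun p : Cov n => p X₀)]
    have h2 : ∫ p : Cov n, p (X i) ∂σ = 0 := by
      rw [hσ, integral_map hLc.aemeasurable (hev (X i)).aestronglyMeasurable]
      exact integral_linear_sphere ((ContinuousLinearMap.apply ℝ ℝ (X i : E n)).comp L)
    rw [h2, zero_mul]

theorem adaptedMoments (hk : k ≠ 0) {S : Structure n k M} {U : Set M}
    {X : Fin k → ∀ p : M, TangentSpace (𝓡 n) p} (hX : IsOrthoFrame S U X)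
    {X₀ : ∀ q : M, TangentSpace (𝓡 n) q} {μ : M → Measure (Cov n)}
    (hμ : S.IsAdapted (fun q => Submodule.span ℝ {X₀ q}) μ) {q : M} (hq : q ∈ U) :
    AdaptedMoments (fun i => X i q) (X₀ q) (μ q) := by
  obtain ⟨σ, ν, ⟨L, hL1, hL2, hσ⟩, hν, hνD, hν2, hμq⟩ := hμ.1 q
  refine adaptedMoments_of_frame hk (L := L) (fun u => (hL1 (L u)).2 ⟨u, rfl⟩ _
    (Submodule.mem_span_singleton_self _)) (fun u => ?_) hσ ?_ hν2 hμq
  · have h := hX.hamiltonian_eq hq (L u)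
    have h2 := hL2 u
    rw [h] at h2
    rw [← h2]
    ring_nf
    rfl
  · filter_upwards [hνD] with p hp i using hp _ (hX.mem_D hq i)

end AdaptedMeasure

/-! ### Integrating the expansion. -/

section MicroLimit

variable {n k : ℕ}

namespace AdaptedMoments

variable {X : Fin k → E n} {X₀ : E n} {m : Measure (Cov n)}

theorem integrable_mul (h : AdaptedMoments X X₀ m) (v w : E n) :
    Integrable (fun p : Cov n => p v * p w) m :=
  MemLp.integrable_mul (h.memLp v) (h.memLp w)

theorem integrable_apply (h : AdaptedMoments X X₀ m) (v : E n) :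
    Integrable (fun p : Cov n => p v) m :=
  have := h.prob
  (h.memLp v).integrable one_le_two

theorem integrable_norm (h : AdaptedMoments X X₀ m) : Integrable (fun p : Cov n => ‖p‖) m := by
  have h1 : Integrable (fun p : Cov n => ∑ i, |p (EuclideanSpace.single i 1)|) m :=
    integrable_finsetSum _ fun i _ => (h.integrable_apply _).abs
  refine h1.mono' continuous_norm.aestronglyMeasurable (Eventually.of_forall fun p => ?_)
  rw [norm_norm]
  exact cov_norm_le p

/-- The complement of D enters here: the component of `w` along `X₀` drops out by the mixed moments,
and the others are orthogonal with weight 1/k, leaving only the component along `X j`. -/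
theorem integral_mul (h : AdaptedMoments X X₀ m) {θ : Fin k → Cov n} {θ₀ : Cov n}
    (hθ : ∀ w, w = ∑ l, θ l w • X l + θ₀ w • X₀) (j : Fin k) (w : E n) :
    ∫ p, p (X j) * p w ∂m = θ j w * (k : ℝ)⁻¹ := by
  have h1 : ∀ p : Cov n, p (X j) * p w =
      ∑ l, θ l w * (p (X j) * p (X l)) + θ₀ w * (p (X j) * p X₀) := by
    intro p
    conv_lhs => rw [hθ w]
    rw [map_add, map_sum, mul_add, Finset.mul_sum]
    simp only [map_smul, smul_eq_mul]
    congr 1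
    · exact Finset.sum_congr rfl fun l _ => by ring
    · ring
  simp_rw [h1]
  rw [integral_add (integrable_finsetSum _ fun l _ => (h.integrable_mul _ _).const_mul _)
    ((h.integrable_mul _ _).const_mul _),
    integral_finsetSum _ fun l _ => (h.integrable_mul _ _).const_mul _]
  simp_rw [integral_const_mul, h.second, h.mixed]
  simp

end AdaptedMoments

/-- The value of the microscopic Laplacian in a frame `Y` with dual coframe `θ`. -/
def microValue (Y : Fin k → E n → E n) (θ : Fin k → Cov n) (f : E n → ℝ) (x : E n) : ℝ :=
  ∑ i, (fderiv ℝ (fun y => fderiv ℝ f y (Y i y)) x (Y i x) +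
    (∑ j, θ j (fderiv ℝ (Y i) x (Y j x) - fderiv ℝ (Y j) x (Y i x))) * fderiv ℝ f x (Y i x))

variable {Y : Fin k → E n → E n} {x₀ X₀ : E n} {m : Measure (Cov n)} {f : E n → ℝ}

theorem integral_flowDeriv (h : AdaptedMoments (fun i => Y i x₀) X₀ m) :
    Integrable (fun p => flowDeriv Y f (x₀, p)) m ∧ ∫ p, flowDeriv Y f (x₀, p) ∂m = 0 := by
  unfold flowDeriv
  have hi : ∀ i, Integrable (fun p : Cov n => p (Y i x₀) * fderiv ℝ f x₀ (Y i x₀)) m :=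
    fun i => (h.integrable_apply _).mul_const _
  refine ⟨integrable_finsetSum _ fun i _ => hi i, ?_⟩
  simp only
  rw [integral_finsetSum _ fun i _ => hi i]
  simp_rw [integral_mul_const, h.first, zero_mul, Finset.sum_const_zero]

/-- The covariance δ_ij / k keeps the diagonal second derivatives, and the bracket terms are reduced
to their horizontal components. The factor `k` in front removes the normalization. -/
theorem integral_flowDeriv₂ (hk : k ≠ 0) (h : AdaptedMoments (fun i => Y i x₀) X₀ m)
    {θ : Fin k → Cov n} {θ₀ : Cov n} (hθ : ∀ w, w = ∑ l, θ l w • Y l x₀ + θ₀ w • X₀) :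
    k * ∫ p, flowDeriv₂ Y f (x₀, p) ∂m = microValue Y θ f x₀ := by
  unfold flowDeriv₂ microValue
  simp only
  have h1 : ∀ i j, Integrable (fun p : Cov n => p (Y j x₀) *
      p (fderiv ℝ (Y i) x₀ (Y j x₀) - fderiv ℝ (Y j) x₀ (Y i x₀)) * fderiv ℝ f x₀ (Y i x₀)) m :=
    fun i j => (h.integrable_mul _ _).mul_const _
  have h2 : ∀ i j, Integrable (fun p : Cov n => p (Y i x₀) * p (Y j x₀) *
      fderiv ℝ (fun x => fderiv ℝ f x (Y i x)) x₀ (Y j x₀)) m :=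
    fun i j => (h.integrable_mul _ _).mul_const _
  have h12 : ∀ i j, Integrable (fun p : Cov n => p (Y j x₀) *
      p (fderiv ℝ (Y i) x₀ (Y j x₀) - fderiv ℝ (Y j) x₀ (Y i x₀)) * fderiv ℝ f x₀ (Y i x₀) +
      p (Y i x₀) * p (Y j x₀) * fderiv ℝ (fun x => fderiv ℝ f x (Y i x)) x₀ (Y j x₀)) m :=
    fun i j => (h1 i j).add (h2 i j)
  rw [integral_finsetSum _ fun i _ => integrable_finsetSum _ fun j _ => h12 i j, Finset.mul_sum]
  refine Finset.sum_congr rfl fun i _ => ?_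
  rw [integral_finsetSum _ fun j _ => h12 i j]
  have hk' : (k : ℝ) ≠ 0 := by exact_mod_cast hk
  have h3 : ∀ j, ∫ p : Cov n, (p (Y j x₀) *
      p (fderiv ℝ (Y i) x₀ (Y j x₀) - fderiv ℝ (Y j) x₀ (Y i x₀)) * fderiv ℝ f x₀ (Y i x₀) +
      p (Y i x₀) * p (Y j x₀) * fderiv ℝ (fun x => fderiv ℝ f x (Y i x)) x₀ (Y j x₀)) ∂m =
      θ j (fderiv ℝ (Y i) x₀ (Y j x₀) - fderiv ℝ (Y j) x₀ (Y i x₀)) * (k : ℝ)⁻¹ *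
        fderiv ℝ f x₀ (Y i x₀) +
      (if i = j then (k : ℝ)⁻¹ else 0) *
        fderiv ℝ (fun x => fderiv ℝ f x (Y i x)) x₀ (Y j x₀) := by
    intro j
    rw [integral_add (h1 i j) (h2 i j), integral_mul_const, integral_mul_const, h.second,
      h.integral_mul hθ]
  simp_rw [h3, Finset.sum_add_distrib, ite_mul, zero_mul, Finset.sum_ite_eq,
    Finset.mem_univ, if_true, mul_add, Finset.mul_sum, Finset.sum_mul]
  rw [add_comm]
  congr 1
  · field_simp
  · exact Finset.sum_congr rfl fun j _ => by field_simp

/-- The term linear in `t` has mean zero, so the singular factor 1/t² meets only the quadratic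
remainder. Dominated convergence applies with majorant `C * (1 + ‖p‖)`, integrable because the
second moments are finite. -/
theorem tendsto_integral_of_expansion (h : AdaptedMoments (fun i => Y i x₀) X₀ m)
    {G : ℝ → Cov n → ℝ} {ε C : ℝ} (hε : 0 < ε)
    (hbound : ∀ p : Cov n, energy Y (x₀, p) = 1 → ∀ t ∈ Icc 0 ε,
      |G t p - t * flowDeriv Y f (x₀, p)| ≤ C * (1 + ‖p‖) * t ^ 2)
    (hlim : ∀ p : Cov n, energy Y (x₀, p) = 1 →
      Tendsto (fun t => (G t p - t * flowDeriv Y f (x₀, p)) / t ^ 2)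
        (𝓝[>] 0) (𝓝 (flowDeriv₂ Y f (x₀, p) / 2)))
    (hcont : ∀ t ∈ Icc 0 ε, ContinuousOn (G t) {p | energy Y (x₀, p) = 1}) :
    Tendsto (fun t : ℝ => 2 * (k : ℝ) / t ^ 2 * ∫ p, G t p ∂m) (𝓝[>] 0)
      (𝓝 (k * ∫ p, flowDeriv₂ Y f (x₀, p) ∂m)) := by
  have := h.prob
  obtain ⟨hfi, hf0⟩ := integral_flowDeriv (f := f) h
  have hcyl : ∀ᵐ p ∂m, energy Y (x₀, p) = 1 := h.cylinder
  have henergy : Continuous fun p : Cov n => energy Y (x₀, p) := by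
    unfold energy
    exact continuous_finsetSum _ fun i _ => (continuous_eval_const (Y i x₀)).pow 2
  have hmeas : ∀ t ∈ Icc 0 ε, AEStronglyMeasurable (G t) m := by
    intro t ht
    -- Continuity is known only on the cylinder, which is closed and has full measure; this suffices
    -- for measurability.
    have h1 := (hcont t ht).aestronglyMeasurable (μ := m)
      (isClosed_eq henergy continuous_const).measurableSet
    have h2 : m.restrict {p | energy Y (x₀, p) = 1} = m := Measure.restrict_eq_self_of_ae_mem hcyl
    rwa [h2] at h1
  have hev : ∀ᶠ t in 𝓝[>] (0 : ℝ), t ∈ Ioc 0 ε := Ioc_mem_nhdsGT hε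
  have hbi : Integrable (fun p : Cov n => C * (1 + ‖p‖)) m :=
    ((integrable_const 1).add h.integrable_norm).const_mul C
  have hRmeas : ∀ t ∈ Icc 0 ε,
      AEStronglyMeasurable (fun p => (G t p - t * flowDeriv Y f (x₀, p)) / t ^ 2) m :=
    fun t ht => by
      simp_rw [div_eq_mul_inv]
      exact ((hmeas t ht).sub (hfi.const_mul t).aestronglyMeasurable).mul_const _
  have hRb : ∀ t ∈ Ioc 0 ε, ∀ᵐ p ∂m,
      ‖(G t p - t * flowDeriv Y f (x₀, p)) / t ^ 2‖ ≤ C * (1 + ‖p‖) := by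
    intro t ht
    filter_upwards [hcyl] with p hp
    have ht2 : 0 < t ^ 2 := pow_pos ht.1 2
    rw [norm_div, Real.norm_eq_abs, Real.norm_of_nonneg ht2.le, div_le_iff₀ ht2]
    exact hbound p hp t ⟨ht.1.le, ht.2⟩
  have hdom : Tendsto (fun t => ∫ p, (G t p - t * flowDeriv Y f (x₀, p)) / t ^ 2 ∂m) (𝓝[>] 0)
      (𝓝 (∫ p, flowDeriv₂ Y f (x₀, p) / 2 ∂m)) := by
    refine tendsto_integral_filter_of_dominated_convergence (fun p => C * (1 + ‖p‖))
      (hev.mono fun t ht => hRmeas t ⟨ht.1.le, ht.2⟩) (hev.mono hRb) hbi ?_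
    filter_upwards [hcyl] with p hp using hlim p hp
  have h2 := hdom.const_mul (2 * (k : ℝ))
  rw [integral_div] at h2
  have h3 : 2 * (k : ℝ) * ((∫ p, flowDeriv₂ Y f (x₀, p) ∂m) / 2) =
      k * ∫ p, flowDeriv₂ Y f (x₀, p) ∂m := by ring
  rw [h3] at h2
  refine h2.congr' (hev.mono fun t ht => ?_)
  have ht0 : t ≠ 0 := ht.1.ne'
  have hRi : Integrable (fun p => (G t p - t * flowDeriv Y f (x₀, p)) / t ^ 2) m :=
    hbi.mono' (hRmeas t ⟨ht.1.le, ht.2⟩) (hRb t ht)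
  have h4 : ∀ p, G t p = t ^ 2 * ((G t p - t * flowDeriv Y f (x₀, p)) / t ^ 2) +
      t * flowDeriv Y f (x₀, p) := fun p => by field_simp; ring
  have h5 : ∫ p, G t p ∂m =
      t ^ 2 * ∫ p, (G t p - t * flowDeriv Y f (x₀, p)) / t ^ 2 ∂m := by
    conv_lhs => rw [funext h4]
    rw [integral_add (hRi.const_mul _) (hfi.const_mul _), integral_const_mul, integral_const_mul,
      hf0, mul_zero, add_zero]
  simp only
  rw [h5]
  field_simp

end MicroLimit

/-! ### The microscopic Laplacian in an orthonormal frame. -/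

section Micro

variable {n k : ℕ} {M : Type*} [TopologicalSpace M] [ChartedSpace (E n) M]
  [IsManifold (𝓡 n) ∞ M] {S : Structure n k M} {U : Set M}
  {X : Fin k → ∀ p : M, TangentSpace (𝓡 n) p}

/-- The value of a vector field at a point, as an element of the model space. -/
def vec (X : ∀ p : M, TangentSpace (𝓡 n) p) (q : M) : E n := X q

theorem chartField_self (q : M) (X : ∀ p : M, TangentSpace (𝓡 n) p) :
    chartField q X (extChartAt (𝓡 n) q q) = vec X q := by
  rw [tangentMap_chartField, extChartAt_to_inv (I := 𝓡 n) q]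
  exact congrArg (fun A : E n →L[ℝ] E n => A (X q)) (dphi_self q)

theorem hasMicroLaplacianAt_microValue [T2Space M] (hk : k ≠ 0) (hU : IsOpen U) (hX : IsOrthoFrame S U X)
    {X₀ : ∀ q : M, TangentSpace (𝓡 n) q} {μ : M → Measure (Cov n)}
    (hμ : S.IsAdapted (fun q => Submodule.span ℝ {X₀ q}) μ) {q : M} (hq : q ∈ U)
    {θ : Fin k → Cov n} {θ₀ : Cov n}
    (hθ : ∀ w : E n, w = ∑ l, θ l w • vec (X l) q + θ₀ w • vec X₀ q)
    {f : M → ℝ} (hf : ContMDiff (𝓡 n) 𝓘(ℝ, ℝ) ∞ f) :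
    S.HasMicroLaplacianAt μ f q (microValue (fun i => chartField q (X i)) θ
      (f ∘ (extChartAt (𝓡 n) q).symm) (extChartAt (𝓡 n) q q)) := by
  have hm := adaptedMoments hk hX hμ hq
  have hXY : (fun i => vec (X i) q) = fun i => chartField q (X i) (extChartAt (𝓡 n) q q) :=
    funext fun i => (chartField_self q (X i)).symm
  have hm' : AdaptedMoments (fun i => chartField q (X i) (extChartAt (𝓡 n) q q)) (X₀ q) (μ q) :=
    hXY ▸ hm
  have hθ' : ∀ w : E n, w = ∑ l, θ l w • chartField q (X l) (extChartAt (𝓡 n) q q) +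
      θ₀ w • vec X₀ q := by
    intro w
    simp_rw [chartField_self]
    exact hθ w
  obtain ⟨ε, hε, C, -, hb, hl, hc⟩ := exists_expMap_expansion hU hX hq hf
  rw [← integral_flowDeriv₂ (Y := fun i => chartField q (X i)) hk hm' hθ']
  exact tendsto_integral_of_expansion (Y := fun i => chartField q (X i))
    (G := fun t p => f (S.expMap q t p) - f q) hm' hε hb hl
    fun t ht => (hc t ht).sub continuousOn_const

theorem hasMicroLaplacianAt_iff [T2Space M] (hk : k ≠ 0) (hU : IsOpen U) (hX : IsOrthoFrame S U X)
    {X₀ : ∀ q : M, TangentSpace (𝓡 n) q} {μ : M → Measure (Cov n)}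
    (hμ : S.IsAdapted (fun q => Submodule.span ℝ {X₀ q}) μ) {q : M} (hq : q ∈ U)
    {θ : Fin k → Cov n} {θ₀ : Cov n}
    (hθ : ∀ w : E n, w = ∑ l, θ l w • vec (X l) q + θ₀ w • vec X₀ q)
    {f : M → ℝ} (hf : ContMDiff (𝓡 n) 𝓘(ℝ, ℝ) ∞ f) {ℓ : ℝ} :
    S.HasMicroLaplacianAt μ f q ℓ ↔ ℓ = microValue (fun i => chartField q (X i)) θ
      (f ∘ (extChartAt (𝓡 n) q).symm) (extChartAt (𝓡 n) q q) := by
  have h := hasMicroLaplacianAt_microValue hk hU hX hμ hq hθ hf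
  exact ⟨fun h' => tendsto_nhds_unique h' h, fun h' => h' ▸ h⟩

end Micro

/-! ### Top-degree forms, bases and traces. -/

section TopForms

variable {n : ℕ}

theorem coe_basisFun : ⇑(EuclideanSpace.basisFun (Fin n) ℝ).toBasis =
    fun i => EuclideanSpace.single i (1 : ℝ) := by
  funext i
  simp

/-- Top-degree forms are proportional. -/
theorem topForm_mul_comm (A B : E n [⋀^Fin n]→ₗ[ℝ] ℝ) (u v : Fin n → E n) :
    A u * B v = A v * B u := by
  have hA := A.eq_smul_basis_det (EuclideanSpace.basisFun (Fin n) ℝ).toBasis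
  have hB := B.eq_smul_basis_det (EuclideanSpace.basisFun (Fin n) ℝ).toBasis
  rw [hA, hB]
  simp only [AlternatingMap.smul_apply, smul_eq_mul]
  ring

theorem map_update_basis (A : E n [⋀^Fin n]→ₗ[ℝ] ℝ) (b : Module.Basis (Fin n) ℝ (E n)) (i : Fin n)
    (w : E n) : A (Function.update b i w) = b.repr w i * A b := by
  conv_lhs => rw [← b.sum_repr w]
  rw [A.map_update_sum]
  rw [Finset.sum_eq_single i]
  · rw [A.map_update_smul, Function.update_eq_self, smul_eq_mul]
  · intro j _ hj
    rw [A.map_update_smul, A.map_update_self _ hj.symm, smul_zero]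
  · simp

theorem trace_eq_sum_repr (b : Module.Basis (Fin n) ℝ (E n)) (B : E n →L[ℝ] E n) :
    LinearMap.trace ℝ (E n) B = ∑ a, b.repr (B (b a)) a := by
  rw [LinearMap.trace_eq_matrix_trace ℝ b, Matrix.trace]
  simp [LinearMap.toMatrix_apply]

theorem sum_update_basis (A : E n [⋀^Fin n]→ₗ[ℝ] ℝ) (b : Module.Basis (Fin n) ℝ (E n))
    (B : E n →L[ℝ] E n) :
    ∑ i, A (Function.update b i (B (b i))) = LinearMap.trace ℝ (E n) B * A b := by
  simp_rw [map_update_basis, trace_eq_sum_repr b, Finset.sum_mul]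

theorem topForm_basis_ne_zero {A : E n [⋀^Fin n]→L[ℝ] ℝ} (hA : A ≠ 0)
    (b : Module.Basis (Fin n) ℝ (E n)) : A b ≠ 0 := by
  refine (AlternatingMap.map_basis_ne_zero_iff b A.toAlternatingMap).2 fun h => hA ?_
  ext v
  exact DFunLike.congr_fun h v

end TopForms

/-! ### Divergence and Lie brackets in a frame. -/

section FrameCalculus

variable {n : ℕ}

/-- The divergence in coordinates. -/
def coordDivergence (Ω : E n → E n [⋀^Fin n]→L[ℝ] ℝ) (Z : E n → E n) (x : E n) : ℝ :=
  fderiv ℝ Ω x (Z x) (fun i => EuclideanSpace.single i (1 : ℝ)) /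
    Ω x (fun i => EuclideanSpace.single i (1 : ℝ)) + LinearMap.trace ℝ (E n) (fderiv ℝ Z x)

theorem coordDivergence_congr {Ω : E n → E n [⋀^Fin n]→L[ℝ] ℝ} {Z Z' : E n → E n} {x : E n}
    (h : Z =ᶠ[𝓝 x] Z') : coordDivergence Ω Z x = coordDivergence Ω Z' x := by
  rw [coordDivergence, coordDivergence, h.fderiv_eq, h.eq_of_nhds]

/-- The Leibniz rule div(f Y) = Y f + f div Y; the first term is the trace of the rank-one map df ⊗
Y. -/
theorem coordDivergence_sum {k : ℕ} {Ω : E n → E n [⋀^Fin n]→L[ℝ] ℝ} {Y : Fin k → E n → E n}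
    {f : Fin k → E n → ℝ} {x : E n} (hY : ∀ i, DifferentiableAt ℝ (Y i) x)
    (hf : ∀ i, DifferentiableAt ℝ (f i) x) :
    coordDivergence Ω (fun y => ∑ i, f i y • Y i y) x =
      ∑ i, (fderiv ℝ (f i) x (Y i x) + f i x * coordDivergence Ω (Y i) x) := by
  have h1 : fderiv ℝ (fun y => ∑ i, f i y • Y i y) x =
      ∑ i, (f i x • fderiv ℝ (Y i) x + (fderiv ℝ (f i) x).smulRight (Y i x)) := by
    rw [fderiv_fun_sum (A := fun i y => f i y • Y i y) fun i _ => (hf i).smul (hY i)]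
    exact Finset.sum_congr rfl fun i _ => fderiv_fun_smul (hf i) (hY i)
  have h2 : ∀ (ℓ : E n →L[ℝ] ℝ) (v : E n),
      LinearMap.trace ℝ (E n) (ℓ.smulRight v : E n →L[ℝ] E n) = ℓ v := by
    intro ℓ v
    rw [trace_eq_sum_repr (EuclideanSpace.basisFun (Fin n) ℝ).toBasis]
    conv_rhs => rw [← (EuclideanSpace.basisFun (Fin n) ℝ).toBasis.sum_repr v]
    rw [map_sum]
    refine Finset.sum_congr rfl fun i _ => ?_
    simp [mul_comm]
  have h3 : LinearMap.trace ℝ (E n) (fderiv ℝ (fun y => ∑ i, f i y • Y i y) x) =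
      ∑ i, (f i x * LinearMap.trace ℝ (E n) (fderiv ℝ (Y i) x) + fderiv ℝ (f i) x (Y i x)) := by
    rw [h1]
    simp only [ContinuousLinearMap.toLinearMap_sum, ContinuousLinearMap.toLinearMap_add,
      ContinuousLinearMap.toLinearMap_smul, map_sum, map_add, map_smul, smul_eq_mul]
    exact Finset.sum_congr rfl fun i _ => by rw [h2]
  rw [coordDivergence, h3]
  simp only [coordDivergence, map_sum, map_smul, ContinuousAlternatingMap.sum_apply,
    ContinuousAlternatingMap.smul_apply, smul_eq_mul, Finset.sum_div]
  rw [← Finset.sum_add_distrib]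
  exact Finset.sum_congr rfl fun i _ => by ring

theorem fderiv_form_frame {m : ℕ} {A : E n → E n [⋀^Fin m]→L[ℝ] ℝ} {Y : Fin m → E n → E n}
    {x : E n} (hA : DifferentiableAt ℝ A x) (hY : ∀ i, DifferentiableAt ℝ (Y i) x) (w : E n) :
    fderiv ℝ (fun y => A y fun i => Y i y) x w = fderiv ℝ A x w (fun i => Y i x) +
      ∑ i, A x (Function.update (fun i => Y i x) i (fderiv ℝ (Y i) x w)) := by
  rw [(hA.hasFDerivAt.continuousAlternatingMap_apply fun i => (hY i).hasFDerivAt).fderiv,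
    _root_.add_apply, _root_.sum_apply]
  rfl

theorem differentiableAt_form_frame {m : ℕ} {A : E n → E n [⋀^Fin m]→L[ℝ] ℝ}
    {Y : Fin m → E n → E n}
    {x : E n} (hA : DifferentiableAt ℝ A x) (hY : ∀ i, DifferentiableAt ℝ (Y i) x) :
    DifferentiableAt ℝ (fun y => A y fun i => Y i y) x :=
  (hA.hasFDerivAt.continuousAlternatingMap_apply fun i => (hY i).hasFDerivAt).differentiableAt

/-- Differentiating the form contributes a quotient of two top forms, which is the same on every
basis; differentiating the i-th frame field contributes the i-th coefficient of its derivative. -/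
theorem fderiv_density_div {Ω : E n → E n [⋀^Fin n]→L[ℝ] ℝ} {Y : Fin n → E n → E n} {x : E n}
    (hΩ : DifferentiableAt ℝ Ω x) (hΩ0 : Ω x ≠ 0) (hY : ∀ i, DifferentiableAt ℝ (Y i) x)
    (b : Module.Basis (Fin n) ℝ (E n)) (hb : ∀ i, b i = Y i x) (w : E n) :
    fderiv ℝ (fun y => Ω y fun i => Y i y) x w / (Ω x fun i => Y i x) =
      fderiv ℝ Ω x w (fun i => EuclideanSpace.single i (1 : ℝ)) /
        Ω x (fun i => EuclideanSpace.single i (1 : ℝ)) + ∑ i, b.repr (fderiv ℝ (Y i) x w) i := by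
  have hb' : (fun i => Y i x) = b := funext fun i => (hb i).symm
  have h0 : Ω x b ≠ 0 := topForm_basis_ne_zero hΩ0 b
  have h1 : Ω x (fun i => EuclideanSpace.single i (1 : ℝ)) ≠ 0 := by
    have := topForm_basis_ne_zero hΩ0 (EuclideanSpace.basisFun (Fin n) ℝ).toBasis
    rwa [coe_basisFun] at this
  rw [fderiv_form_frame hΩ hY, hb']
  have h2 : ∀ i u, Ω x (Function.update b i u) = b.repr u i * Ω x b := fun i u =>
    map_update_basis (Ω x).toAlternatingMap b i u
  simp_rw [h2]
  rw [← Finset.sum_mul, add_div, mul_div_assoc, div_self h0, mul_one]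
  congr 1
  rw [div_eq_div_iff h0 h1]
  exact topForm_mul_comm (fderiv ℝ Ω x w).toAlternatingMap (Ω x).toAlternatingMap _ _

/-- The logarithmic derivative of the frame volume contains the coefficients of D Y_a (Y_i), whereas
the trace contains those of D Y_i (Y_a). Their differences are the coefficients of the brackets
[Y_a, Y_i]. -/
theorem coordDivergence_frame {Ω : E n → E n [⋀^Fin n]→L[ℝ] ℝ} {Y : Fin n → E n → E n} {x : E n}
    (hΩ : DifferentiableAt ℝ Ω x) (hΩ0 : Ω x ≠ 0) (hY : ∀ i, DifferentiableAt ℝ (Y i) x)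
    (b : Module.Basis (Fin n) ℝ (E n)) (hb : ∀ i, b i = Y i x) (i : Fin n) :
    coordDivergence Ω (Y i) x =
      fderiv ℝ (fun y => Ω y fun i => Y i y) x (Y i x) / (Ω x fun i => Y i x) +
        ∑ a, b.repr (fderiv ℝ (Y i) x (Y a x) - fderiv ℝ (Y a) x (Y i x)) a := by
  rw [fderiv_density_div hΩ hΩ0 hY b hb, coordDivergence, trace_eq_sum_repr b, add_assoc,
    ← Finset.sum_add_distrib]
  congr 1
  refine Finset.sum_congr rfl fun a _ => ?_
  rw [map_sub, hb]
  simp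

theorem extDeriv_one_apply {A : E n → E n [⋀^Fin 1]→L[ℝ] ℝ} {x : E n}
    (hA : DifferentiableAt ℝ A x) (v w : E n) :
    extDeriv A x ![v, w] = fderiv ℝ A x v ![w] - fderiv ℝ A x w ![v] := by
  rw [extDeriv_apply hA, Fin.sum_univ_two]
  have h1 : (0 : Fin 2).removeNth ![v, w] = ![w] := by
    ext i; fin_cases i; rfl
  have h2 : (1 : Fin 2).removeNth ![v, w] = ![v] := by
    ext i; fin_cases i; rfl
  simp only [h1, h2]
  rw [fderiv_continuousAlternatingMap_apply_const hA, fderiv_continuousAlternatingMap_apply_const hA]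
  simp [sub_eq_add_neg]

theorem fderiv_oneForm_field {A : E n → E n [⋀^Fin 1]→L[ℝ] ℝ} {Y : E n → E n} {x : E n}
    (hA : DifferentiableAt ℝ A x) (hY : DifferentiableAt ℝ Y x) (w : E n) :
    fderiv ℝ (fun y => A y ![Y y]) x w = fderiv ℝ A x w ![Y x] + A x ![fderiv ℝ Y x w] := by
  have h := fderiv_form_frame hA (Y := fun _ : Fin 1 => Y) (fun _ => hY) w
  have h1 : ∀ v : E n, (fun _ : Fin 1 => v) = ![v] := fun v => by ext i; fin_cases i; rfl
  simp only [h1, Finset.univ_unique, Finset.sum_singleton] at h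
  rw [h]
  congr 2
  ext i; fin_cases i; rfl

/-- Cartan's formula A([Z, Y]) = Z(A(Y)) - Y(A(Z)) - dA(Z, Y), where the first term vanishes because
`A` annihilates `Y` near the point. -/
theorem oneForm_bracket {A : E n → E n [⋀^Fin 1]→L[ℝ] ℝ} {Y Z : E n → E n} {x : E n}
    (hA : DifferentiableAt ℝ A x) (hY : DifferentiableAt ℝ Y x) (hZ : DifferentiableAt ℝ Z x)
    (hY0 : (fun y => A y ![Y y]) =ᶠ[𝓝 x] 0) :
    A x ![fderiv ℝ Y x (Z x) - fderiv ℝ Z x (Y x)] =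
      - fderiv ℝ (fun y => A y ![Z y]) x (Y x) - extDeriv A x ![Z x, Y x] := by
  have h1 := fderiv_oneForm_field hA hY (Z x)
  have h2 := fderiv_oneForm_field hA hZ (Y x)
  rw [hY0.fderiv_eq] at h1
  have h3 : A x ![fderiv ℝ Y x (Z x) - fderiv ℝ Z x (Y x)] =
      A x ![fderiv ℝ Y x (Z x)] - A x ![fderiv ℝ Z x (Y x)] := by simp
  rw [h3, h2, extDeriv_one_apply hA]
  simp at h1
  linarith

end FrameCalculus

theorem exists_basis_cons {k : ℕ} {D : Submodule ℝ (E (k + 1))} (b : Module.Basis (Fin k) ℝ D)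
    {v : E (k + 1)} (hv : v ∉ D) :
    ∃ c : Module.Basis (Fin (k + 1)) ℝ (E (k + 1)), ⇑c = Fin.cons v fun i => (b i : E (k + 1)) := by
  have h1 : LinearIndependent ℝ fun i => (b i : E (k + 1)) :=
    b.linearIndependent.map' D.subtype (Submodule.ker_subtype D)
  have h2 : LinearIndependent ℝ (Fin.cons v fun i => (b i : E (k + 1)) : Fin (k + 1) → E (k + 1)) := by
    refine linearIndependent_finCons.2 ⟨h1, fun h => hv ?_⟩
    refine Submodule.span_le.2 ?_ h
    rintro _ ⟨i, rfl⟩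
    exact (b i).2
  exact ⟨basisOfLinearIndependentOfCardEqFinrank h2 (by simp), by simp⟩

/-! ### Localization, test functions, and the divergence and gradient in charts. -/

section Restrict

variable {n k : ℕ} {M : Type*} [TopologicalSpace M] [ChartedSpace (E n) M]

theorem SmoothFormOn.mono {m : ℕ} {U V : Set M} {Ω : DForm n M m} (h : SmoothFormOn U Ω)
    (hVU : V ⊆ U) : SmoothFormOn V Ω :=
  fun c => (h c).mono fun _ hx => ⟨hx.1, hVU hx.2⟩

theorem IsVolumeOn.mono {U V : Set M} {Ω : DForm n M n} (h : IsVolumeOn U Ω)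
    (hVU : V ⊆ U) : IsVolumeOn V Ω :=
  ⟨h.1.mono hVU, fun q hq => h.2 q (hVU hq)⟩

variable [IsManifold (𝓡 n) ∞ M]

theorem IsOrthoFrame.mono {S : Structure n k M} {U V : Set M}
    {X : Fin k → ∀ p : M, TangentSpace (𝓡 n) p} (h : IsOrthoFrame S U X) (hVU : V ⊆ U) :
    IsOrthoFrame S V X :=
  ⟨fun i => (h.smooth i).mono hVU, fun p hp => h.basis p (hVU hp)⟩

theorem SmoothFieldOn.mono {U V : Set M} {X : ∀ p : M, TangentSpace (𝓡 n) p}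
    (h : SmoothFieldOn U X) (hVU : V ⊆ U) : SmoothFieldOn V X :=
  ContMDiffOn.mono h hVU

theorem exists_orthoFrame (S : Structure n k M) (q : M) :
    ∃ U : Set M, IsOpen U ∧ q ∈ U ∧ ∃ X, IsOrthoFrame S U X := by
  obtain ⟨U, hU, hq, X, hX, hb⟩ := S.frame q
  exact ⟨U, hU, hq, X, hX, hb⟩

/-- There are smooth functions with a given differential at a given point. -/
theorem exists_test_function [T2Space M] (q : M) (ξ : Cov n) :
    ∃ f : M → ℝ, ContMDiff (𝓡 n) 𝓘(ℝ, ℝ) ∞ f ∧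
      f ∘ (extChartAt (𝓡 n) q).symm =ᶠ[𝓝 (extChartAt (𝓡 n) q q)] ξ := by
  obtain ⟨B⟩ : Nonempty (SmoothBumpFunction (𝓡 n) q) := inferInstance
  refine ⟨fun p => B p • ξ (extChartAt (𝓡 n) q p), B.contMDiff_smul ?_, ?_⟩
  · exact ξ.contDiff.contMDiff.comp_contMDiffOn contMDiffOn_extChartAt
  · have h1 : ∀ᶠ y in 𝓝 (extChartAt (𝓡 n) q q), B ((extChartAt (𝓡 n) q).symm y) = 1 := by
      have h2 : Tendsto (extChartAt (𝓡 n) q).symm (𝓝 (extChartAt (𝓡 n) q q)) (𝓝 q) := by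
        have := continuousAt_extChartAt_symm (I := 𝓡 n) q
        rwa [ContinuousAt, extChartAt_to_inv] at this
      exact h2.eventually B.eventuallyEq_one
    filter_upwards [h1, extChartAt_target_mem_nhds (I := 𝓡 n) q] with y hy hyt
    simp only [Function.comp_apply, hy, one_smul, (extChartAt (𝓡 n) q).right_inv hyt]

/-- The differential at `q` of the preferred chart is the identity, so the frame in the definition
is the standard basis. Inserting the derivative of the field slot by slot into a top form yields its
trace. -/
theorem divergence_eq_coordDivergence {U : Set M} (hU : IsOpen U) {Ω : DForm n M n}
    (hΩ : SmoothFormOn U Ω) {q : M} (hq : q ∈ U) (X : ∀ p : M, TangentSpace (𝓡 n) p)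
    (h0 : Ω q ≠ 0) :
    divergence Ω X q = coordDivergence (chartForm q Ω) (chartField q X) (extChartAt (𝓡 n) q q) := by
  have hd : DifferentiableAt ℝ (chartForm q Ω) (extChartAt (𝓡 n) q q) :=
    (hΩ.contDiffAt (n := n) hU (mem_extChartAt_target q)
      (by rwa [extChartAt_to_inv])).differentiableAt (by simp)
  have hval : chartForm q Ω (extChartAt (𝓡 n) q q) = Ω q := by
    ext v
    rw [chartForm_apply, dpsi_self, extChartAt_to_inv]
    rfl
  have hw : (fun i => dphi q q (EuclideanSpace.single i (1 : ℝ))) =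
      fun i : Fin n => (EuclideanSpace.single i (1 : ℝ) : E n) := by
    rw [dphi_self]; rfl
  have h1 : divergence Ω X q =
      (fderiv ℝ (fun y => chartForm q Ω y
        (fun i => dphi q q (EuclideanSpace.single i (1 : ℝ)))) (extChartAt (𝓡 n) q q)
        (chartField q X (extChartAt (𝓡 n) q q)) +
      ∑ i, chartForm q Ω (extChartAt (𝓡 n) q q) (Function.update
        (fun i => dphi q q (EuclideanSpace.single i (1 : ℝ))) i
        (fderiv ℝ (chartField q X) (extChartAt (𝓡 n) q q)
          (dphi q q (EuclideanSpace.single i (1 : ℝ)))))) /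
      chartForm q Ω (extChartAt (𝓡 n) q q) (fun i => EuclideanSpace.single i (1 : ℝ)) :=
    congrArg (_ / ·) (DFunLike.congr_fun hval _).symm
  rw [h1, hw]
  have h2 : ∀ i : Fin n, dphi q q (EuclideanSpace.single i (1 : ℝ)) = EuclideanSpace.single i 1 :=
    fun i => congrFun hw i
  simp_rw [h2]
  have h3 := sum_update_basis (chartForm q Ω (extChartAt (𝓡 n) q q)).toAlternatingMap
    (EuclideanSpace.basisFun (Fin n) ℝ).toBasis (fderiv ℝ (chartField q X) (extChartAt (𝓡 n) q q))
  have h4 := topForm_basis_ne_zero (hval.trans_ne h0) (EuclideanSpace.basisFun (Fin n) ℝ).toBasis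
  rw [coe_basisFun] at h3 h4
  have h5 := h3
  simp only [ContinuousAlternatingMap.coe_toAlternatingMap] at h5
  rw [h5, coordDivergence, add_div, mul_div_assoc, div_self h4, mul_one,
    fderiv_continuousAlternatingMap_apply_const hd]
  rfl

theorem chartField_hgrad {S : Structure n k M} {U : Set M}
    {X : Fin k → ∀ p : M, TangentSpace (𝓡 n) p} (hX : IsOrthoFrame S U X) {f : M → ℝ}
    (hf : ContMDiff (𝓡 n) 𝓘(ℝ, ℝ) ∞ f) {c : M} {x : E n}
    (hx : x ∈ (extChartAt (𝓡 n) c).target) (hxU : (extChartAt (𝓡 n) c).symm x ∈ U) :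
    chartField c (S.hgrad f) x =
      ∑ i, fderiv ℝ (f ∘ (extChartAt (𝓡 n) c).symm) x (chartField c (X i) x) •
        chartField c (X i) x := by
  have h : S.hgrad f ((extChartAt (𝓡 n) c).symm x) = _ := hX.sharp_eq hxU _
  rw [tangentMap_chartField, h]
  refine (map_sum (dphi c ((extChartAt (𝓡 n) c).symm x)) _ _).trans ?_
  refine Finset.sum_congr rfl fun i _ => ?_
  refine (map_smul (dphi c ((extChartAt (𝓡 n) c).symm x)) _ _).trans ?_
  rw [dFun_apply_field hx ((hf _).mdifferentiableAt (by simp))]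
  rfl

end Restrict

/-! ### The completed frame and its density. -/

section Compatibility

variable {k : ℕ} {M : Type*} [TopologicalSpace M] [ChartedSpace (E (k + 1)) M]

/-- The frame `(X₀, X₁, …, X_k)`. -/
def fullFrame (X₀ : ∀ p : M, TangentSpace (𝓡 (k + 1)) p)
    (X : Fin k → ∀ p : M, TangentSpace (𝓡 (k + 1)) p) :
    Fin (k + 1) → ∀ p : M, TangentSpace (𝓡 (k + 1)) p :=
  Fin.cons X₀ X

/-- The density `Ω(X₀, …, X_k) / η(X₀)`. -/
def frameDensity (η : DForm (k + 1) M 1) (Ω : DForm (k + 1) M (k + 1))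
    (X₀ : ∀ p : M, TangentSpace (𝓡 (k + 1)) p)
    (X : Fin k → ∀ p : M, TangentSpace (𝓡 (k + 1)) p) (q : M) : ℝ :=
  Ω q (fun a => fullFrame X₀ X a q) / η q ![X₀ q]

variable [IsManifold (𝓡 (k + 1)) ∞ M]

theorem IsOrthoFrame.smooth_fullFrame {S : Structure (k + 1) k M} {U : Set M}
    {X : Fin k → ∀ p : M, TangentSpace (𝓡 (k + 1)) p} (hX : IsOrthoFrame S U X)
    {X₀ : ∀ p : M, TangentSpace (𝓡 (k + 1)) p} (hX₀ : SmoothFieldOn U X₀) (a : Fin (k + 1)) :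
    SmoothFieldOn U (fullFrame X₀ X a) := by
  refine Fin.cases ?_ (fun i => ?_) a
  · exact hX₀
  · exact hX.smooth i

theorem IsOrthoFrame.exists_basis {S : Structure (k + 1) k M} {U : Set M}
    {X : Fin k → ∀ p : M, TangentSpace (𝓡 (k + 1)) p} (hX : IsOrthoFrame S U X)
    {X₀ : ∀ p : M, TangentSpace (𝓡 (k + 1)) p} {p : M} (hp : p ∈ U) (h0 : X₀ p ∉ S.D p) :
    ∃ b : Module.Basis (Fin (k + 1)) ℝ (E (k + 1)), ∀ a, b a = vec (fullFrame X₀ X a) p := by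
  obtain ⟨b, hb, -⟩ := hX.basis p hp
  obtain ⟨c, hc⟩ := exists_basis_cons (D := S.D p) b (v := vec X₀ p) h0
  refine ⟨c, fun a => ?_⟩
  rw [hc]
  refine Fin.cases rfl (fun i => ?_) a
  exact hb i

end Compatibility

/-! ### The first-order coefficients in coordinates. -/

section Coordinates

variable {k : ℕ}

theorem oneForm_add {n : ℕ} (A : E n [⋀^Fin 1]→L[ℝ] ℝ) (v w : E n) :
    A ![v + w] = A ![v] + A ![w] := by
  have h : ∀ u : E n, Function.update ![v] 0 u = ![u] := fun u => by ext i; fin_cases i; rfl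
  simpa only [h] using A.map_update_add ![v] 0 v w

theorem oneForm_smul {n : ℕ} (A : E n [⋀^Fin 1]→L[ℝ] ℝ) (c : ℝ) (v : E n) :
    A ![c • v] = c * A ![v] := by
  have h : ∀ u : E n, Function.update ![v] 0 u = ![u] := fun u => by ext i; fin_cases i; rfl
  simpa only [h, smul_eq_mul] using A.map_update_smul ![v] 0 c v

theorem oneForm_eq_repr_zero {A : E (k + 1) [⋀^Fin 1]→L[ℝ] ℝ}
    (b : Module.Basis (Fin (k + 1)) ℝ (E (k + 1))) (h0 : ∀ i : Fin k, A ![b i.succ] = 0)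
    (w : E (k + 1)) : A ![w] = b.repr w 0 * A ![b 0] := by
  let B : E (k + 1) →ₗ[ℝ] ℝ :=
    { toFun := fun v => A ![v]
      map_add' := oneForm_add A
      map_smul' := oneForm_smul A }
  have h : B w = b.repr w 0 * B (b 0) := by
    conv_lhs => rw [← b.sum_repr w]
    rw [map_sum, Fin.sum_univ_succ, map_smul, smul_eq_mul, Finset.sum_eq_zero, add_zero]
    intro i _
    rw [map_smul]
    change _ • A ![b i.succ] = 0
    rw [h0, smul_zero]
  exact h

/-- The brackets with indices at least 1 cancel. In the remaining one the coefficient along `Y 0` is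
read off with `A / A(Y 0)`, and Cartan's formula applies. The first two terms on the right form the
logarithmic derivative of Ω(Y) / A(Y 0); this is why the density is divided by η(X₀). -/
theorem coordDivergence_sub_bracket {Ω : E (k + 1) → E (k + 1) [⋀^Fin (k + 1)]→L[ℝ] ℝ}
    {A : E (k + 1) → E (k + 1) [⋀^Fin 1]→L[ℝ] ℝ} {Y : Fin (k + 1) → E (k + 1) → E (k + 1)}
    {x : E (k + 1)} (hΩ : DifferentiableAt ℝ Ω x) (hΩ0 : Ω x ≠ 0)
    (hY : ∀ i, DifferentiableAt ℝ (Y i) x) (hA : DifferentiableAt ℝ A x)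
    (b : Module.Basis (Fin (k + 1)) ℝ (E (k + 1))) (hb : ∀ i, b i = Y i x)
    (h0 : ∀ i : Fin k, (fun y => A y ![Y i.succ y]) =ᶠ[𝓝 x] 0) (hA0 : A x ![Y 0 x] ≠ 0)
    (i : Fin k) :
    coordDivergence Ω (Y i.succ) x - ∑ j : Fin k, b.repr (fderiv ℝ (Y i.succ) x (Y j.succ x) -
        fderiv ℝ (Y j.succ) x (Y i.succ x)) j.succ =
      fderiv ℝ (fun y => Ω y fun a => Y a y) x (Y i.succ x) / (Ω x fun a => Y a x) -
        fderiv ℝ (fun y => A y ![Y 0 y]) x (Y i.succ x) / A x ![Y 0 x] -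
        (A x ![Y 0 x])⁻¹ * extDeriv A x ![Y 0 x, Y i.succ x] := by
  have h1 := oneForm_eq_repr_zero (A := A x) b
    (fun j => by rw [hb]; exact (h0 j).eq_of_nhds)
    (fderiv ℝ (Y i.succ) x (Y 0 x) - fderiv ℝ (Y 0) x (Y i.succ x))
  rw [oneForm_bracket hA (hY i.succ) (hY 0) (h0 i), hb 0] at h1
  rw [coordDivergence_frame hΩ hΩ0 hY b hb, Fin.sum_univ_succ]
  have h2 : b.repr (fderiv ℝ (Y i.succ) x (Y 0 x) - fderiv ℝ (Y 0) x (Y i.succ x)) 0 =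
      (- fderiv ℝ (fun y => A y ![Y 0 y]) x (Y i.succ x) - extDeriv A x ![Y 0 x, Y i.succ x]) /
        A x ![Y 0 x] := by
    rw [eq_div_iff hA0, ← h1]
  rw [h2]
  field_simp
  ring

theorem fderiv_div_apply {F e : E k → ℝ} {x : E k} (hF : DifferentiableAt ℝ F x)
    (he : DifferentiableAt ℝ e x) (hF0 : F x ≠ 0) (he0 : e x ≠ 0) (w : E k) :
    fderiv ℝ (fun y => F y / e y) x w =
      F x / e x * (fderiv ℝ F x w / F x - fderiv ℝ e x w / e x) := by
  have h := (hF.hasFDerivAt.mul ((hasDerivAt_inv he0).comp_hasFDerivAt x he.hasFDerivAt)).fderiv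
  have h' : fderiv ℝ (fun y => F y / e y) x = _ := h
  rw [h']
  simp only [_root_.smul_apply, _root_.add_apply, smul_eq_mul, Function.comp_apply]
  field_simp
  ring

end Coordinates

/-! ### Compatibility as a first-order equation for the density along D. -/

section Compatibility

variable {k : ℕ} {M : Type*} [TopologicalSpace M] [ChartedSpace (E (k + 1)) M]
  [IsManifold (𝓡 (k + 1)) ∞ M] {S : Structure (k + 1) k M} {U : Set M}
  {X : Fin k → ∀ p : M, TangentSpace (𝓡 (k + 1)) p}
  {X₀ : ∀ p : M, TangentSpace (𝓡 (k + 1)) p} {η : DForm (k + 1) M 1}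
  {Ω : DForm (k + 1) M (k + 1)}

theorem chartForm_one_chartField {c : M} {x : E (k + 1)}
    (hx : x ∈ (extChartAt (𝓡 (k + 1)) c).target) (Y : ∀ p : M, TangentSpace (𝓡 (k + 1)) p) :
    chartForm c η x ![chartField c Y x] = η ((extChartAt (𝓡 (k + 1)) c).symm x)
      ![Y ((extChartAt (𝓡 (k + 1)) c).symm x)] := by
  have h := chartForm_chartField hx η fun _ : Fin 1 => Y
  have h1 : (fun _ : Fin 1 => chartField c Y x) = ![chartField c Y x] := by
    ext i; fin_cases i; rfl
  rw [h1] at h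
  rw [h]
  congr 1
  ext i; fin_cases i; rfl

theorem chartForm_two_chartField {β : DForm (k + 1) M 2} {c : M} {x : E (k + 1)}
    (hx : x ∈ (extChartAt (𝓡 (k + 1)) c).target) (Y Z : ∀ p : M, TangentSpace (𝓡 (k + 1)) p) :
    chartForm c β x ![chartField c Y x, chartField c Z x] = β ((extChartAt (𝓡 (k + 1)) c).symm x)
      ![Y ((extChartAt (𝓡 (k + 1)) c).symm x), Z ((extChartAt (𝓡 (k + 1)) c).symm x)] := by
  rw [chartForm_apply]
  congr 1
  funext i
  fin_cases i
  · exact dpsi_chartField hx Y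
  · exact dpsi_chartField hx Z

theorem frameDensity_chart {c : M} {x : E (k + 1)}
    (hx : x ∈ (extChartAt (𝓡 (k + 1)) c).target) :
    frameDensity η Ω X₀ X ((extChartAt (𝓡 (k + 1)) c).symm x) =
      chartForm c Ω x (fun a => chartField c (fullFrame X₀ X a) x) /
        chartForm c η x ![chartField c X₀ x] := by
  rw [chartForm_chartField hx, chartForm_one_chartField hx]
  rfl

/-- The values of an orthonormal frame, completed by `X₀`, on a volume form do not vanish. -/
theorem volume_fullFrame_ne_zero (hX : IsOrthoFrame S U X) {q : M} (hq : q ∈ U)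
    (h0 : X₀ q ∉ S.D q) (hΩ : Ω q ≠ 0) : Ω q (fun a => fullFrame X₀ X a q) ≠ 0 := by
  obtain ⟨b, hb⟩ := hX.exists_basis hq h0
  have h : Ω q b ≠ 0 := topForm_basis_ne_zero (A := Ω q) hΩ b
  rwa [show ⇑b = fun a => vec (fullFrame X₀ X a) q from funext hb] at h

/-- Evaluation is analytic jointly in the form and the vectors, being multilinear in the vectors and
linear in the form. -/
theorem contDiffAt_form_frame {n m : ℕ} {A : E n → E n [⋀^Fin m]→L[ℝ] ℝ} {Y : Fin m → E n → E n}
    {x : E n} (hA : ContDiffAt ℝ ∞ A x) (hY : ∀ i, ContDiffAt ℝ ∞ (Y i) x) :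
    ContDiffAt ℝ ∞ (fun y => A y fun i => Y i y) x := by
  have h1 : ContDiff ℝ ∞ fun z : (E n [⋀^Fin m]→L[ℝ] ℝ) × (Fin m → E n) => z.1 z.2 := by
    rw [← contDiffOn_univ]
    let T : (E n [⋀^Fin m]→L[ℝ] ℝ) →L[ℝ] ContinuousMultilinearMap ℝ (fun _ : Fin m => E n) ℝ :=
      ContinuousAlternatingMap.toContinuousMultilinearMapCLM ℝ
    exact (T.analyticOnNhd_uncurry_of_multilinear (s := univ)).contDiffOn uniqueDiffOn_univ
  exact h1.contDiffAt.comp x (hA.prodMk (contDiffAt_pi.2 hY))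

theorem contDiffAt_oneForm_field {n : ℕ} {A : E n → E n [⋀^Fin 1]→L[ℝ] ℝ} {Y : E n → E n}
    {x : E n} (hA : ContDiffAt ℝ ∞ A x) (hY : ContDiffAt ℝ ∞ Y x) :
    ContDiffAt ℝ ∞ (fun y => A y ![Y y]) x := by
  have h := contDiffAt_form_frame hA (Y := fun _ : Fin 1 => Y) fun _ => hY
  have h1 : ∀ v : E n, (fun _ : Fin 1 => v) = ![v] := fun v => by ext i; fin_cases i; rfl
  simpa only [h1] using h

theorem contDiffAt_frameDensity (hU : IsOpen U) (hX : IsOrthoFrame S U X)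
    (hX₀ : SmoothFieldOn U X₀) (hηs : SmoothFormOn U η) (hΩ : SmoothFormOn U Ω) {c : M}
    {x : E (k + 1)} (hx : x ∈ (extChartAt (𝓡 (k + 1)) c).target)
    (hxU : (extChartAt (𝓡 (k + 1)) c).symm x ∈ U)
    (h0 : η ((extChartAt (𝓡 (k + 1)) c).symm x) ![X₀ ((extChartAt (𝓡 (k + 1)) c).symm x)] ≠ 0) :
    ContDiffAt ℝ ∞ (frameDensity η Ω X₀ X ∘ (extChartAt (𝓡 (k + 1)) c).symm) x := by
  have hY : ∀ a, ContDiffAt ℝ ∞ (chartField c (fullFrame X₀ X a)) x := fun a =>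
    (hX.smooth_fullFrame hX₀ a).contDiffAt (n := k + 1) hU hx hxU
  have h1 : ContDiffAt ℝ ∞ (fun y => chartForm c Ω y (fun a => chartField c (fullFrame X₀ X a) y) /
      chartForm c η y ![chartField c X₀ y]) x := by
    refine (contDiffAt_form_frame (hΩ.contDiffAt (n := k + 1) hU hx hxU) hY).div
      (contDiffAt_oneForm_field (hηs.contDiffAt (n := k + 1) hU hx hxU) (hY 0)) ?_
    exact fun h => h0 ((chartForm_one_chartField hx X₀).symm.trans h)
  refine h1.congr_of_eventuallyEq ?_
  filter_upwards [target_mem_nhds hx] with y hy using frameDensity_chart hy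

/-- Pointwise characterization of the volumes for which the microscopic and the macroscopic
Laplacians agree. -/
theorem compatibleAt_iff [T2Space M] (hk : k ≠ 0) (hU : IsOpen U) (hX : IsOrthoFrame S U X)
    (hX₀ : SmoothFieldOn U X₀) {μ : M → Measure (Cov (k + 1))}
    (hμ : S.IsAdapted (fun q => Submodule.span ℝ {X₀ q}) μ) (hηs : SmoothFormOn U η)
    (hker : ∀ q v, v ∈ S.D q ↔ η q ![v] = 0) (hη0 : ∀ q, η q ![X₀ q] ≠ 0)
    (hΩ : IsVolumeOn U Ω) {q : M} (hq : q ∈ U) :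
    (∀ f : M → ℝ, ContMDiff (𝓡 (k + 1)) 𝓘(ℝ, ℝ) ∞ f →
      S.HasMicroLaplacianAt μ f q (S.macroLaplacian Ω f q)) ↔
    ∀ i, dFun (frameDensity η Ω X₀ X) q (X i q) =
      frameDensity η Ω X₀ X q * ((η q ![X₀ q])⁻¹ * extD η q ![X₀ q, X i q]) := by
  set x := extChartAt (𝓡 (k + 1)) q q with hxdef
  have hψx : (extChartAt (𝓡 (k + 1)) q).symm x = q := extChartAt_to_inv q
  have hxt : x ∈ (extChartAt (𝓡 (k + 1)) q).target := mem_extChartAt_target q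
  have hxU : (extChartAt (𝓡 (k + 1)) q).symm x ∈ U := by rwa [hψx]
  set Y : Fin (k + 1) → E (k + 1) → E (k + 1) := fun a => chartField q (fullFrame X₀ X a) with hYdef
  set W := chartForm q Ω with hW
  set A := chartForm q η with hA
  have hYs : ∀ a, ContDiffAt ℝ ∞ (Y a) x := fun a =>
    (hX.smooth_fullFrame hX₀ a).contDiffAt (n := k + 1) hU hxt hxU
  have hYd : ∀ a, DifferentiableAt ℝ (Y a) x := fun a => (hYs a).differentiableAt (by simp)
  have hWd : DifferentiableAt ℝ W x :=
    (hΩ.1.contDiffAt (n := k + 1) hU hxt hxU).differentiableAt (by simp)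
  have hAd : DifferentiableAt ℝ A x :=
    (hηs.contDiffAt (n := k + 1) hU hxt hxU).differentiableAt (by simp)
  have hev : ∀ᶠ y in 𝓝 x, y ∈ (extChartAt (𝓡 (k + 1)) q).target ∧
      (extChartAt (𝓡 (k + 1)) q).symm y ∈ U := chart_preimage_mem_nhds (n := k + 1) hU hxt hxU
  have hA0 : A x ![Y 0 x] ≠ 0 := by
    have h := chartForm_one_chartField (η := η) hxt (fullFrame X₀ X 0)
    rw [hA, hYdef]
    intro h'
    exact hη0 _ (h.symm.trans h')
  have hAY : ∀ i : Fin k, (fun y => A y ![Y i.succ y]) =ᶠ[𝓝 x] 0 := by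
    intro i
    filter_upwards [hev] with y hy
    have h := chartForm_one_chartField (η := η) hy.1 (fullFrame X₀ X i.succ)
    refine h.trans ((hker _ _).1 ?_)
    exact hX.mem_D hy.2 i
  have h0D : X₀ q ∉ S.D q := fun h => hη0 q ((hker q _).1 h)
  obtain ⟨b, hb⟩ := hX.exists_basis (X₀ := X₀) hq h0D
  have hbY : ∀ a, b a = Y a x := fun a => (hb a).trans (chartField_self q _).symm
  have hW0 : W x ≠ 0 := by
    intro h
    have h1 := chartForm_chartField hxt Ω (fullFrame X₀ X)
    have h2 := volume_fullFrame_ne_zero hX (X₀ := X₀) hxU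
      (fun h => hη0 _ ((hker _ _).1 h)) (hΩ.2 _ hxU)
    rw [← h1] at h2
    exact h2 (DFunLike.congr_fun h _)
  have hF0 : (W x fun a => Y a x) ≠ 0 := by
    have h3 := topForm_basis_ne_zero hW0 b
    rwa [show ⇑b = fun a => Y a x from funext hbY] at h3
  -- the coefficients whose vanishing is equivalent to compatibility
  set coef : Fin k → ℝ := fun i => coordDivergence W (Y i.succ) x -
    ∑ j : Fin k, b.repr (fderiv ℝ (Y i.succ) x (Y j.succ x) -
        fderiv ℝ (Y j.succ) x (Y i.succ x)) j.succ with hcoef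
  -- The coordinate formula solved for the density: its logarithmic derivative along X_i is `coef i`
  -- plus α(X_i).
  have hdens : ∀ i, dFun (frameDensity η Ω X₀ X) q (X i q) =
      frameDensity η Ω X₀ X q * (coef i + (η q ![X₀ q])⁻¹ * extD η q ![X₀ q, X i q]) := by
    intro i
    have hρd : ContDiffAt ℝ ∞ (frameDensity η Ω X₀ X ∘ (extChartAt (𝓡 (k + 1)) q).symm) x :=
      contDiffAt_frameDensity hU hX hX₀ hηs hΩ.1 hxt hxU (hη0 _)
    have h1 := dFun_apply_field hxt
      ((contMDiffAt_of_chart hxt hρd).mdifferentiableAt (by simp)) (X i)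
    have h2 : frameDensity η Ω X₀ X ∘ (extChartAt (𝓡 (k + 1)) q).symm =ᶠ[𝓝 x]
        fun y => (W y fun a => Y a y) / A y ![Y 0 y] := by
      filter_upwards [hev] with y hy using frameDensity_chart hy.1
    rw [h2.fderiv_eq] at h1
    have h3 := fderiv_div_apply (differentiableAt_form_frame hWd hYd)
      ((contDiffAt_oneForm_field (hηs.contDiffAt (n := k + 1) hU hxt hxU)
        (hYs 0)).differentiableAt (by simp)) hF0 hA0 (Y i.succ x)
    have h4 := coordDivergence_sub_bracket hWd hW0 hYd hAd b hbY hAY hA0 i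
    have h5 := h2.eq_of_nhds
    have h6 := chartForm_one_chartField (η := η) hxt X₀
    have h7 := chartForm_two_chartField (β := extD η) hxt X₀ (X i)
    rw [chartForm_extD hU hηs hxt hxU] at h7
    have h8 := h1.trans h3
    have h9 : dFun (frameDensity η Ω X₀ X) ((extChartAt (𝓡 (k + 1)) q).symm x)
        (X i ((extChartAt (𝓡 (k + 1)) q).symm x)) =
      frameDensity η Ω X₀ X ((extChartAt (𝓡 (k + 1)) q).symm x) *
        (coef i + (η ((extChartAt (𝓡 (k + 1)) q).symm x)
          ![X₀ ((extChartAt (𝓡 (k + 1)) q).symm x)])⁻¹ *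
          extD η ((extChartAt (𝓡 (k + 1)) q).symm x)
          ![X₀ ((extChartAt (𝓡 (k + 1)) q).symm x), X i ((extChartAt (𝓡 (k + 1)) q).symm x)]) := by
      rw [← h6, ← h7, h8]
      change _ = (frameDensity η Ω X₀ X ∘ (extChartAt (𝓡 (k + 1)) q).symm) x * _
      rw [h5]
      simp only [hcoef]
      rw [h4]
      congr 1
      change _ = _ + (A x ![Y 0 x])⁻¹ * extDeriv A x ![Y 0 x, Y i.succ x]
      ring
    rwa [hψx] at h9
  have hρ0 : frameDensity η Ω X₀ X q ≠ 0 :=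
    div_ne_zero (volume_fullFrame_ne_zero hX hq h0D (hΩ.2 q hq)) (hη0 q)
  have hRHS : (∀ i, dFun (frameDensity η Ω X₀ X) q (X i q) =
      frameDensity η Ω X₀ X q * ((η q ![X₀ q])⁻¹ * extD η q ![X₀ q, X i q])) ↔
      ∀ i, coef i = 0 := by
    refine forall_congr' fun i => ?_
    rw [hdens i]
    constructor
    · intro h
      have := mul_left_cancel₀ hρ0 h
      linarith
    · intro h
      rw [h, zero_add]
  rw [hRHS]
  have hθ : ∀ w : E (k + 1), w = ∑ l : Fin k,
      (b.coord l.succ).toContinuousLinearMap w • vec (X l) q +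
        (b.coord 0).toContinuousLinearMap w • vec X₀ q := by
    intro w
    conv_lhs => rw [← b.sum_repr w, Fin.sum_univ_succ, add_comm, hb 0]
    simp_rw [hb]
    rfl
  -- The second-order parts of the two Laplacians coincide, so their difference is a derivation with
  -- coefficients `coef`.
  have hmain : ∀ f : M → ℝ, ContMDiff (𝓡 (k + 1)) 𝓘(ℝ, ℝ) ∞ f →
      (S.HasMicroLaplacianAt μ f q (S.macroLaplacian Ω f q) ↔
        ∑ i : Fin k, fderiv ℝ (f ∘ (extChartAt (𝓡 (k + 1)) q).symm) x (Y i.succ x) * coef i = 0) := by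
    intro f hf
    rw [hasMicroLaplacianAt_iff hk hU hX hμ hq hθ hf]
    set fq := f ∘ (extChartAt (𝓡 (k + 1)) q).symm with hfq
    have hfs : ContDiffAt ℝ ∞ fq x := contDiffAt_chart_of_contMDiffAt hxt (hf _)
    have hfi : ∀ i, DifferentiableAt ℝ (fun y => fderiv ℝ fq y (Y i y)) x := fun i =>
      ((hfs.fderiv_right (m := ∞) (by simp)).clm_apply (hYs i)).differentiableAt (by simp)
    have hdivL : S.macroLaplacian Ω f q = ∑ i : Fin k,
        (fderiv ℝ (fun y => fderiv ℝ fq y (Y i.succ y)) x (Y i.succ x) +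
          fderiv ℝ fq x (Y i.succ x) * coordDivergence W (Y i.succ) x) := by
      rw [Structure.macroLaplacian, divergence_eq_coordDivergence hU hΩ.1 hq _ (hΩ.2 q hq),
        ← coordDivergence_sum (fun i => hYd i.succ) (fun i => hfi i.succ)]
      refine coordDivergence_congr ?_
      filter_upwards [hev] with y hy
      exact chartField_hgrad hX hf hy.1 hy.2
    have hmicro : microValue (fun i => chartField q (X i))
        (fun l : Fin k => (b.coord l.succ).toContinuousLinearMap) fq x =
        ∑ i : Fin k, (fderiv ℝ (fun y => fderiv ℝ fq y (Y i.succ y)) x (Y i.succ x) +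
          (∑ j : Fin k, b.repr (fderiv ℝ (Y i.succ) x (Y j.succ x) -
            fderiv ℝ (Y j.succ) x (Y i.succ x)) j.succ) * fderiv ℝ fq x (Y i.succ x)) := rfl
    rw [hdivL, hmicro, ← sub_eq_zero, ← Finset.sum_sub_distrib]
    have : ∀ i : Fin k, (fderiv ℝ (fun y => fderiv ℝ fq y (Y i.succ y)) x (Y i.succ x) +
          fderiv ℝ fq x (Y i.succ x) * coordDivergence W (Y i.succ) x) -
        (fderiv ℝ (fun y => fderiv ℝ fq y (Y i.succ y)) x (Y i.succ x) +
          (∑ j : Fin k, b.repr (fderiv ℝ (Y i.succ) x (Y j.succ x) -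
            fderiv ℝ (Y j.succ) x (Y i.succ x)) j.succ) * fderiv ℝ fq x (Y i.succ x)) =
        fderiv ℝ fq x (Y i.succ x) * coef i := fun i => by
      simp only [hcoef]; ring
    simp_rw [this]
  constructor
  · intro h i
    -- A global function whose differential at `q` is the i-th dual frame covector isolates `coef
    -- i`.
    obtain ⟨f, hf, hfe⟩ := exists_test_function q ((b.coord i.succ).toContinuousLinearMap)
    have h1 := (hmain f hf).1 (h f hf)
    rw [hfe.fderiv_eq, ContinuousLinearMap.fderiv] at h1
    rw [Finset.sum_eq_single i] at h1
    · rw [← hbY] at h1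
      simpa using h1
    · intro j _ hj
      rw [← hbY]
      simp [hj]
    · simp
  · intro h f hf
    rw [hmain f hf]
    exact Finset.sum_eq_zero fun i _ => by rw [h i, mul_zero]

end Compatibility

/-! ### Wedge products as sums over permutations. -/

section Wedge

variable {W : Type*} [AddCommGroup W] [Module ℝ W] {k l m : ℕ}

/-- The wedge product as a sum over all permutations. -/
theorem wedge_apply (a : W [⋀^Fin k]→ₗ[ℝ] ℝ) (b : W [⋀^Fin l]→ₗ[ℝ] ℝ) (v : Fin (k + l) → W) :
    ((k.factorial * l.factorial : ℕ) : ℝ) * wedge a b v =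
      ∑ σ : Equiv.Perm (Fin k ⊕ Fin l), ((Equiv.Perm.sign σ : ℤ) : ℝ) *
        (a (fun i => v (finSumFinEquiv (σ (Sum.inl i)))) *
          b (fun i => v (finSumFinEquiv (σ (Sum.inr i))))) := by
  have h := MultilinearMap.domCoprod_alternization_eq a b
  have h1 := congrArg (fun A => LinearMap.mul' ℝ ℝ (A fun i => v (finSumFinEquiv i))) h
  simp only [Fintype.card_fin, AlternatingMap.smul_apply] at h1
  rw [map_nsmul, nsmul_eq_mul] at h1
  rw [show wedge a b v =
    LinearMap.mul' ℝ ℝ (a.domCoprod b fun i => v (finSumFinEquiv i)) from rfl, ← h1,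
    MultilinearMap.alternatization_apply, map_sum]
  refine Finset.sum_congr rfl fun σ _ => ?_
  rw [Units.smul_def, map_zsmul, zsmul_eq_mul]
  rfl

theorem wedge_compLinearMap {V : Type*} [AddCommGroup V] [Module ℝ V] (A : V →ₗ[ℝ] W)
    (a : W [⋀^Fin k]→ₗ[ℝ] ℝ) (b : W [⋀^Fin l]→ₗ[ℝ] ℝ) :
    (wedge a b).compLinearMap A = wedge (a.compLinearMap A) (b.compLinearMap A) := by
  ext v
  have hne : ((k.factorial * l.factorial : ℕ) : ℝ) ≠ 0 := by positivity
  refine mul_left_cancel₀ hne ?_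
  rw [wedge_apply, AlternatingMap.compLinearMap_apply, wedge_apply]
  rfl

theorem wedgePow_compLinearMap {V : Type*} [AddCommGroup V] [Module ℝ V] (A : V →ₗ[ℝ] W)
    (b : W [⋀^Fin 2]→ₗ[ℝ] ℝ) (m : ℕ) :
    (wedgePow b m).compLinearMap A = wedgePow (b.compLinearMap A) m := by
  induction m with
  | zero => rfl
  | succ m ih => exact (wedge_compLinearMap A _ _).trans (congrArg (wedge · _) ih)

theorem wedge_one_one_apply (a b : W [⋀^Fin 1]→ₗ[ℝ] ℝ) (v w : W) :
    wedge a b ![v, w] = a ![v] * b ![w] - a ![w] * b ![v] := by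
  have h := wedge_apply a b ![v, w]
  simp only [Nat.factorial_one, mul_one, Nat.cast_one, one_mul] at h
  rw [h, ← Equiv.sum_comp (Equiv.permCongr (finSumFinEquiv (m := 1) (n := 1)).symm)]
  have h2 : (Finset.univ : Finset (Equiv.Perm (Fin (1 + 1)))) = {1, Equiv.swap 0 1} := by decide
  rw [h2, Finset.sum_pair (by decide)]
  have e1 : ∀ u : Fin 1 → W, ∀ x : W, u 0 = x → u = ![x] := fun u x h => by
    ext i; fin_cases i; exact h
  simp only [Equiv.Perm.sign_permCongr, Equiv.Perm.sign_one, Equiv.Perm.sign_swap (zero_ne_one),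
    Equiv.permCongr_apply]
  rw [e1 (fun i => _) v (by rfl), e1 (fun i => _) w (by rfl), e1 (fun i => _) w (by rfl),
    e1 (fun i => _) v (by rfl)]
  push_cast
  ring

end Wedge

/-! ### Forms represented in the exterior algebra of the dual space, where wedge identities are ring
identities. -/

section Representation

open ExteriorAlgebra

variable {W : Type*} [AddCommGroup W] [Module ℝ W] {k l m : ℕ}

/-- The determinant `λ ↦ det (λᵢ vⱼ)`. -/
def detAt (v : Fin m → W) : Module.Dual ℝ W [⋀^Fin m]→ₗ[ℝ] ℝ :=
  (Matrix.detRowAlternating (R := ℝ) (n := Fin m)).compLinearMap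
    (LinearMap.pi fun j => Module.Dual.eval ℝ W (v j))

theorem detAt_apply (v : Fin m → W) (lam : Fin m → Module.Dual ℝ W) :
    detAt v lam = Matrix.det (Matrix.of fun i j => lam i (v j)) := rfl

/-- The evaluation of the degree `m` part of an element of the exterior algebra of the dual space
on `m` vectors. -/
def extEval (v : Fin m → W) : ExteriorAlgebra ℝ (Module.Dual ℝ W) →ₗ[ℝ] ℝ :=
  liftAlternating (Pi.single (M := fun i => Module.Dual ℝ W [⋀^Fin i]→ₗ[ℝ] ℝ) m (detAt v))

theorem extEval_ιMulti (v : Fin m → W) (lam : Fin m → Module.Dual ℝ W) :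
    extEval v (ιMulti ℝ m lam) = Matrix.det (Matrix.of fun i j => lam i (v j)) := by
  rw [extEval, liftAlternating_apply_ιMulti, Pi.single_eq_same, detAt_apply]

/-- The multilinear map `v ↦ ∏ λᵢ(vᵢ)`. -/
def prodForm (lam : Fin m → Module.Dual ℝ W) : MultilinearMap ℝ (fun _ : Fin m => W) ℝ :=
  (MultilinearMap.mkPiAlgebra ℝ (Fin m) ℝ).compLinearMap lam

theorem alternatization_prodForm (lam : Fin m → Module.Dual ℝ W) (v : Fin m → W) :
    MultilinearMap.alternatization (prodForm lam) v = extEval v (ιMulti ℝ m lam) := by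
  rw [extEval_ιMulti, ← Matrix.det_transpose, Matrix.det_apply,
    MultilinearMap.alternatization_apply]
  refine Finset.sum_congr rfl fun σ _ => ?_
  congr 1

/-- Both sides expand to the same signed sum over permutations: one as a determinant, the other
through the alternatization of a tensor product of products of covectors. -/
theorem extEval_ιMulti_mul (lam : Fin k → Module.Dual ℝ W) (mu : Fin l → Module.Dual ℝ W)
    (v : Fin (k + l) → W) :
    extEval v (ιMulti ℝ k lam * ιMulti ℝ l mu) =
      wedge (MultilinearMap.alternatization (prodForm lam))
        (MultilinearMap.alternatization (prodForm mu)) v := by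
  have h := MultilinearMap.domCoprod_alternization (prodForm lam) (prodForm mu)
  rw [show wedge (MultilinearMap.alternatization (prodForm lam))
      (MultilinearMap.alternatization (prodForm mu)) v =
    LinearMap.mul' ℝ ℝ ((MultilinearMap.alternatization (prodForm lam)).domCoprod
      (MultilinearMap.alternatization (prodForm mu)) fun i => v (finSumFinEquiv i)) from rfl, ← h,
    MultilinearMap.alternatization_apply, map_sum, ιMulti_mul_ιMulti, extEval_ιMulti,
    ← Matrix.det_transpose, ← Matrix.det_submatrix_equiv_self finSumFinEquiv, Matrix.det_apply]
  refine Finset.sum_congr rfl fun σ _ => ?_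
  rw [Units.smul_def, Units.smul_def, map_zsmul]
  congr 1
  rw [Fintype.prod_sum_type]
  simp only [Matrix.submatrix_apply, Matrix.transpose_apply, Matrix.of_apply,
    finSumFinEquiv_apply_left, finSumFinEquiv_apply_right, Fin.append_left, Fin.append_right]
  rfl

/-- Both sides are bilinear and homogeneous elements are sums of decomposable ones, so the
decomposable case is enough. The factorials correct for summing over all permutations rather than
shuffles. -/
theorem extEval_mul {x y : ExteriorAlgebra ℝ (Module.Dual ℝ W)}
    (hx : x ∈ ⋀[ℝ]^k (Module.Dual ℝ W)) (hy : y ∈ ⋀[ℝ]^l (Module.Dual ℝ W))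
    (v : Fin (k + l) → W) :
    ((k.factorial * l.factorial : ℕ) : ℝ) * extEval v (x * y) =
      ∑ σ : Equiv.Perm (Fin k ⊕ Fin l), ((Equiv.Perm.sign σ : ℤ) : ℝ) *
        (extEval (fun i => v (finSumFinEquiv (σ (Sum.inl i)))) x *
          extEval (fun i => v (finSumFinEquiv (σ (Sum.inr i)))) y) := by
  rw [← ιMulti_span_fixedDegree] at hx hy
  induction hx using Submodule.span_induction with
  | mem x hx =>
    obtain ⟨lam, rfl⟩ := hx
    induction hy using Submodule.span_induction with
    | mem y hy =>
      obtain ⟨mu, rfl⟩ := hy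
      rw [extEval_ιMulti_mul, wedge_apply]
      simp only [alternatization_prodForm]
    | zero => simp
    | add y₁ y₂ _ _ h₁ h₂ =>
      simp only [mul_add, map_add, Finset.sum_add_distrib] at h₁ h₂ ⊢
      rw [h₁, h₂]
    | smul c y _ h =>
      simp only [mul_smul_comm, map_smul, smul_eq_mul] at h ⊢
      rw [mul_left_comm, h, Finset.mul_sum]
      exact Finset.sum_congr rfl fun σ _ => by ring
  | zero => simp
  | add x₁ x₂ _ _ h₁ h₂ =>
    simp only [mul_add, add_mul, map_add, Finset.sum_add_distrib] at h₁ h₂ ⊢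
    rw [h₁, h₂]
  | smul c x _ h =>
    simp only [smul_mul_assoc, map_smul, smul_eq_mul] at h ⊢
    rw [mul_left_comm, h, Finset.mul_sum]
    exact Finset.sum_congr rfl fun σ _ => by ring

/-- The homogeneous element `x` of the exterior algebra of the dual space represents the
alternating form `a`. -/
def Represents (x : ExteriorAlgebra ℝ (Module.Dual ℝ W)) (a : W [⋀^Fin m]→ₗ[ℝ] ℝ) : Prop :=
  x ∈ ⋀[ℝ]^m (Module.Dual ℝ W) ∧ ∀ v, extEval v x = a v

namespace Represents

variable {x y : ExteriorAlgebra ℝ (Module.Dual ℝ W)}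

theorem wedge {a : W [⋀^Fin k]→ₗ[ℝ] ℝ} {b : W [⋀^Fin l]→ₗ[ℝ] ℝ} (hx : Represents x a)
    (hy : Represents y b) : Represents (x * y) (wedge a b) := by
  refine ⟨SetLike.GradedMul.mul_mem hx.1 hy.1, fun v => ?_⟩
  have hne : ((k.factorial * l.factorial : ℕ) : ℝ) ≠ 0 := by positivity
  refine mul_left_cancel₀ hne ?_
  rw [extEval_mul hx.1 hy.1, wedge_apply]
  simp only [hx.2, hy.2]

theorem wedgePow {b : W [⋀^Fin 2]→ₗ[ℝ] ℝ} (hx : Represents x b) (m : ℕ) :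
    Represents (x ^ m) (wedgePow b m) := by
  induction m with
  | zero =>
    rw [pow_zero]
    refine ⟨(SetLike.GradedOne.one_mem : (1 : ExteriorAlgebra ℝ (Module.Dual ℝ W)) ∈
      ⋀[ℝ]^0 (Module.Dual ℝ W)), fun v => ?_⟩
    rw [← ιMulti_zero_apply (R := ℝ) (M := Module.Dual ℝ W) (fun i => i.elim0)]
    refine (extEval_ιMulti v _).trans ?_
    exact Matrix.det_isEmpty (n := Fin 0)
  | succ m ih =>
    rw [pow_succ]
    exact ih.wedge hx

theorem add {a b : W [⋀^Fin k]→ₗ[ℝ] ℝ} (hx : Represents x a) (hy : Represents y b) :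
    Represents (x + y) (a + b) :=
  ⟨Submodule.add_mem _ hx.1 hy.1, fun v => by rw [map_add, hx.2, hy.2]; rfl⟩

theorem smul {a : W [⋀^Fin k]→ₗ[ℝ] ℝ} (hx : Represents x a) (c : ℝ) :
    Represents (c • x) (c • a) :=
  ⟨Submodule.smul_mem _ _ hx.1, fun v => by rw [map_smul, hx.2]; rfl⟩

end Represents

end Representation

/-! ### Contractions, and nonvanishing of η ∧ (dη)^d. -/

section Contraction

open ExteriorAlgebra

variable {W : Type*} [AddCommGroup W] [Module ℝ W] {n m : ℕ}

/-- The one-form `a` as an element of the dual space. -/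
def dualOf (a : W [⋀^Fin 1]→ₗ[ℝ] ℝ) : Module.Dual ℝ W where
  toFun v := a ![v]
  map_add' v w := by
    have h : ∀ u : W, Function.update ![v] 0 u = ![u] := fun u => by ext i; fin_cases i; rfl
    simpa only [h] using a.map_update_add ![v] 0 v w
  map_smul' c v := by
    have h : ∀ u : W, Function.update ![v] 0 u = ![u] := fun u => by ext i; fin_cases i; rfl
    simpa only [h, RingHom.id_apply] using a.map_update_smul ![v] 0 c v

theorem dualOf_apply (a : W [⋀^Fin 1]→ₗ[ℝ] ℝ) (v : W) : dualOf a v = a ![v] := rfl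

/-- The bilinear form of a two-form. -/
def bilinOf (b : W [⋀^Fin 2]→ₗ[ℝ] ℝ) : W →ₗ[ℝ] Module.Dual ℝ W :=
  LinearMap.mk₂ ℝ (fun v w => b ![v, w])
    (fun v v' w => by
      have h : ∀ u : W, Function.update ![v, w] 0 u = ![u, w] := fun u => by
        ext i; fin_cases i <;> rfl
      simpa only [h] using b.map_update_add ![v, w] 0 v v')
    (fun c v w => by
      have h : ∀ u : W, Function.update ![v, w] 0 u = ![u, w] := fun u => by
        ext i; fin_cases i <;> rfl
      simpa only [h] using b.map_update_smul ![v, w] 0 c v)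
    (fun v w w' => by
      have h : ∀ u : W, Function.update ![v, w] 1 u = ![v, u] := fun u => by
        ext i; fin_cases i <;> rfl
      simpa only [h] using b.map_update_add ![v, w] 1 w w')
    (fun c v w => by
      have h : ∀ u : W, Function.update ![v, w] 1 u = ![v, u] := fun u => by
        ext i; fin_cases i <;> rfl
      simpa only [h] using b.map_update_smul ![v, w] 1 c w)

theorem bilinOf_apply (b : W [⋀^Fin 2]→ₗ[ℝ] ℝ) (v w : W) : bilinOf b v w = b ![v, w] := rfl

theorem bilinOf_swap (b : W [⋀^Fin 2]→ₗ[ℝ] ℝ) (v w : W) : bilinOf b v w = - bilinOf b w v := by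
  have h := b.map_swap ![w, v] (i := 0) (j := 1) (by decide)
  rw [bilinOf_apply, bilinOf_apply, ← h]
  congr 1
  ext i; fin_cases i <;> rfl

theorem represents_dualOf (a : W [⋀^Fin 1]→ₗ[ℝ] ℝ) : Represents (ι ℝ (dualOf a)) a := by
  have h : ι ℝ (dualOf a) = ιMulti ℝ 1 ![dualOf a] := by simp
  refine ⟨h ▸ ιMulti_range ℝ 1 ⟨_, rfl⟩, fun v => ?_⟩
  rw [h, extEval_ιMulti, Matrix.det_fin_one, Matrix.of_apply, Matrix.cons_val_zero, dualOf_apply]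
  congr 1
  ext i; fin_cases i; rfl

theorem ι_mul_ι_eq (x y : Module.Dual ℝ W) : ι ℝ x * ι ℝ y = ιMulti ℝ 2 ![x, y] := by
  simp [Matrix.vecTail]

theorem extEval_ι_mul_ι (x y : Module.Dual ℝ W) (v : Fin 2 → W) :
    extEval v (ι ℝ x * ι ℝ y) = x (v 0) * y (v 1) - x (v 1) * y (v 0) := by
  rw [ι_mul_ι_eq, extEval_ιMulti, Matrix.det_fin_two]
  simp

/-- The element of the exterior algebra that represents a two-form. -/
def twoElement (e : Module.Basis (Fin n) ℝ W) (b : W [⋀^Fin 2]→ₗ[ℝ] ℝ) :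
    ExteriorAlgebra ℝ (Module.Dual ℝ W) :=
  (1 / 2 : ℝ) • ∑ i, ∑ j, bilinOf b (e i) (e j) • (ι ℝ (e.coord i) * ι ℝ (e.coord j))

theorem bilinOf_eq_sum (e : Module.Basis (Fin n) ℝ W) (b : W [⋀^Fin 2]→ₗ[ℝ] ℝ) (v w : W) :
    bilinOf b v w = ∑ i, ∑ j, bilinOf b (e i) (e j) * (e.coord i v * e.coord j w) := by
  conv_lhs => rw [← e.sum_repr v, ← e.sum_repr w]
  simp only [map_sum, LinearMap.sum_apply, map_smul, LinearMap.smul_apply, smul_eq_mul,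
    Module.Basis.coord_apply, Finset.mul_sum]
  rw [Finset.sum_comm]
  exact Finset.sum_congr rfl fun i _ => Finset.sum_congr rfl fun j _ => by ring

theorem represents_twoElement (e : Module.Basis (Fin n) ℝ W) (b : W [⋀^Fin 2]→ₗ[ℝ] ℝ) :
    Represents (twoElement e b) b := by
  refine ⟨Submodule.smul_mem _ _ (Submodule.sum_mem _ fun i _ => Submodule.sum_mem _ fun j _ =>
    Submodule.smul_mem _ _ (ι_mul_ι_eq (e.coord i) (e.coord j) ▸ ιMulti_range ℝ 2 ⟨_, rfl⟩)),
    fun v => ?_⟩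
  have h1 : b v = bilinOf b (v 0) (v 1) := by
    rw [bilinOf_apply]
    congr 1
    ext i; fin_cases i <;> rfl
  have h2 := bilinOf_eq_sum e b (v 0) (v 1)
  have h3 := bilinOf_eq_sum e b (v 1) (v 0)
  rw [bilinOf_swap] at h3
  rw [h1, twoElement, map_smul]
  simp only [map_sum, map_smul, extEval_ι_mul_ι, smul_eq_mul, mul_sub, Finset.sum_sub_distrib]
  have h4 : ∑ i, ∑ j, bilinOf b (e i) (e j) * (e.coord i (v 1) * e.coord j (v 0)) =
    - bilinOf b (v 0) (v 1) := h3.symm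
  rw [← h2, h4]
  ring

/-- Contraction with a vector. -/
def contraction (v : W) :
    ExteriorAlgebra ℝ (Module.Dual ℝ W) →ₗ[ℝ] ExteriorAlgebra ℝ (Module.Dual ℝ W) :=
  CliffordAlgebra.contractLeft (Module.Dual.eval ℝ W v)

theorem contraction_ι_mul (v : W) (x : Module.Dual ℝ W) (y : ExteriorAlgebra ℝ (Module.Dual ℝ W)) :
    contraction v (ι ℝ x * y) = x v • y - ι ℝ x * contraction v y :=
  CliffordAlgebra.contractLeft_ι_mul _ _ _

theorem contraction_one (v : W) : contraction v (1 : ExteriorAlgebra ℝ (Module.Dual ℝ W)) = 0 :=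
  CliffordAlgebra.contractLeft_one _ _

/-- Contraction is an antiderivation and a two-form has even degree, so no sign appears. The two
slots of `b` contribute equally by antisymmetry, which absorbs the factor 1/2 in `twoElement`. -/
theorem contraction_twoElement_mul (e : Module.Basis (Fin n) ℝ W) (b : W [⋀^Fin 2]→ₗ[ℝ] ℝ) (v : W)
    (y : ExteriorAlgebra ℝ (Module.Dual ℝ W)) :
    contraction v (twoElement e b * y) =
      ι ℝ (bilinOf b v) * y + twoElement e b * contraction v y := by
  have h1 : ∀ i j, contraction v (ι ℝ (e.coord i) * ι ℝ (e.coord j) * y) =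
      e.coord i v • (ι ℝ (e.coord j) * y) - e.coord j v • (ι ℝ (e.coord i) * y) +
        ι ℝ (e.coord i) * ι ℝ (e.coord j) * contraction v y := by
    intro i j
    rw [mul_assoc, contraction_ι_mul, contraction_ι_mul, mul_sub, mul_smul_comm, mul_assoc]
    abel
  have h2 : ∀ j, ∑ i, bilinOf b (e i) (e j) * e.coord i v = bilinOf b v (e j) := by
    intro j
    conv_rhs => rw [← e.sum_repr v, map_sum, LinearMap.sum_apply]
    refine Finset.sum_congr rfl fun i _ => ?_
    rw [map_smul, LinearMap.smul_apply, smul_eq_mul, mul_comm, Module.Basis.coord_apply]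
  have h3 : bilinOf b v = ∑ j, bilinOf b v (e j) • e.coord j := by
    refine e.ext fun i => ?_
    simp
  have h4 : ∑ i, ∑ j, bilinOf b (e i) (e j) • (e.coord i v • (ι ℝ (e.coord j) * y)) =
      ι ℝ (bilinOf b v) * y := by
    rw [Finset.sum_comm]
    conv_rhs => rw [h3]
    rw [map_sum, Finset.sum_mul]
    refine Finset.sum_congr rfl fun j _ => ?_
    rw [map_smul, ← h2, Finset.sum_smul, Finset.sum_mul]
    exact Finset.sum_congr rfl fun i _ => by rw [smul_smul, smul_mul_assoc]
  have h5 : ∑ i, ∑ j, bilinOf b (e i) (e j) • (e.coord j v • (ι ℝ (e.coord i) * y)) =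
      - (ι ℝ (bilinOf b v) * y) := by
    rw [← h4, Finset.sum_comm, ← Finset.sum_neg_distrib]
    refine Finset.sum_congr rfl fun i _ => ?_
    rw [← Finset.sum_neg_distrib]
    refine Finset.sum_congr rfl fun j _ => ?_
    rw [bilinOf_swap, neg_smul]
  rw [twoElement, smul_mul_assoc, map_smul, Finset.sum_mul, map_sum]
  simp_rw [Finset.sum_mul, map_sum, smul_mul_assoc, map_smul, h1, smul_add, smul_sub,
    Finset.sum_add_distrib, Finset.sum_sub_distrib]
  rw [h4, h5, Finset.sum_mul]
  simp_rw [Finset.sum_mul, smul_mul_assoc]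
  rw [smul_add]
  congr 1
  rw [sub_neg_eq_add, ← two_smul ℝ, smul_smul]
  norm_num

theorem ι_mul_ι_swap (x y : Module.Dual ℝ W) : ι ℝ x * ι ℝ y = - (ι ℝ y * ι ℝ x) :=
  eq_neg_of_add_eq_zero_left (ExteriorAlgebra.ι_add_mul_swap x y)

theorem commute_twoElement (e : Module.Basis (Fin n) ℝ W) (b : W [⋀^Fin 2]→ₗ[ℝ] ℝ)
    (x : Module.Dual ℝ W) : Commute (ι ℝ x) (twoElement e b) := by
  refine Commute.smul_right (Commute.sum_right _ _ _ fun i _ => Commute.sum_right _ _ _ fun j _ =>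
    Commute.smul_right ?_ _) _
  change ι ℝ x * (ι ℝ (e.coord i) * ι ℝ (e.coord j)) = ι ℝ (e.coord i) * ι ℝ (e.coord j) * ι ℝ x
  rw [← mul_assoc, ι_mul_ι_swap x, mul_assoc, neg_mul, mul_assoc, ι_mul_ι_swap x, mul_neg, neg_neg]

theorem contraction_twoElement_pow (e : Module.Basis (Fin n) ℝ W) (b : W [⋀^Fin 2]→ₗ[ℝ] ℝ) (v : W)
    (m : ℕ) : contraction v (twoElement e b ^ (m + 1)) =
      ((m : ℝ) + 1) • (ι ℝ (bilinOf b v) * twoElement e b ^ m) := by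
  induction m with
  | zero => simpa [contraction_one] using contraction_twoElement_mul e b v 1
  | succ m ih =>
    rw [pow_succ', contraction_twoElement_mul, ih, mul_smul_comm, ← mul_assoc,
      ← (commute_twoElement e b _).eq, mul_assoc, ← pow_succ', Nat.cast_succ]
    module

/-- Euler's identity for the exterior algebra: contracting with each basis vector and multiplying
back counts the degree. -/
theorem sum_ι_mul_contraction (e : Module.Basis (Fin n) ℝ W)
    {y : ExteriorAlgebra ℝ (Module.Dual ℝ W)} (hy : y ∈ ⋀[ℝ]^m (Module.Dual ℝ W)) :
    ∑ i, ι ℝ (e.coord i) * contraction (e i) y = (m : ℝ) • y := by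
  rw [← ιMulti_span_fixedDegree] at hy
  induction hy using Submodule.span_induction with
  | mem y hy =>
    obtain ⟨lam, rfl⟩ := hy
    induction m with
    | zero => simp [contraction_one]
    | succ m ih =>
      rw [ιMulti_succ_apply]
      have h1 : ι ℝ (lam 0) = ∑ i, lam 0 (e i) • ι ℝ (e.coord i) := by
        have : lam 0 = ∑ i, lam 0 (e i) • e.coord i := by
          refine e.ext fun i => ?_
          simp
        conv_lhs => rw [this, map_sum]
        simp only [map_smul]
      simp_rw [contraction_ι_mul, mul_sub, Finset.sum_sub_distrib, ← mul_assoc,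
        ι_mul_ι_swap _ (lam 0), neg_mul, Finset.sum_neg_distrib, sub_neg_eq_add, mul_assoc,
        ← Finset.mul_sum, ih (Matrix.vecTail lam), mul_smul_comm, ← smul_mul_assoc,
        ← Finset.sum_mul, ← h1]
      push_cast
      rw [add_smul, one_smul, add_comm, add_mul, smul_mul_assoc]
  | zero => simp
  | add y₁ y₂ _ _ h₁ h₂ => simp only [map_add, mul_add, Finset.sum_add_distrib, h₁, h₂, smul_add]
  | smul c y _ h =>
    simp only [map_smul, mul_smul_comm]
    rw [← Finset.smul_sum, h, smul_comm]

/-- Contracting e^i ∧ y = 0 with e_i gives y = e^i ∧ i_(e_i) y for each i. Summing over i and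
comparing with Euler's identity yields n y = m y. -/
theorem eq_zero_of_forall_ι_mul (e : Module.Basis (Fin n) ℝ W)
    {y : ExteriorAlgebra ℝ (Module.Dual ℝ W)} (hy : y ∈ ⋀[ℝ]^m (Module.Dual ℝ W)) (hm : m ≠ n)
    (h : ∀ x : Module.Dual ℝ W, ι ℝ x * y = 0) : y = 0 := by
  have h1 := sum_ι_mul_contraction e hy
  have h2 : ∀ i, ι ℝ (e.coord i) * contraction (e i) y = y := by
    intro i
    have h3 := contraction_ι_mul (e i) (e.coord i) y
    rw [h, map_zero, Module.Basis.coord_apply, e.repr_self, Finsupp.single_eq_same, one_smul] at h3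
    exact (sub_eq_zero.1 h3.symm).symm
  simp_rw [h2] at h1
  rw [Finset.sum_const, Finset.card_univ, Fintype.card_fin, ← Nat.cast_smul_eq_nsmul ℝ,
    ← sub_eq_zero, ← sub_smul, smul_eq_zero] at h1
  refine h1.resolve_left fun h4 => hm ?_
  have : (n : ℝ) = m := sub_eq_zero.1 h4
  exact_mod_cast this.symm

/-- Nondegeneracy on ker x makes v ↦ b(v, ·) injective into the dual of ker x, hence surjective by
dimension. Covectors with equal restrictions to ker x differ by a multiple of `x`. -/
theorem exists_eq_bilinOf_add_smul [FiniteDimensional ℝ W] {x : Module.Dual ℝ W}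
    {b : W [⋀^Fin 2]→ₗ[ℝ] ℝ} (hx : x ≠ 0)
    (hb : ∀ v, x v = 0 → (∀ w, x w = 0 → b ![v, w] = 0) → v = 0) (y : Module.Dual ℝ W) :
    ∃ v, x v = 0 ∧ ∃ c : ℝ, y = bilinOf b v + c • x := by
  let K := LinearMap.ker x
  let T : K →ₗ[ℝ] Module.Dual ℝ K := (Module.Dual.transpose K.subtype).comp ((bilinOf b).comp K.subtype)
  have hT : Function.Injective T := by
    rw [← LinearMap.ker_eq_bot, LinearMap.ker_eq_bot']
    intro v hv
    refine Subtype.ext (hb v v.2 fun w hw => ?_)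
    exact DFunLike.congr_fun hv (⟨w, hw⟩ : K)
  have hT' : Function.Surjective T :=
    (LinearMap.injective_iff_surjective_of_finrank_eq_finrank (Subspace.dual_finrank_eq).symm).1 hT
  obtain ⟨v, hv⟩ := hT' (y.comp K.subtype)
  obtain ⟨u, hu⟩ : ∃ u, x u ≠ 0 := by
    by_contra! h
    exact hx (LinearMap.ext h)
  refine ⟨v, v.2, (y u - bilinOf b v u) / x u, LinearMap.ext fun w => ?_⟩
  have h1 : x (w - (x w / x u) • u) = 0 := by
    rw [map_sub, map_smul, smul_eq_mul, div_mul_cancel₀ _ hu, sub_self]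
  have h2 : bilinOf b v (w - (x w / x u) • u) = y (w - (x w / x u) • u) :=
    DFunLike.congr_fun hv (⟨_, h1⟩ : K)
  simp only [map_sub, map_smul, smul_eq_mul] at h2
  simp only [LinearMap.add_apply, LinearMap.smul_apply, smul_eq_mul]
  field_simp
  field_simp at h2
  linarith

/-- If x ∧ b^(m+1) = 0, contraction with v in ker x gives x ∧ i_v b ∧ b^m = 0. Up to multiples of
`x`, the i_v b are all the covectors, so every covector annihilates x ∧ b^m. Its degree 2m + 1 is
below the top degree for m < d, so it vanishes, against the induction hypothesis. -/
theorem contact_power_ne_zero [FiniteDimensional ℝ W] {d : ℕ}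
    (e : Module.Basis (Fin (2 * d + 1)) ℝ W) {x : Module.Dual ℝ W}
    {b : W [⋀^Fin 2]→ₗ[ℝ] ℝ} (hx : x ≠ 0)
    (hb : ∀ v, x v = 0 → (∀ w, x w = 0 → b ![v, w] = 0) → v = 0) :
    ∀ m ≤ d, ι ℝ x * twoElement e b ^ m ≠ 0 := by
  intro m
  induction m with
  | zero =>
    intro _ h
    rw [pow_zero, mul_one] at h
    exact hx ((ExteriorAlgebra.ι_eq_zero_iff x).1 h)
  | succ m ih =>
    intro hm h
    refine ih (by omega) ?_
    have hmem : ι ℝ x * twoElement e b ^ m ∈ ⋀[ℝ]^(1 + 2 * m) (Module.Dual ℝ W) := by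
      have h1 : Represents (ι ℝ x) (AlternatingMap.ofSubsingleton ℝ W ℝ (0 : Fin 1) x) :=
        represents_dualOf (AlternatingMap.ofSubsingleton ℝ W ℝ (0 : Fin 1) x)
      exact (h1.wedge ((represents_twoElement e b).wedgePow m)).1
    refine eq_zero_of_forall_ι_mul e hmem (by omega) fun y => ?_
    obtain ⟨v, hv, c, rfl⟩ := exists_eq_bilinOf_add_smul hx hb y
    have h2 := congrArg (contraction v) h
    rw [map_zero, contraction_ι_mul, hv, zero_smul, zero_sub, neg_eq_zero,
      contraction_twoElement_pow, mul_smul_comm, smul_eq_zero] at h2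
    have h3 := h2.resolve_left (by positivity)
    rw [map_add, map_smul, add_mul, smul_mul_assoc, ← mul_assoc (ι ℝ x), ExteriorAlgebra.ι_sq_zero,
      zero_mul, smul_zero, add_zero, ← mul_assoc, ι_mul_ι_swap, neg_mul, mul_assoc, h3, neg_zero]

/-- Top-degree elements form a line: an alternating map on n-tuples of covectors is determined by
the dual basis, where permutations account for all injective choices. -/
theorem eq_extEval_smul (e : Module.Basis (Fin n) ℝ W) {y : ExteriorAlgebra ℝ (Module.Dual ℝ W)}
    (hy : y ∈ ⋀[ℝ]^n (Module.Dual ℝ W)) : y = extEval e y • ιMulti ℝ n fun i => e.coord i := by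
  have key : ιMulti ℝ n (M := Module.Dual ℝ W) = (LinearMap.toSpanSingleton ℝ _
      (ιMulti ℝ n fun i => e.coord i)).compAlternatingMap (detAt e) := by
    refine Module.Basis.ext_alternating e.dualBasis fun s hs => ?_
    let σ : Equiv.Perm (Fin n) := Equiv.ofBijective s (Finite.injective_iff_bijective.1 hs)
    have h1 : (fun i => e.dualBasis (s i)) = (fun i => e.coord i) ∘ σ := by
      funext i
      exact congrFun e.coe_dualBasis (s i)
    rw [h1, AlternatingMap.map_perm, AlternatingMap.map_perm]
    congr 1
    have h2 : detAt e (fun i => e.coord i) = 1 := by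
      rw [detAt_apply, ← Matrix.det_one (n := Fin n)]
      congr 1
      ext i j
      simp [Matrix.one_apply, Finsupp.single_apply, eq_comm]
    simp [h2]
  rw [← ιMulti_span_fixedDegree] at hy
  induction hy using Submodule.span_induction with
  | mem y hy =>
    obtain ⟨lam, rfl⟩ := hy
    rw [extEval_ιMulti]
    exact DFunLike.congr_fun key lam
  | zero => simp
  | add y₁ y₂ _ _ h₁ h₂ =>
    rw [map_add, add_smul, ← h₁, ← h₂]
  | smul c y _ h =>
    rw [map_smul, smul_assoc, ← h]

end Contraction

/-! ### Quotients of top forms and smoothness of wedge products. -/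

section TopCoefficients

open ExteriorAlgebra

variable {n m k l : ℕ}

theorem topCoeff_eq_extEval {x : ExteriorAlgebra ℝ (Module.Dual ℝ (E n))}
    {A : E n [⋀^Fin m]→ₗ[ℝ] ℝ} (hx : Represents x A) (h : m = n) :
    topCoeff h A = extEval (EuclideanSpace.basisFun (Fin n) ℝ).toBasis x := by
  subst h
  rw [coe_basisFun, hx.2]
  rfl

theorem map_cast_eq_topCoeff_mul_det (h : m = n) {A : E n [⋀^Fin m]→ₗ[ℝ] ℝ} (v : Fin n → E n) :
    A (fun i => v (Fin.cast h i)) =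
      topCoeff h A * (EuclideanSpace.basisFun (Fin n) ℝ).toBasis.det v := by
  subst h
  have h1 := DFunLike.congr_fun
    (A.eq_smul_basis_det (EuclideanSpace.basisFun (Fin m) ℝ).toBasis) v
  rw [coe_basisFun] at h1
  exact h1

theorem topCoeff_contact_ne_zero {d : ℕ} {a : E (2 * d + 1) [⋀^Fin 1]→ₗ[ℝ] ℝ}
    {b : E (2 * d + 1) [⋀^Fin 2]→ₗ[ℝ] ℝ} (ha : ∃ v, a ![v] ≠ 0)
    (hb : ∀ v, a ![v] = 0 → (∀ w, a ![w] = 0 → b ![v, w] = 0) → v = 0) (h : 1 + 2 * d = 2 * d + 1) :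
    topCoeff h (wedge a (wedgePow b d)) ≠ 0 := by
  set e := (EuclideanSpace.basisFun (Fin (2 * d + 1)) ℝ).toBasis with he
  have hrep := (represents_dualOf a).wedge ((represents_twoElement e b).wedgePow d)
  rw [topCoeff_eq_extEval hrep]
  have ha0 : dualOf a ≠ 0 := by
    obtain ⟨v, hv⟩ := ha
    exact fun h0 => hv (DFunLike.congr_fun h0 v)
  have hne := contact_power_ne_zero e ha0 hb d le_rfl
  have hmem : ι ℝ (dualOf a) * twoElement e b ^ d ∈
      ⋀[ℝ]^(2 * d + 1) (Module.Dual ℝ (E (2 * d + 1))) := by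
    have key : ∀ m, 1 + 2 * d = m → ι ℝ (dualOf a) * twoElement e b ^ d ∈
        ⋀[ℝ]^m (Module.Dual ℝ (E (2 * d + 1))) := by
      rintro _ rfl
      exact hrep.1
    exact key _ h
  intro h0
  have h1 := eq_extEval_smul e hmem
  rw [h0, zero_smul] at h1
  exact hne h1

/-- Here c = - s ∧ a - r b. Multiplication by `a` kills the first term since a ∧ a = 0, and in the
second term `a` commutes past the even element. -/
theorem topCoeff_wedge_eq {d : ℕ} (hd : 1 ≤ d) {a s : E (2 * d + 1) [⋀^Fin 1]→ₗ[ℝ] ℝ}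
    {b c : E (2 * d + 1) [⋀^Fin 2]→ₗ[ℝ] ℝ} {r : ℝ} (hc : c + wedge s a + r • b = 0)
    (h : 1 + 1 + 1 + 2 * (d - 1) = 2 * d + 1) (h' : 1 + 2 * d = 2 * d + 1) :
    topCoeff (m := 1 + 1 + 1 + 2 * (d - 1)) h (wedge (wedge c a) (wedgePow b (d - 1))) =
      - r * topCoeff h' (wedge a (wedgePow b d)) := by
  set e := (EuclideanSpace.basisFun (Fin (2 * d + 1)) ℝ).toBasis with he
  have hc' : c = (-1 : ℝ) • wedge s a + (-r) • b := by
    have h1 : c = -(wedge s a) - r • b := by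
      rw [← sub_eq_zero, ← hc]; abel
    rw [h1]; module
  have hb := represents_twoElement e b
  have ha := represents_dualOf a
  have hcr : Represents ((-1 : ℝ) • (ι ℝ (dualOf s) * ι ℝ (dualOf a)) + (-r) • twoElement e b) c := by
    rw [hc']
    exact (((represents_dualOf s).wedge ha).smul (-1)).add (hb.smul (-r))
  rw [topCoeff_eq_extEval (n := 2 * d + 1) ((hcr.wedge ha).wedge (hb.wedgePow (d - 1))) h,
    topCoeff_eq_extEval (ha.wedge (hb.wedgePow d)) h', ← he]
  refine Eq.trans (congrArg (extEval e) ?_) (map_smul (extEval e) (-r) _)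
  rw [add_mul, smul_mul_assoc, mul_assoc, ExteriorAlgebra.ι_sq_zero, mul_zero, smul_zero, zero_add,
    smul_mul_assoc, ← (commute_twoElement e b _).eq, smul_mul_assoc, mul_assoc, ← pow_succ',
    Nat.sub_add_cancel hd]

theorem contDiffAt_wedge {F : Type*} [NormedAddCommGroup F] [NormedSpace ℝ F] {x : F}
    {a : F → E n [⋀^Fin k]→ₗ[ℝ] ℝ} {b : F → E n [⋀^Fin l]→ₗ[ℝ] ℝ}
    (ha : ∀ v, ContDiffAt ℝ ∞ (fun y => a y v) x) (hb : ∀ v, ContDiffAt ℝ ∞ (fun y => b y v) x)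
    (v : Fin (k + l) → E n) : ContDiffAt ℝ ∞ (fun y => wedge (a y) (b y) v) x := by
  have hne : ((k.factorial * l.factorial : ℕ) : ℝ) ≠ 0 := by positivity
  have h : (fun y => wedge (a y) (b y) v) = fun y => ((k.factorial * l.factorial : ℕ) : ℝ)⁻¹ *
      ∑ σ : Equiv.Perm (Fin k ⊕ Fin l), ((Equiv.Perm.sign σ : ℤ) : ℝ) *
        (a y (fun i => v (finSumFinEquiv (σ (Sum.inl i)))) *
          b y (fun i => v (finSumFinEquiv (σ (Sum.inr i))))) := by
    funext y
    rw [← wedge_apply, inv_mul_cancel_left₀ hne]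
  rw [h]
  exact contDiffAt_const.mul (ContDiffAt.sum fun σ _ =>
    contDiffAt_const.mul ((ha _).mul (hb _)))

theorem contDiffAt_wedgePow {F : Type*} [NormedAddCommGroup F] [NormedSpace ℝ F] {x : F}
    {b : F → E n [⋀^Fin 2]→ₗ[ℝ] ℝ} (hb : ∀ v, ContDiffAt ℝ ∞ (fun y => b y v) x) (m : ℕ) :
    ∀ v, ContDiffAt ℝ ∞ (fun y => wedgePow (b y) m v) x := by
  induction m with
  | zero => exact fun v => contDiffAt_const
  | succ m ih => exact fun v => contDiffAt_wedge ih hb v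

variable (n) in
/-- The standard volume form of `ℝⁿ`. -/
def detForm : E n [⋀^Fin n]→L[ℝ] ℝ :=
  { (EuclideanSpace.basisFun (Fin n) ℝ).toBasis.det with
    cont := by
      change Continuous fun v : Fin n → E n => (EuclideanSpace.basisFun (Fin n) ℝ).toBasis.det v
      simp_rw [Module.Basis.det_apply]
      refine Continuous.matrix_det (continuous_matrix fun i j => ?_)
      simp only [Module.Basis.toMatrix_apply, OrthonormalBasis.coe_toBasis_repr_apply,
        EuclideanSpace.basisFun_repr]
      fun_prop }

theorem detForm_apply (v : Fin n → E n) :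
    detForm n v = (EuclideanSpace.basisFun (Fin n) ℝ).toBasis.det v := rfl

theorem detForm_single : detForm n (fun i => EuclideanSpace.single i (1 : ℝ)) = 1 := by
  rw [detForm_apply, ← coe_basisFun, Module.Basis.det_self]

theorem topForm_eq_smul_detForm (A : E n [⋀^Fin n]→L[ℝ] ℝ) :
    A = A (fun i => EuclideanSpace.single i (1 : ℝ)) • detForm n := by
  ext v
  have h := topForm_mul_comm A.toAlternatingMap (detForm n).toAlternatingMap v
    (fun i => EuclideanSpace.single i (1 : ℝ))
  simp only [ContinuousAlternatingMap.coe_toAlternatingMap, detForm_single, mul_one] at h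
  exact h

end TopCoefficients

/-! ### Recovering g from a structure equation. -/

section ContactForms

variable {d : ℕ} {M : Type*} [TopologicalSpace M] [ChartedSpace (E (2 * d + 1)) M]

/-- The numerator of g is -r times its denominator, and nondegeneracy on ker η makes the denominator
nonzero. -/
theorem gFun_eq_of_identity (hd : 1 ≤ d) {η α : DForm (2 * d + 1) M 1} {q : M}
    {s : TangentSpace (𝓡 (2 * d + 1)) q [⋀^Fin 1]→ₗ[ℝ] ℝ} {r : ℝ}
    (h0 : ∃ v : E (2 * d + 1), η q ![v] ≠ 0)
    (hnd : ∀ v : E (2 * d + 1), η q ![v] = 0 →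
      (∀ w : E (2 * d + 1), η q ![w] = 0 → extD η q ![v, w] = 0) → v = 0)
    (h : (extD α q).toAlternatingMap + wedge s (η q).toAlternatingMap +
      r • (extD η q).toAlternatingMap = 0) : gFun hd η α q = - r := by
  have h1 := topCoeff_contact_ne_zero (a := (η q).toAlternatingMap)
    (b := (extD η q).toAlternatingMap) h0 hnd (by omega)
  have h2 := topCoeff_wedge_eq hd (a := (η q).toAlternatingMap) (s := s)
    (b := (extD η q).toAlternatingMap) (c := (extD α q).toAlternatingMap) h (by omega) (by omega)
  exact (div_eq_iff h1).2 h2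

end ContactForms

/-! ### One-forms with smooth coefficients, and the exterior derivative of a differential. -/

section OneForms

variable {n : ℕ}

theorem oneForm_eq_sum (A : E n [⋀^Fin 1]→L[ℝ] ℝ) :
    A = ∑ i, A ![EuclideanSpace.single i (1 : ℝ)] •
      ContinuousAlternatingMap.ofSubsingleton ℝ (E n) ℝ (0 : Fin 1)
        (EuclideanSpace.proj i : E n →L[ℝ] ℝ) := by
  ext v
  obtain ⟨w, rfl⟩ : ∃ w : E n, v = ![w] := ⟨v 0, by ext i; fin_cases i; rfl⟩
  have hw : w = ∑ i, w i • EuclideanSpace.single i (1 : ℝ) := by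
    have := (EuclideanSpace.basisFun (Fin n) ℝ).sum_repr w
    simpa using this.symm
  let B : E n →ₗ[ℝ] ℝ :=
    { toFun := fun v => A ![v]
      map_add' := oneForm_add A
      map_smul' := oneForm_smul A }
  have h : B w = ∑ i, w i * B (EuclideanSpace.single i (1 : ℝ)) := by
    conv_lhs => rw [hw]
    simp
  rw [ContinuousAlternatingMap.sum_apply]
  refine h.trans (Finset.sum_congr rfl fun i _ => ?_)
  simp [B, mul_comm]

theorem contDiffAt_oneForm {F : Type*} [NormedAddCommGroup F] [NormedSpace ℝ F]
    {A : F → E n [⋀^Fin 1]→L[ℝ] ℝ} {x : F}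
    (h : ∀ w, ContDiffAt ℝ ∞ (fun y => A y ![w]) x) : ContDiffAt ℝ ∞ A x := by
  rw [funext fun y => oneForm_eq_sum (A y)]
  exact ContDiffAt.sum fun i _ => (h _).smul contDiffAt_const

theorem contDiffAt_extDeriv_apply {A : E n → E n [⋀^Fin 1]→L[ℝ] ℝ} {x : E n}
    {Y Z : E n → E n} (hA : ContDiffAt ℝ ∞ A x) (hY : ContDiffAt ℝ ∞ Y x)
    (hZ : ContDiffAt ℝ ∞ Z x) : ContDiffAt ℝ ∞ (fun y => extDeriv A y ![Y y, Z y]) x := by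
  have h1 : ContDiffAt ℝ ∞ (fderiv ℝ A) x := hA.fderiv_right (m := ∞) (by simp)
  have h2 : ∀ {Y Z : E n → E n}, ContDiffAt ℝ ∞ Y x → ContDiffAt ℝ ∞ Z x →
      ContDiffAt ℝ ∞ (fun y => fderiv ℝ A y (Y y) ![Z y]) x := fun hY hZ =>
    contDiffAt_oneForm_field (h1.clm_apply hY) hZ
  refine ((h2 hY hZ).sub (h2 hZ hY)).congr_of_eventuallyEq ?_
  have h3 : ∀ᶠ y in 𝓝 x, ContDiffAt ℝ 1 A y :=
    (hA.of_le (m := 1) (by exact_mod_cast le_top)).eventually (by simp)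
  filter_upwards [h3] with y hy
  exact extDeriv_one_apply (hy.differentiableAt (by simp)) _ _

/-- If `dh = A + s B` then `dA + ds ∧ B + s dB = 0`. -/
theorem extDeriv_identity {A B : E n → E n [⋀^Fin 1]→L[ℝ] ℝ} {h s : E n → ℝ} {x : E n}
    (hA : DifferentiableAt ℝ A x) (hB : DifferentiableAt ℝ B x) (hs : DifferentiableAt ℝ s x)
    (hh : ContDiffAt ℝ ∞ h x)
    (heq : ∀ᶠ y in 𝓝 x, ∀ w, fderiv ℝ h y w = A y ![w] + s y * B y ![w]) (v w : E n) :
    extDeriv A x ![v, w] + (fderiv ℝ s x v * B x ![w] - fderiv ℝ s x w * B x ![v]) +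
      s x * extDeriv B x ![v, w] = 0 := by
  have h1 : ContDiffAt ℝ ∞ (fderiv ℝ h) x := hh.fderiv_right (m := ∞) (by simp)
  have h2 : ∀ v w : E n, fderiv ℝ (fderiv ℝ h) x v w = fderiv ℝ A x v ![w] +
      (s x * fderiv ℝ B x v ![w] + fderiv ℝ s x v * B x ![w]) := by
    intro v w
    have h3 : (fun y => fderiv ℝ h y w) =ᶠ[𝓝 x] fun y => A y ![w] + s y * B y ![w] :=
      heq.mono fun y hy => hy w
    have h4 := h3.fderiv_eq (𝕜 := ℝ)
    have hA' : DifferentiableAt ℝ (fun y => A y ![w]) x :=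
      (hA.hasFDerivAt.continuousAlternatingMap_apply_const _).differentiableAt
    have hB' : DifferentiableAt ℝ (fun y => B y ![w]) x :=
      (hB.hasFDerivAt.continuousAlternatingMap_apply_const _).differentiableAt
    have h5 : fderiv ℝ (fun y => A y ![w] + s y * B y ![w]) x =
      fderiv ℝ (fun y => A y ![w]) x + fderiv ℝ (fun y => s y * B y ![w]) x :=
      fderiv_fun_add (𝕜 := ℝ) hA' (hs.mul hB')
    have h6 : fderiv ℝ (fun y => s y * B y ![w]) x = _ := fderiv_fun_mul hs hB'
    rw [h5, h6, fderiv_continuousAlternatingMap_apply_const hA,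
      fderiv_continuousAlternatingMap_apply_const hB,
      fderiv_clm_apply (h1.differentiableAt (by simp)) (differentiableAt_const w)] at h4
    have h7 := DFunLike.congr_fun h4 v
    simp at h7
    rw [h7]
    ring
  have h8 : fderiv ℝ (fderiv ℝ h) x v w = fderiv ℝ (fderiv ℝ h) x w v :=
    (hh.isSymmSndFDerivAt (by simpa using (ENat.LEInfty.out : (2 : WithTop ℕ∞) ≤ ∞))).eq v w
  rw [h2, h2] at h8
  rw [extDeriv_one_apply hA, extDeriv_one_apply hB]
  linarith

end OneForms

/-! ### Evaluation at the centre of the preferred chart. -/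

section AtPoint

variable {n k : ℕ} {M : Type*} [TopologicalSpace M] [ChartedSpace (E n) M] [IsManifold (𝓡 n) ∞ M]

theorem chartForm_self (Ω : DForm n M k) (q : M) (v : Fin k → E n) :
    chartForm q Ω (extChartAt (𝓡 n) q q) v = Ω q v := by
  rw [chartForm_apply, dpsi_self, extChartAt_to_inv]
  rfl

theorem dFun_self {f : M → ℝ} {q : M} (hf : MDifferentiableAt (𝓡 n) 𝓘(ℝ, ℝ) f q) (v : E n) :
    dFun f q v = fderiv ℝ (f ∘ (extChartAt (𝓡 n) q).symm) (extChartAt (𝓡 n) q q) v := by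
  have h := dFun_eq (f := f) (mem_extChartAt_target (I := 𝓡 n) q)
    (by rwa [extChartAt_to_inv]) v
  rw [dpsi_self] at h
  rw [← h]
  have h2 : (extChartAt (𝓡 n) q).symm (extChartAt (𝓡 n) q q) = q := extChartAt_to_inv q
  have h3 : ∀ p, p = q → (dFun f q : E n → ℝ) v = (dFun f p : E n → ℝ) v := by
    rintro _ rfl; rfl
  exact h3 _ h2

/-- A pointwise version of smoothness that can be checked in the preferred charts. -/
theorem contMDiffAt_iff_self {f : M → ℝ} {q : M} :
    ContMDiffAt (𝓡 n) 𝓘(ℝ, ℝ) ∞ f q ↔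
      ContDiffAt ℝ ∞ (f ∘ (extChartAt (𝓡 n) q).symm) (extChartAt (𝓡 n) q q) := by
  have h2 : (extChartAt (𝓡 n) q).symm (extChartAt (𝓡 n) q q) = q := extChartAt_to_inv q
  constructor
  · intro h
    exact contDiffAt_chart_of_contMDiffAt (mem_extChartAt_target q) (by rwa [h2])
  · intro h
    have := contMDiffAt_of_chart (mem_extChartAt_target q) h
    rwa [h2] at this

theorem dFun_log {f : M → ℝ} {q : M} (hf : ContMDiffAt (𝓡 n) 𝓘(ℝ, ℝ) ∞ f q) (h0 : f q ≠ 0) :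
    ContMDiffAt (𝓡 n) 𝓘(ℝ, ℝ) ∞ (fun p => Real.log (f p)) q ∧
    ∀ v : E n, dFun (fun p => Real.log (f p)) q v = (f q)⁻¹ * dFun f q v := by
  have h2 : (f ∘ (extChartAt (𝓡 n) q).symm) (extChartAt (𝓡 n) q q) = f q :=
    congrArg f (extChartAt_to_inv q)
  have h3 := contMDiffAt_iff_self.1 hf
  have hl : ContMDiffAt (𝓡 n) 𝓘(ℝ, ℝ) ∞ (fun p => Real.log (f p)) q :=
    contMDiffAt_iff_self.2 (h3.log (by rwa [h2]))
  refine ⟨hl, fun v => ?_⟩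
  rw [dFun_self (hl.mdifferentiableAt (by simp)), dFun_self (hf.mdifferentiableAt (by simp))]
  have h4 := fderiv.log (h3.differentiableAt (by simp)) (by rwa [h2])
  have h5 : fderiv ℝ ((fun p => Real.log (f p)) ∘ (extChartAt (𝓡 n) q).symm)
    (extChartAt (𝓡 n) q q) = _ := h4
  rw [h5, h2]
  rfl

omit [IsManifold (𝓡 n) ∞ M] in
theorem eventually_chart {q : M} {P : M → Prop} (h : ∀ᶠ p in 𝓝 q, P p) :
    ∀ᶠ y in 𝓝 (extChartAt (𝓡 n) q q), y ∈ (extChartAt (𝓡 n) q).target ∧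
      P ((extChartAt (𝓡 n) q).symm y) := by
  have h1 : ∀ᶠ y in 𝓝 (extChartAt (𝓡 n) q q), y ∈ (extChartAt (𝓡 n) q).target :=
    extChartAt_target_mem_nhds q
  have h2 : Tendsto (extChartAt (𝓡 n) q).symm (𝓝 (extChartAt (𝓡 n) q q)) (𝓝 q) := by
    have := continuousAt_extChartAt_symm (I := 𝓡 n) q
    rwa [ContinuousAt, extChartAt_to_inv] at this
  exact h1.and (h2.eventually h)

omit [IsManifold (𝓡 n) ∞ M] in
theorem SmoothFormOn.contDiffAt_self {U : Set M} (hU : IsOpen U) {Ω : DForm n M k}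
    (hΩ : SmoothFormOn U Ω) {q : M} (hq : q ∈ U) :
    ContDiffAt ℝ ∞ (chartForm q Ω) (extChartAt (𝓡 n) q q) :=
  hΩ.contDiffAt (n := n) hU (mem_extChartAt_target q) (by rwa [extChartAt_to_inv])

theorem SmoothFieldOn.contDiffAt_self {U : Set M} (hU : IsOpen U)
    {X : ∀ q : M, TangentSpace (𝓡 n) q} (hX : SmoothFieldOn U X) {q : M} (hq : q ∈ U) :
    ContDiffAt ℝ ∞ (chartField q X) (extChartAt (𝓡 n) q q) :=
  hX.contDiffAt (n := n) hU (mem_extChartAt_target q) (by rwa [extChartAt_to_inv])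

theorem extD_self {U : Set M} (hU : IsOpen U) {Ω : DForm n M k} (hΩ : SmoothFormOn U Ω) {q : M}
    (hq : q ∈ U) (v : Fin (k + 1) → E n) :
    extD Ω q v = extDeriv (chartForm q Ω) (extChartAt (𝓡 n) q q) v := by
  rw [← chartForm_extD hU hΩ (mem_extChartAt_target (I := 𝓡 n) q) (by rwa [extChartAt_to_inv]),
    chartForm_self]

omit [IsManifold (𝓡 n) ∞ M] in
theorem chartForm_one_apply (A : DForm n M 1) (c : M) (x v : E n) :
    chartForm c A x ![v] = A ((extChartAt (𝓡 n) c).symm x) ![dpsi c x v] := by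
  rw [chartForm_apply]
  congr 1
  funext i
  fin_cases i
  rfl

/-- If `dh = A + s B` near `q` then `dA + ds ∧ B + s dB = 0` at `q`. -/
theorem extD_identity {U : Set M} (hU : IsOpen U) {A B : DForm n M 1} (hA : SmoothFormOn U A)
    (hB : SmoothFormOn U B) {h s : M → ℝ} {q : M} (hq : q ∈ U)
    (hh : ∀ p ∈ U, ContMDiffAt (𝓡 n) 𝓘(ℝ, ℝ) ∞ h p) (hs : MDifferentiableAt (𝓡 n) 𝓘(ℝ, ℝ) s q)
    (heq : ∀ p ∈ U, ∀ v : E n, dFun h p v = A p ![v] + s p * B p ![v]) (v w : E n) :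
    extD A q ![v, w] + (dFun s q v * B q ![w] - dFun s q w * B q ![v]) +
      s q * extD B q ![v, w] = 0 := by
  have h2 : (extChartAt (𝓡 n) q).symm (extChartAt (𝓡 n) q q) = q := extChartAt_to_inv q
  have hsd : DifferentiableAt ℝ (s ∘ (extChartAt (𝓡 n) q).symm) (extChartAt (𝓡 n) q q) := by
    rw [← mdifferentiableAt_iff_differentiableAt]
    exact MDifferentiableAt.comp _ (by rwa [h2])
      (mdifferentiableAt_psi (mem_extChartAt_target q))
  have key := extDeriv_identity
    ((hA.contDiffAt_self hU hq).differentiableAt (by simp))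
    ((hB.contDiffAt_self hU hq).differentiableAt (by simp)) hsd
    (contMDiffAt_iff_self.1 (hh q hq)) (A := chartForm q A) (B := chartForm q B) ?_ v w
  · have e1 : ∀ u : E n, chartForm q B (extChartAt (𝓡 n) q q) ![u] = B q ![u] :=
      fun u => chartForm_self B q ![u]
    have e2 : (s ∘ (extChartAt (𝓡 n) q).symm) (extChartAt (𝓡 n) q q) = s q := congrArg s h2
    have e3 := extD_self hU hA hq ![v, w]
    have e4 := extD_self hU hB hq ![v, w]
    rw [e1, e1, e2, ← dFun_self hs, ← dFun_self hs] at key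
    exact (congrArg₂ (fun a b => a + _ + s q * b) e3 e4).trans key
  · filter_upwards [eventually_chart (n := n) (hU.mem_nhds hq)] with y hy u
    have h3 := heq _ hy.2 (dpsi q y u)
    have h4 := dFun_eq hy.1 ((hh _ hy.2).mdifferentiableAt (by simp)) u
    rw [← h4, chartForm_one_apply, chartForm_one_apply]
    exact h3

end AtPoint

/-! ### From a compatible volume to the integrability condition. -/

section Contact

variable {d : ℕ} {M : Type*} [TopologicalSpace M] [ChartedSpace (E (2 * d + 1)) M]
  {η : DForm (2 * d + 1) M 1} {X₀ : ∀ q : M, TangentSpace (𝓡 (2 * d + 1)) q}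

theorem alphaForm_apply (q : M) (v : E (2 * d + 1)) :
    alphaForm η X₀ q ![v] = (η q ![X₀ q])⁻¹ * extD η q ![X₀ q, v] := rfl

theorem alphaForm_self (q : M) : alphaForm η X₀ q ![X₀ q] = 0 := by
  refine (alphaForm_apply q (X₀ q)).trans ?_
  have h : extD η q ![X₀ q, X₀ q] = 0 :=
    (extD η q).map_eq_zero_of_eq ![X₀ q, X₀ q] (i := 0) (j := 1) rfl (by decide)
  exact (congrArg _ h).trans (mul_zero _)

variable [IsManifold (𝓡 (2 * d + 1)) ∞ M]

theorem smoothFormOn_of_forall {n : ℕ} {N : Type*} [TopologicalSpace N] [ChartedSpace (E n) N]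
    {A : DForm n N 1} {U : Set N} (h : ∀ (c : N) (x : E n),
      x ∈ (extChartAt (𝓡 n) c).target → (extChartAt (𝓡 n) c).symm x ∈ U →
      ∀ w, ContDiffAt ℝ ∞ (fun y => chartForm c A y ![w]) x) : SmoothFormOn U A :=
  fun c x hx => (contDiffAt_oneForm (h c x hx.1 hx.2)).contDiffWithinAt

theorem smoothFormOn_alphaForm (hη : SmoothFormOn univ η) (hX₀ : SmoothFieldOn univ X₀)
    (h0 : ∀ q, η q ![X₀ q] ≠ 0) : SmoothFormOn univ (alphaForm η X₀) := by
  refine smoothFormOn_of_forall fun c x hx _ w => ?_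
  have hA := hη.contDiffAt (n := 2 * d + 1) isOpen_univ hx (mem_univ _)
  have hY := hX₀.contDiffAt (n := 2 * d + 1) isOpen_univ hx (mem_univ _)
  have h1 : ContDiffAt ℝ ∞ (fun y => (chartForm c η y ![chartField c X₀ y])⁻¹ *
      extDeriv (chartForm c η) y ![chartField c X₀ y, w]) x := by
    refine ((contDiffAt_oneForm_field hA hY).inv ?_).mul
      (contDiffAt_extDeriv_apply hA hY contDiffAt_const)
    exact fun h => h0 _ ((chartForm_one_chartField hx X₀).symm.trans h)
  refine h1.congr_of_eventuallyEq ?_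
  filter_upwards [target_mem_nhds hx] with y hy
  rw [chartForm_one_apply]
  refine (alphaForm_apply _ _).trans ?_
  rw [chartForm_one_chartField hy X₀, ← chartForm_extD isOpen_univ hη hy (mem_univ _)]
  congr 1
  rw [chartForm_apply]
  congr 1
  funext i
  fin_cases i
  · exact (dpsi_chartField hy X₀).symm
  · rfl

variable {S : Structure (2 * d + 1) (2 * d) M} {U : Set M}
  {X : Fin (2 * d) → ∀ p : M, TangentSpace (𝓡 (2 * d + 1)) p}
  {μ : M → Measure (Cov (2 * d + 1))} {Ω : DForm (2 * d + 1) M (2 * d + 1)}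

/-- Linear maps on the tangent space are determined by their values on `X₀, X₁, …, X_k`. -/
theorem ext_fullFrame (hη : IsContactForm S η) (hη0 : ∀ q, η q ![X₀ q] ≠ 0)
    (hX : IsOrthoFrame S U X) {p : M} (hp : p ∈ U) {A B : E (2 * d + 1) →ₗ[ℝ] ℝ}
    (h0 : A (X₀ p) = B (X₀ p)) (h : ∀ i, A (X i p) = B (X i p)) : A = B := by
  obtain ⟨b, hb⟩ := hX.exists_basis (X₀ := X₀) hp fun h => hη0 p ((hη.ker p _).1 h)
  refine b.ext fun a => ?_
  rw [hb]
  exact Fin.cases h0 h a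

theorem contMDiffAt_frameDensity (hU : IsOpen U) (hX : IsOrthoFrame S U X)
    (hX₀ : SmoothFieldOn univ X₀) (hη : SmoothFormOn univ η) (hη0 : ∀ q, η q ![X₀ q] ≠ 0)
    (hΩ : SmoothFormOn U Ω) {p : M} (hp : p ∈ U) :
    ContMDiffAt (𝓡 (2 * d + 1)) 𝓘(ℝ, ℝ) ∞ (frameDensity η Ω X₀ X) p :=
  contMDiffAt_iff_self.2 (contDiffAt_frameDensity hU hX (hX₀.mono (subset_univ _))
    (hη.mono (subset_univ _)) hΩ (mem_extChartAt_target p) (by rwa [extChartAt_to_inv]) (hη0 _))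

theorem frameDensity_ne_zero (hη : IsContactForm S η) (hη0 : ∀ q, η q ![X₀ q] ≠ 0)
    (hX : IsOrthoFrame S U X) {p : M} (hp : p ∈ U) (hΩ : Ω p ≠ 0) :
    frameDensity η Ω X₀ X p ≠ 0 :=
  div_ne_zero (volume_fullFrame_ne_zero hX hp (fun h => hη0 p ((hη.ker p _).1 h)) hΩ) (hη0 p)

theorem compatibleAt_iff_alphaForm [T2Space M] (hd : 1 ≤ d) (hη : IsContactForm S η)
    (hX₀ : SmoothFieldOn univ X₀) (hη0 : ∀ q, η q ![X₀ q] ≠ 0)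
    (hμ : S.IsAdapted (fun q => Submodule.span ℝ {X₀ q}) μ) (hU : IsOpen U)
    (hX : IsOrthoFrame S U X) (hΩ : IsVolumeOn U Ω) {q : M} (hq : q ∈ U) :
    (∀ f : M → ℝ, ContMDiff (𝓡 (2 * d + 1)) 𝓘(ℝ, ℝ) ∞ f →
      S.HasMicroLaplacianAt μ f q (S.macroLaplacian Ω f q)) ↔
    ∀ i, dFun (frameDensity η Ω X₀ X) q (X i q) =
      frameDensity η Ω X₀ X q * alphaForm η X₀ q ![X i q] :=
  compatibleAt_iff (by omega) hU hX (hX₀.mono (subset_univ _)) hμ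
    (hη.smooth.mono (subset_univ _)) hη.ker hη0 hΩ hq

/-- The logarithmic derivative of the density of a compatible volume, and the integrability
condition. -/
theorem forward_of_frame [T2Space M] (hd : 1 ≤ d) (hη : IsContactForm S η)
    (hX₀ : SmoothFieldOn univ X₀) (hη0 : ∀ q, η q ![X₀ q] ≠ 0)
    (hμ : S.IsAdapted (fun q => Submodule.span ℝ {X₀ q}) μ) (hU : IsOpen U)
    (hX : IsOrthoFrame S U X) (hΩ : S.IsCompatibleVolumeOn μ U Ω) {q : M} (hq : q ∈ U) :
    (∀ v : E (2 * d + 1), dFun (fun p => Real.log (frameDensity η Ω X₀ X p)) q v =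
      alphaForm η X₀ q ![v] - gFun hd η (alphaForm η X₀) q * η q ![v]) ∧
    ((extD (alphaForm η X₀) q).toAlternatingMap
      - wedge (dForm (n := 2 * d + 1) (gFun hd η (alphaForm η X₀)) q).toAlternatingMap
          (η q).toAlternatingMap
      - gFun hd η (alphaForm η X₀) q • (extD η q).toAlternatingMap = 0) := by
  set α := alphaForm η X₀ with hαdef
  set g := gFun hd η α with hgdef
  set ρ := frameDensity η Ω X₀ X with hρdef
  -- `Real.log` is log |·| away from 0, so the orientation of the frame plays no role.
  set h : M → ℝ := fun p => Real.log (ρ p) with hhdef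
  set s : M → ℝ := fun p => dFun h p (X₀ p) / η p ![X₀ p] with hsdef
  have hαs : SmoothFormOn univ α := smoothFormOn_alphaForm hη.smooth hX₀ hη0
  have hρs : ∀ p ∈ U, ContMDiffAt (𝓡 (2 * d + 1)) 𝓘(ℝ, ℝ) ∞ ρ p := fun p hp =>
    contMDiffAt_frameDensity hU hX hX₀ hη.smooth hη0 hΩ.1.1 hp
  have hρ0 : ∀ p ∈ U, ρ p ≠ 0 := fun p hp => frameDensity_ne_zero hη hη0 hX hp (hΩ.1.2 p hp)
  have hhs : ∀ p ∈ U, ContMDiffAt (𝓡 (2 * d + 1)) 𝓘(ℝ, ℝ) ∞ h p := fun p hp =>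
    (dFun_log (hρs p hp) (hρ0 p hp)).1
  -- On X₀ the identity is the choice of `s`, and on each X_i it is compatibility together with
  -- η(X_i) = 0; these vectors span.
  have hdh : ∀ p ∈ U, ∀ v : E (2 * d + 1), dFun h p v = α p ![v] + s p * η p ![v] := by
    intro p hp v
    let A' : E (2 * d + 1) →L[ℝ] ℝ := dFun h p
    let A : E (2 * d + 1) →ₗ[ℝ] ℝ := A'.toLinearMap
    let B : E (2 * d + 1) →ₗ[ℝ] ℝ := dualOf (α p).toAlternatingMap +
      s p • dualOf (η p).toAlternatingMap
    have hAB : A = B := by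
      refine ext_fullFrame hη hη0 hX hp ?_ fun i => ?_
      · change dFun h p (X₀ p) = α p ![X₀ p] + s p * η p ![X₀ p]
        have h1 : α p ![X₀ p] = 0 := alphaForm_self p
        have h2 : s p * η p ![X₀ p] = dFun h p (X₀ p) := div_mul_cancel₀ _ (hη0 p)
        rw [h1, h2, zero_add]
      · change dFun h p (X i p) = α p ![X i p] + s p * η p ![X i p]
        have h1 : η p ![X i p] = 0 := (hη.ker p _).1 (hX.mem_D hp i)
        have h2 : dFun h p (X i p) = (ρ p)⁻¹ * dFun ρ p (X i p) :=
          (dFun_log (hρs p hp) (hρ0 p hp)).2 _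
        have h3 := (compatibleAt_iff_alphaForm hd hη hX₀ hη0 hμ hU hX hΩ.1 hp).1
          (fun f hf => hΩ.2 f hf p hp) i
        have h4 : dFun ρ p (X i p) = ρ p * α p ![X i p] := h3
        rw [h1, h2, h4, mul_zero, add_zero, inv_mul_cancel_left₀ (hρ0 p hp)]
    exact DFunLike.congr_fun hAB v
  have hss : ∀ p ∈ U, ContMDiffAt (𝓡 (2 * d + 1)) 𝓘(ℝ, ℝ) ∞ s p := by
    intro p hp
    rw [contMDiffAt_iff_self]
    have h1 := contMDiffAt_iff_self.1 (hhs p hp)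
    have hY := hX₀.contDiffAt_self isOpen_univ (mem_univ p)
    have hA := hη.smooth.contDiffAt_self isOpen_univ (mem_univ p)
    have h2 : ContDiffAt ℝ ∞ (fun y => fderiv ℝ (h ∘ (extChartAt (𝓡 (2 * d + 1)) p).symm) y
        (chartField p X₀ y) / chartForm p η y ![chartField p X₀ y])
        (extChartAt (𝓡 (2 * d + 1)) p p) := by
      refine ((h1.fderiv_right (m := ∞) (by simp)).clm_apply hY).div
        (contDiffAt_oneForm_field hA hY) ?_
      exact fun h => hη0 _ ((chartForm_one_chartField (mem_extChartAt_target p) X₀).symm.trans h)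
    refine h2.congr_of_eventuallyEq ?_
    filter_upwards [eventually_chart (n := 2 * d + 1) (hU.mem_nhds hp)] with y hy
    simp only [hsdef, Function.comp_apply]
    rw [dFun_apply_field hy.1 ((hhs _ hy.2).mdifferentiableAt (by simp)),
      chartForm_one_chartField hy.1]
  have hid : ∀ p ∈ U, (extD α p).toAlternatingMap +
      wedge (dForm (n := 2 * d + 1) s p).toAlternatingMap (η p).toAlternatingMap +
      s p • (extD η p).toAlternatingMap = 0 := by
    intro p hp
    ext u
    obtain ⟨v, w, rfl⟩ : ∃ v w, u = ![v, w] := ⟨u 0, u 1, by ext i; fin_cases i <;> rfl⟩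
    have h1 := extD_identity hU (hαs.mono (subset_univ _)) (hη.smooth.mono (subset_univ _)) hp hhs
      ((hss p hp).mdifferentiableAt (by simp)) hdh v w
    have h2 := wedge_one_one_apply (dForm (n := 2 * d + 1) s p).toAlternatingMap
      (η p).toAlternatingMap v w
    exact (congrArg (fun t => extD α p ![v, w] + t + s p * extD η p ![v, w]) h2).trans h1
  have hgs : ∀ p ∈ U, g p = - s p := fun p hp =>
    gFun_eq_of_identity hd ⟨X₀ p, hη0 p⟩
      (fun v hv hw => hη.nondegenerate p v ((hη.ker p v).2 hv)
        fun w hwD => hw w ((hη.ker p w).1 hwD)) (hid p hp)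
  refine ⟨fun v => ?_, ?_⟩
  · rw [hdh q hq, hgs q hq]
    ring
  · have hev : g =ᶠ[𝓝 q] fun p => - s p :=
      Filter.eventuallyEq_of_mem (hU.mem_nhds hq) hgs
    have hdg : ∀ v : E (2 * d + 1), dFun g q v = - dFun s q v := by
      intro v
      have h1 : dFun (n := 2 * d + 1) g q = dFun (fun p => - s p) q := hev.mfderiv_eq
      have h2 : dFun (n := 2 * d + 1) (fun p => - s p) q = - dFun s q :=
        mfderiv_neg
      rw [h1, h2]
      rfl
    rw [← hid q hq, hgs q hq]
    ext u
    obtain ⟨v, w, rfl⟩ : ∃ v w : E (2 * d + 1), u = ![v, w] :=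
      ⟨u 0, u 1, by ext i; fin_cases i <;> rfl⟩
    have h1 : wedge (dForm (n := 2 * d + 1) g q).toAlternatingMap (η q).toAlternatingMap ![v, w] =
        dFun g q v * η q ![w] - dFun g q w * η q ![v] := wedge_one_one_apply _ _ v w
    have h2 : wedge (dForm (n := 2 * d + 1) s q).toAlternatingMap (η q).toAlternatingMap ![v, w] =
        dFun s q v * η q ![w] - dFun s q w * η q ![v] := wedge_one_one_apply _ _ v w
    rw [hdg, hdg] at h1
    change extD α q ![v, w] - wedge (dForm (n := 2 * d + 1) g q).toAlternatingMap
        (η q).toAlternatingMap ![v, w] - (- s q) * extD η q ![v, w] =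
      extD α q ![v, w] + wedge (dForm (n := 2 * d + 1) s q).toAlternatingMap
        (η q).toAlternatingMap ![v, w] + s q * extD η q ![v, w]
    refine (congrArg (fun t => extD α q ![v, w] - t - (- s q) * extD η q ![v, w]) h1).trans
      (Eq.trans ?_ (congrArg (fun t => extD α q ![v, w] + t + s q * extD η q ![v, w]) h2).symm)
    ring

end Contact

/-! ### Functions with vanishing differential. -/

section LocallyConstant

variable {n : ℕ} {M : Type*} [TopologicalSpace M] [ChartedSpace (E n) M] [IsManifold (𝓡 n) ∞ M]

theorem eventually_eq_of_dFun_eq_zero {f : M → ℝ} {V : Set M} (hV : IsOpen V)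
    (hf : ∀ p ∈ V, ContMDiffAt (𝓡 n) 𝓘(ℝ, ℝ) ∞ f p) (h : ∀ p ∈ V, ∀ v : E n, dFun f p v = 0)
    {q : M} (hq : q ∈ V) : ∀ᶠ p in 𝓝 q, f p = f q := by
  obtain ⟨ε, hε, hball⟩ := Metric.mem_nhds_iff.1 (eventually_chart (n := n) (hV.mem_nhds hq))
  have h1 : ∀ y ∈ Metric.ball (extChartAt (𝓡 n) q q) ε,
      (f ∘ (extChartAt (𝓡 n) q).symm) y =
        (f ∘ (extChartAt (𝓡 n) q).symm) (extChartAt (𝓡 n) q q) := by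
    intro y hy
    refine Metric.isOpen_ball.is_const_of_fderiv_eq_zero (𝕜 := ℝ)
      (convex_ball _ _).isPreconnected ?_ ?_ hy (Metric.mem_ball_self hε)
    · intro z hz
      exact ((contDiffAt_chart_of_contMDiffAt (hball hz).1
        (hf _ (hball hz).2)).differentiableAt (by simp)).differentiableWithinAt
    · intro z hz
      ext v
      rw [← dFun_eq (hball hz).1 ((hf _ (hball hz).2).mdifferentiableAt (by simp))]
      exact h _ (hball hz).2 _
  have h2 : ∀ᶠ p in 𝓝 q, extChartAt (𝓡 n) q p ∈ Metric.ball (extChartAt (𝓡 n) q q) ε :=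
    (continuousAt_extChartAt (I := 𝓡 n) q).eventually (Metric.ball_mem_nhds _ hε)
  filter_upwards [h2, extChartAt_source_mem_nhds (I := 𝓡 n) q] with p hp hps
  have h3 := h1 _ hp
  rw [Function.comp_apply, Function.comp_apply, (extChartAt (𝓡 n) q).left_inv hps,
    extChartAt_to_inv] at h3
  exact h3

/-- The logarithm of |f / g| has zero differential, so f / g itself does; working with the quotient
keeps track of its sign. -/
theorem eventually_div_eq_of_dFun_log_eq {f g : M → ℝ} {V : Set M} (hV : IsOpen V)
    (hf : ∀ p ∈ V, ContMDiffAt (𝓡 n) 𝓘(ℝ, ℝ) ∞ f p) (hg : ∀ p ∈ V, ContMDiffAt (𝓡 n) 𝓘(ℝ, ℝ) ∞ g p)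
    (hf0 : ∀ p ∈ V, f p ≠ 0) (hg0 : ∀ p ∈ V, g p ≠ 0)
    (h : ∀ p ∈ V, ∀ v : E n, dFun (fun p => Real.log (f p)) p v =
      dFun (fun p => Real.log (g p)) p v)
    {q : M} (hq : q ∈ V) : ∀ᶠ p in 𝓝 q, f p / g p = f q / g q := by
  have hr : ∀ p ∈ V, ContMDiffAt (𝓡 n) 𝓘(ℝ, ℝ) ∞ (fun p => f p / g p) p := fun p hp =>
    contMDiffAt_iff_self.2 ((contMDiffAt_iff_self.1 (hf p hp)).div (contMDiffAt_iff_self.1 (hg p hp))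
      (by rw [extChartAt_to_inv]; exact hg0 p hp))
  refine eventually_eq_of_dFun_eq_zero (f := fun p => f p / g p) hV hr (fun p hp v => ?_) hq
  have h1 := (dFun_log (hr p hp) (div_ne_zero (hf0 p hp) (hg0 p hp))).2 v
  have h2 : (fun p => Real.log (f p / g p)) =ᶠ[𝓝 p]
      ((fun p => Real.log (f p)) - (fun p => Real.log (g p))) :=
    Filter.eventuallyEq_of_mem (hV.mem_nhds hp) fun p hp => Real.log_div (hf0 p hp) (hg0 p hp)
  have h3 : dFun (n := n) (fun p => Real.log (f p / g p)) p =
      dFun ((fun p => Real.log (f p)) - (fun p => Real.log (g p))) p := h2.mfderiv_eq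
  have h4 : dFun (n := n) ((fun p => Real.log (f p)) - (fun p => Real.log (g p))) p =
      dFun (fun p => Real.log (f p)) p - dFun (fun p => Real.log (g p)) p :=
    mfderiv_sub ((dFun_log (hf p hp) (hf0 p hp)).1.mdifferentiableAt (by simp))
      ((dFun_log (hg p hp) (hg0 p hp)).1.mdifferentiableAt (by simp))
  have h5 : dFun (fun p => Real.log (f p / g p)) p v = 0 := by
    rw [h3, h4]
    exact sub_eq_zero.2 (h p hp v)
  have h6 := h1.symm.trans h5
  exact (mul_eq_zero.1 h6).resolve_left (inv_ne_zero (div_ne_zero (hf0 p hp) (hg0 p hp)))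

end LocallyConstant

theorem topForm_eq_smul {n : ℕ} (A B : E n [⋀^Fin n]→L[ℝ] ℝ) (hB : B ≠ 0) :
    ∃ c : ℝ, A = c • B := by
  have hA := topForm_eq_smul_detForm A
  have hB' := topForm_eq_smul_detForm B
  have h0 : B (fun i => EuclideanSpace.single i (1 : ℝ)) ≠ 0 := fun h =>
    hB (by rw [hB', h, zero_smul])
  refine ⟨A (fun i => EuclideanSpace.single i (1 : ℝ)) /
    B (fun i => EuclideanSpace.single i (1 : ℝ)), ?_⟩
  refine hA.trans (Eq.trans ?_ (congrArg _ hB').symm)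
  rw [smul_smul, div_mul_cancel₀ _ h0]

/-! ### Uniqueness up to a constant, and necessity of the integrability condition. -/

section Uniqueness

variable {d : ℕ} {M : Type*} [TopologicalSpace M] [T2Space M] [ChartedSpace (E (2 * d + 1)) M]
  [IsManifold (𝓡 (2 * d + 1)) ∞ M]
  {η : DForm (2 * d + 1) M 1} {X₀ : ∀ q : M, TangentSpace (𝓡 (2 * d + 1)) q}
  {S : Structure (2 * d + 1) (2 * d) M} {U V : Set M}
  {X : Fin (2 * d) → ∀ p : M, TangentSpace (𝓡 (2 * d + 1)) p}
  {μ : M → Measure (Cov (2 * d + 1))} {Ω Ω' : DForm (2 * d + 1) M (2 * d + 1)}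

omit [T2Space M] in
theorem IsCompatibleVolumeOn.mono (h : S.IsCompatibleVolumeOn μ U Ω) (hVU : V ⊆ U) :
    S.IsCompatibleVolumeOn μ V Ω :=
  ⟨h.1.mono hVU, fun f hf q hq => h.2 f hf q (hVU hq)⟩

omit [T2Space M] in
/-- Small orthonormal frames. -/
theorem exists_orthoFrame_subset (S : Structure (2 * d + 1) (2 * d) M) (hU : IsOpen U) {q : M}
    (hq : q ∈ U) : ∃ V ⊆ U, IsOpen V ∧ q ∈ V ∧ ∃ X, IsOrthoFrame S V X := by
  obtain ⟨V, hV, hqV, X, hX⟩ := exists_orthoFrame S q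
  exact ⟨U ∩ V, inter_subset_left, hU.inter hV, ⟨hq, hqV⟩, X, hX.mono inter_subset_right⟩

/-- Compatibility is a homogeneous linear equation for the density, hence preserved by constant
multiples. -/
theorem isCompatibleVolumeOn_of_eq_smul (hd : 1 ≤ d) (hη : IsContactForm S η)
    (hX₀ : SmoothFieldOn univ X₀) (hη0 : ∀ q, η q ![X₀ q] ≠ 0)
    (hμ : S.IsAdapted (fun q => Submodule.span ℝ {X₀ q}) μ) (hU : IsOpen U)
    (hΩ : S.IsCompatibleVolumeOn μ U Ω) (hΩ' : IsVolumeOn U Ω') {c : ℝ}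
    (h : ∀ q ∈ U, Ω' q = c • Ω q) : S.IsCompatibleVolumeOn μ U Ω' := by
  refine ⟨hΩ', fun f hf q hq => ?_⟩
  obtain ⟨V, hVU, hV, hqV, X, hX⟩ := exists_orthoFrame_subset S hU hq
  revert f
  rw [compatibleAt_iff_alphaForm hd hη hX₀ hη0 hμ hV hX (hΩ'.mono hVU) hqV]
  have h1 := (compatibleAt_iff_alphaForm hd hη hX₀ hη0 hμ hV hX (hΩ.1.mono hVU) hqV).1
    fun f hf => hΩ.2 f hf q hq
  have h2 : ∀ p ∈ V, frameDensity η Ω' X₀ X p = (c • frameDensity η Ω X₀ X) p := by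
    intro p hp
    have h3 : Ω' p (fun a => fullFrame X₀ X a p) = c * Ω p (fun a => fullFrame X₀ X a p) := by
      rw [h p (hVU hp)]
      rfl
    exact (congrArg (fun t => t / η p ![X₀ p]) h3).trans (mul_div_assoc _ _ _)
  have h4 : dFun (n := 2 * d + 1) (frameDensity η Ω' X₀ X) q =
      dFun (c • frameDensity η Ω X₀ X) q :=
    (Filter.eventuallyEq_of_mem (hV.mem_nhds hqV) h2).mfderiv_eq
  have h5 : dFun (n := 2 * d + 1) (c • frameDensity η Ω X₀ X) q =
      c • dFun (frameDensity η Ω X₀ X) q :=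
    const_smul_mfderiv ((contMDiffAt_frameDensity hV hX hX₀ hη.smooth hη0
      (hΩ.1.1.mono hVU) hqV).mdifferentiableAt (by simp)) c
  intro i
  rw [h4, h5, h2 q hqV]
  have h6 : (c • dFun (frameDensity η Ω X₀ X) q) (X i q) =
    c * dFun (frameDensity η Ω X₀ X) q (X i q) := rfl
  refine h6.trans ?_
  rw [h1 i, Pi.smul_apply, smul_eq_mul, mul_assoc]

/-- Both densities have logarithmic differential α - g η, so their ratio, which is the ratio of the
volumes, is locally constant; preconnectedness makes it constant. -/
theorem eq_smul_of_isCompatibleVolumeOn (hd : 1 ≤ d) (hη : IsContactForm S η)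
    (hX₀ : SmoothFieldOn univ X₀) (hη0 : ∀ q, η q ![X₀ q] ≠ 0)
    (hμ : S.IsAdapted (fun q => Submodule.span ℝ {X₀ q}) μ) (hU : IsOpen U)
    (hUc : IsPreconnected U) (hΩ : S.IsCompatibleVolumeOn μ U Ω)
    (hΩ' : S.IsCompatibleVolumeOn μ U Ω') : ∃ c : ℝ, c ≠ 0 ∧ ∀ q ∈ U, Ω' q = c • Ω q := by
  obtain rfl | ⟨q₀, hq₀⟩ := U.eq_empty_or_nonempty
  · exact ⟨1, one_ne_zero, fun q hq => absurd hq (notMem_empty q)⟩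
  have hex : ∀ q : M, ∃ c : ℝ, q ∈ U → Ω' q = c • Ω q := by
    intro q
    by_cases hq : q ∈ U
    · obtain ⟨c, hc⟩ := topForm_eq_smul (n := 2 * d + 1) (Ω' q) (Ω q) (hΩ.1.2 q hq)
      exact ⟨c, fun _ => hc⟩
    · exact ⟨0, fun h => absurd h hq⟩
  choose c hc using hex
  have hloc : ∀ q ∈ U, ∀ᶠ p in 𝓝 q, c p = c q := by
    intro q hq
    obtain ⟨V, hVU, hV, hqV, X, hX⟩ := exists_orthoFrame_subset S hU hq
    have h0 : ∀ p ∈ V, frameDensity η Ω X₀ X p ≠ 0 := fun p hp =>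
      frameDensity_ne_zero hη hη0 hX hp (hΩ.1.2 p (hVU hp))
    have h1 : ∀ p ∈ V, frameDensity η Ω' X₀ X p / frameDensity η Ω X₀ X p = c p := by
      intro p hp
      have h3 : Ω' p (fun a => fullFrame X₀ X a p) =
          c p * Ω p (fun a => fullFrame X₀ X a p) := by
        rw [hc p (hVU hp)]
        rfl
      have h4 : frameDensity η Ω' X₀ X p = c p * frameDensity η Ω X₀ X p :=
        (congrArg (fun t => t / η p ![X₀ p]) h3).trans (mul_div_assoc _ _ _)
      rw [h4, mul_div_cancel_right₀ _ (h0 p hp)]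
    have h2 := eventually_div_eq_of_dFun_log_eq (n := 2 * d + 1) hV
      (fun p hp => contMDiffAt_frameDensity hV hX hX₀ hη.smooth hη0 (hΩ'.1.1.mono hVU) hp)
      (fun p hp => contMDiffAt_frameDensity hV hX hX₀ hη.smooth hη0 (hΩ.1.1.mono hVU) hp)
      (fun p hp => frameDensity_ne_zero hη hη0 hX hp (hΩ'.1.2 p (hVU hp))) h0
      (fun p hp v =>
        ((forward_of_frame hd hη hX₀ hη0 hμ hV hX (IsCompatibleVolumeOn.mono hΩ' hVU) hp).1 v).trans
        ((forward_of_frame hd hη hX₀ hη0 hμ hV hX (IsCompatibleVolumeOn.mono hΩ hVU) hp).1 v).symm)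
      hqV
    filter_upwards [h2, hV.mem_nhds hqV] with p hp hpV
    rw [← h1 p hpV, ← h1 q hqV, hp]
  have hconst : ∀ q ∈ U, c q = c q₀ := by
    have : PreconnectedSpace U := isPreconnected_iff_preconnectedSpace.1 hUc
    have hl : IsLocallyConstant (fun q : U => c q) :=
      (IsLocallyConstant.iff_eventually_eq _).2 fun q =>
        continuous_subtype_val.continuousAt.eventually (hloc q q.2)
    intro q hq
    exact hl.apply_eq_of_preconnectedSpace ⟨q, hq⟩ ⟨q₀, hq₀⟩
  refine ⟨c q₀, fun h => ?_, fun q hq => by rw [hc q hq, hconst q hq]⟩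
  refine hΩ'.1.2 q₀ hq₀ ?_
  rw [hc q₀ hq₀, h]
  exact zero_smul ℝ (Ω q₀)

theorem integrability_of_isCompatibleVolumeOn (hd : 1 ≤ d) (hη : IsContactForm S η)
    (hX₀ : SmoothFieldOn univ X₀) (hη0 : ∀ q, η q ![X₀ q] ≠ 0)
    (hμ : S.IsAdapted (fun q => Submodule.span ℝ {X₀ q}) μ)
    (h : ∀ q : M, ∃ U : Set M, IsOpen U ∧ q ∈ U ∧ ∃ Ω, S.IsCompatibleVolumeOn μ U Ω) :
    IntegrabilityCondition η (alphaForm η X₀) (gFun hd η (alphaForm η X₀)) := by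
  intro q
  obtain ⟨U, hU, hq, Ω, hΩ⟩ := h q
  obtain ⟨V, hVU, hV, hqV, X, hX⟩ := exists_orthoFrame_subset S hU hq
  exact (forward_of_frame hd hη hX₀ hη0 hμ hV hX (IsCompatibleVolumeOn.mono hΩ hVU) hqV).2

end Uniqueness

/-! ### The Poincaré lemma in coordinates. -/

section Euclidean

variable {n : ℕ}

/-- A one-form as a continuous linear functional. -/
def functionalOf (A : E n [⋀^Fin 1]→L[ℝ] ℝ) : E n →L[ℝ] ℝ :=
  ∑ i, A ![EuclideanSpace.single i (1 : ℝ)] • (EuclideanSpace.proj i : E n →L[ℝ] ℝ)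

theorem functionalOf_apply (A : E n [⋀^Fin 1]→L[ℝ] ℝ) (v : E n) : functionalOf A v = A ![v] := by
  conv_rhs => rw [oneForm_eq_sum A, ContinuousAlternatingMap.sum_apply]
  rw [functionalOf, _root_.sum_apply]
  exact Finset.sum_congr rfl fun i _ => rfl

theorem contDiffAt_functionalOf {A : E n → E n [⋀^Fin 1]→L[ℝ] ℝ} {x : E n}
    (hA : ContDiffAt ℝ ∞ A x) : ContDiffAt ℝ ∞ (fun y => functionalOf (A y)) x :=
  ContDiffAt.sum fun _ _ => (contDiffAt_oneForm_field hA contDiffAt_const).smul contDiffAt_const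

theorem fderiv_functionalOf {A : E n → E n [⋀^Fin 1]→L[ℝ] ℝ} {x : E n}
    (hA : ContDiffAt ℝ ∞ A x) (v w : E n) :
    fderiv ℝ (fun y => functionalOf (A y)) x v w = fderiv ℝ A x v ![w] := by
  have h1 := ((contDiffAt_functionalOf hA).differentiableAt (by simp)).hasFDerivAt.clm_apply
    (hasFDerivAt_const w x)
  have h2 : HasFDerivAt (fun y => A y ![w]) _ x :=
    ((hA.differentiableAt (by simp)).hasFDerivAt).continuousAlternatingMap_apply_const ![w]
  have h3 : (fun y => functionalOf (A y) w) = fun y => A y ![w] :=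
    funext fun y => functionalOf_apply _ _
  rw [h3] at h1
  have h4 := DFunLike.congr_fun (h1.unique h2) v
  simpa using h4

/-- **Poincaré lemma** on a ball. -/
theorem exists_primitive_on_ball {A : E n → E n [⋀^Fin 1]→L[ℝ] ℝ} {x : E n} {ε : ℝ}
    (hA : ∀ y ∈ Metric.ball x ε, ContDiffAt ℝ ∞ A y)
    (h : ∀ y ∈ Metric.ball x ε, ∀ v w, extDeriv A y ![v, w] = 0) :
    ∃ f : E n → ℝ, ∀ y ∈ Metric.ball x ε,
      ContDiffAt ℝ ∞ f y ∧ ∀ v, fderiv ℝ f y v = A y ![v] := by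
  have hd : DifferentiableOn ℝ (fun y => functionalOf (A y)) (Metric.ball x ε) := fun y hy =>
    ((contDiffAt_functionalOf (hA y hy)).differentiableAt (by simp)).differentiableWithinAt
  obtain ⟨f, hf⟩ := (convex_ball x ε).exists_forall_hasFDerivAt_of_fderiv_symmetric
    Metric.isOpen_ball hd (fun y hy v w => by
      rw [fderiv_functionalOf (hA y hy), fderiv_functionalOf (hA y hy)]
      have := h y hy v w
      rw [extDeriv_one_apply ((hA y hy).differentiableAt (by simp))] at this
      linarith)
  have hs : ContDiffOn ℝ ∞ f (Metric.ball x ε) := by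
    rw [contDiffOn_infty_iff_fderiv_of_isOpen Metric.isOpen_ball]
    refine ⟨fun y hy => (hf y hy).differentiableAt.differentiableWithinAt, ?_⟩
    have h1 : ContDiffOn ℝ ∞ (fun y => functionalOf (A y)) (Metric.ball x ε) := fun y hy =>
      (contDiffAt_functionalOf (hA y hy)).contDiffWithinAt
    exact h1.congr fun y hy => (hf y hy).fderiv
  refine ⟨f, fun y hy => ⟨hs.contDiffAt (Metric.isOpen_ball.mem_nhds hy), fun v => ?_⟩⟩
  rw [(hf y hy).fderiv, functionalOf_apply]

theorem extDeriv_sub_smul {A B : E n → E n [⋀^Fin 1]→L[ℝ] ℝ} {s : E n → ℝ} {x : E n}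
    (hA : DifferentiableAt ℝ A x) (hB : DifferentiableAt ℝ B x) (hs : DifferentiableAt ℝ s x)
    (v w : E n) :
    extDeriv (fun y => A y - s y • B y) x ![v, w] = extDeriv A x ![v, w] -
      (fderiv ℝ s x v * B x ![w] - fderiv ℝ s x w * B x ![v]) - s x * extDeriv B x ![v, w] := by
  have h1 : HasFDerivAt (fun y => A y - s y • B y) _ x :=
    hA.hasFDerivAt.sub (hs.hasFDerivAt.smul hB.hasFDerivAt)
  rw [extDeriv_one_apply h1.differentiableAt, h1.fderiv, extDeriv_one_apply hA,
    extDeriv_one_apply hB]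
  have h2 : ∀ v w : E n, (fderiv ℝ A x - (s x • fderiv ℝ B x + (fderiv ℝ s x).smulRight (B x)))
      v ![w] = fderiv ℝ A x v ![w] - (s x * fderiv ℝ B x v ![w] + fderiv ℝ s x v * B x ![w]) :=
    fun v w => rfl
  rw [h2, h2]
  ring

end Euclidean

/-! ### Local primitives on a manifold. -/

section Manifold

variable {n : ℕ} {M : Type*} [TopologicalSpace M] [ChartedSpace (E n) M] [IsManifold (𝓡 n) ∞ M]

theorem exists_local_primitive {ξ : DForm n M 1} (hξ : SmoothFormOn univ ξ)
    (hc : ∀ (p : M) (v w : E n), extD ξ p ![v, w] = 0) (q : M) :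
    ∃ V : Set M, IsOpen V ∧ q ∈ V ∧ ∃ h : M → ℝ, ∀ p ∈ V,
      ContMDiffAt (𝓡 n) 𝓘(ℝ, ℝ) ∞ h p ∧ ∀ v : E n, dFun h p v = ξ p ![v] := by
  obtain ⟨ε, hε, hball⟩ := Metric.mem_nhds_iff.1 (extChartAt_target_mem_nhds (I := 𝓡 n) q)
  obtain ⟨f, hf⟩ := exists_primitive_on_ball (A := chartForm q ξ)
    (x := extChartAt (𝓡 n) q q) (ε := ε)
    (fun y hy => hξ.contDiffAt (n := n) isOpen_univ (hball hy) (mem_univ _))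
    (fun y hy v w => by
      rw [← chartForm_extD isOpen_univ hξ (hball hy) (mem_univ _), chartForm_apply]
      have h2 : (fun i => dpsi q y ((![v, w] : Fin 2 → E n) i)) = ![dpsi q y v, dpsi q y w] := by
        ext i; fin_cases i <;> rfl
      exact (congrArg _ h2).trans (hc _ _ _))
  refine ⟨(extChartAt (𝓡 n) q).source ∩ extChartAt (𝓡 n) q ⁻¹'
      Metric.ball (extChartAt (𝓡 n) q q) ε,
    (continuousOn_extChartAt q).isOpen_inter_preimage (isOpen_extChartAt_source q)
      Metric.isOpen_ball,
    ⟨mem_extChartAt_source q, Metric.mem_ball_self hε⟩, f ∘ extChartAt (𝓡 n) q, ?_⟩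
  rintro p ⟨hp, hpb⟩
  obtain ⟨y, hy, rfl⟩ : ∃ y ∈ (extChartAt (𝓡 n) q).target, (extChartAt (𝓡 n) q).symm y = p :=
    ⟨_, (extChartAt (𝓡 n) q).map_source hp, (extChartAt (𝓡 n) q).left_inv hp⟩
  rw [mem_preimage, (extChartAt (𝓡 n) q).right_inv hy] at hpb
  have h1 : (f ∘ extChartAt (𝓡 n) q) ∘ (extChartAt (𝓡 n) q).symm =ᶠ[𝓝 y] f := by
    filter_upwards [target_mem_nhds hy] with z hz
    exact congrArg f ((extChartAt (𝓡 n) q).right_inv hz)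
  have h2 : ContMDiffAt (𝓡 n) 𝓘(ℝ, ℝ) ∞ (f ∘ extChartAt (𝓡 n) q)
      ((extChartAt (𝓡 n) q).symm y) :=
    contMDiffAt_of_chart hy ((hf y hpb).1.congr_of_eventuallyEq h1)
  refine ⟨h2, fun v => ?_⟩
  have h3 := dFun_eq hy (h2.mdifferentiableAt (by simp))
    (dphi q ((extChartAt (𝓡 n) q).symm y) v)
  have h4 : dpsi q y (dphi q ((extChartAt (𝓡 n) q).symm y) v) = v := dpsi_dphi hy v
  rw [h1.fderiv_eq, (hf y hpb).2, chartForm_one_apply, h4] at h3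
  exact h3

theorem smoothFormOn_sub_smul {A B : DForm n M 1} {s : M → ℝ} (hA : SmoothFormOn univ A)
    (hB : SmoothFormOn univ B) (hs : ∀ p, ContMDiffAt (𝓡 n) 𝓘(ℝ, ℝ) ∞ s p) :
    SmoothFormOn univ (fun p => A p - s p • B p) := by
  refine smoothFormOn_of_forall fun c x hx _ w => ?_
  have h1 : ∀ y, chartForm c (fun p => A p - s p • B p) y ![w] =
      chartForm c A y ![w] - (s ∘ (extChartAt (𝓡 n) c).symm) y * chartForm c B y ![w] := by
    intro y
    rw [chartForm_one_apply, chartForm_one_apply, chartForm_one_apply]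
    rfl
  simp_rw [h1]
  exact (contDiffAt_oneForm_field (hA.contDiffAt (n := n) isOpen_univ hx (mem_univ _))
    contDiffAt_const).sub ((contDiffAt_chart_of_contMDiffAt hx (hs _)).mul
    (contDiffAt_oneForm_field (hB.contDiffAt (n := n) isOpen_univ hx (mem_univ _))
      contDiffAt_const))

theorem extD_sub_smul {A B : DForm n M 1} {s : M → ℝ} (hA : SmoothFormOn univ A)
    (hB : SmoothFormOn univ B) (hs : ∀ p, ContMDiffAt (𝓡 n) 𝓘(ℝ, ℝ) ∞ s p) (q : M) (v w : E n) :
    extD (fun p => A p - s p • B p) q ![v, w] = extD A q ![v, w] -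
      (dFun s q v * B q ![w] - dFun s q w * B q ![v]) - s q * extD B q ![v, w] := by
  have h2 : (extChartAt (𝓡 n) q).symm (extChartAt (𝓡 n) q q) = q := extChartAt_to_inv q
  have h3 : chartForm q (fun p => A p - s p • B p) = fun y => chartForm q A y -
      (s ∘ (extChartAt (𝓡 n) q).symm) y • chartForm q B y := rfl
  have key := extDeriv_sub_smul
    ((hA.contDiffAt_self isOpen_univ (mem_univ q)).differentiableAt (by simp))
    ((hB.contDiffAt_self isOpen_univ (mem_univ q)).differentiableAt (by simp))
    ((contMDiffAt_iff_self.1 (hs q)).differentiableAt (by simp)) v w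
  have e1 : ∀ u : E n, chartForm q B (extChartAt (𝓡 n) q q) ![u] = B q ![u] :=
    fun u => chartForm_self B q ![u]
  have e2 : (s ∘ (extChartAt (𝓡 n) q).symm) (extChartAt (𝓡 n) q q) = s q := congrArg s h2
  rw [e1, e1, e2, ← dFun_self ((hs q).mdifferentiableAt (by simp)),
    ← dFun_self ((hs q).mdifferentiableAt (by simp))] at key
  refine (extD_self isOpen_univ (smoothFormOn_sub_smul hA hB hs) (mem_univ q) ![v, w]).trans ?_
  rw [h3]
  exact key.trans (congrArg₂ (fun a b => a - _ - s q * b)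
    (extD_self isOpen_univ hA (mem_univ q) ![v, w]).symm
    (extD_self isOpen_univ hB (mem_univ q) ![v, w]).symm)

end Manifold

theorem contMDiffAt_extD_apply {k : ℕ} {M : Type*} [TopologicalSpace M]
    [ChartedSpace (E (k + 1)) M] [IsManifold (𝓡 (k + 1)) ∞ M] {A : DForm (k + 1) M 1} {U : Set M} (hU : IsOpen U)
    (hA : SmoothFormOn univ A) {Y Z : ∀ p : M, TangentSpace (𝓡 (k + 1)) p} (hY : SmoothFieldOn U Y)
    (hZ : SmoothFieldOn U Z) {q : M} (hq : q ∈ U) :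
    ContMDiffAt (𝓡 (k + 1)) 𝓘(ℝ, ℝ) ∞ (fun p => extD A p ![Y p, Z p]) q := by
  rw [contMDiffAt_iff_self]
  refine (contDiffAt_extDeriv_apply (hA.contDiffAt_self isOpen_univ (mem_univ q))
    (hY.contDiffAt_self hU hq) (hZ.contDiffAt_self hU hq)).congr_of_eventuallyEq ?_
  filter_upwards [extChartAt_target_mem_nhds (I := 𝓡 (k + 1)) q] with y hy
  rw [← chartForm_extD isOpen_univ hA hy (mem_univ _), chartForm_two_chartField hy]
  rfl

/-! ### Closedness of α - g η under the integrability condition. -/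

section Contact

variable {d : ℕ} {M : Type*} [TopologicalSpace M] [ChartedSpace (E (2 * d + 1)) M]
  [IsManifold (𝓡 (2 * d + 1)) ∞ M]
  {S : Structure (2 * d + 1) (2 * d) M} {η α : DForm (2 * d + 1) M 1} {g : M → ℝ}

omit [IsManifold (𝓡 (2 * d + 1)) ∞ M] in
theorem IntegrabilityCondition.apply (h : IntegrabilityCondition η α g) (q : M)
    (v w : E (2 * d + 1)) :
    extD α q ![v, w] - (dFun g q v * η q ![w] - dFun g q w * η q ![v]) - g q * extD η q ![v, w] = 0 := by
  have h1 := DFunLike.congr_fun (h q) ![v, w]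
  have h2 : wedge (dForm (n := 2 * d + 1) g q).toAlternatingMap (η q).toAlternatingMap ![v, w] =
      dFun g q v * η q ![w] - dFun g q w * η q ![v] := wedge_one_one_apply _ _ v w
  exact (congrArg (fun t => extD α q ![v, w] - t - g q * extD η q ![v, w]) h2).symm.trans h1

/-- Restricted to D, the condition reads dα = g dη: the term with dg disappears, so this is
meaningful before g is known to be differentiable. Some dη(X_i, X_j) is nonzero, because otherwise
nondegeneracy would make a frame vector vanish. Near such a point g is a quotient of smooth
functions. -/
theorem IntegrabilityCondition.contMDiffAt (hd : 1 ≤ d) (hη : IsContactForm S η)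
    (hα : SmoothFormOn univ α) (h : IntegrabilityCondition η α g) (q : M) :
    ContMDiffAt (𝓡 (2 * d + 1)) 𝓘(ℝ, ℝ) ∞ g q := by
  obtain ⟨U, hU, hq, X, hX⟩ := exists_orthoFrame S q
  obtain ⟨i, j, hij⟩ : ∃ i j, extD η q ![X i q, X j q] ≠ 0 := by
    by_contra! hcon
    obtain ⟨b, hb, -⟩ := hX.basis q hq
    let i : Fin (2 * d) := ⟨0, by omega⟩
    have h0 : X i q = 0 := by
      refine hη.nondegenerate q _ (hX.mem_D hq i) fun w hw => ?_
      let B := bilinOf (extD η q).toAlternatingMap (X i q)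
      have hB : (B.comp (S.D q).subtype) = 0 := b.ext fun j => by
        have : B (X j q) = 0 := hcon i j
        exact (congrArg B (hb j)).trans this
      exact DFunLike.congr_fun hB ⟨w, hw⟩
    exact b.ne_zero i (Subtype.ext ((hb i).trans h0))
  have h1 : ∀ p ∈ U, extD α p ![X i p, X j p] = g p * extD η p ![X i p, X j p] := by
    intro p hp
    have h2 := h.apply p (X i p) (X j p)
    have h3 : ∀ i, η p ![X i p] = 0 := fun i => (hη.ker p _).1 (hX.mem_D hp i)
    rw [h3, h3, mul_zero, mul_zero, sub_zero, sub_zero, sub_eq_zero] at h2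
    exact h2
  have hs : ∀ {A : DForm (2 * d + 1) M 1}, SmoothFormOn univ A → ContMDiffAt (𝓡 (2 * d + 1))
      𝓘(ℝ, ℝ) ∞ (fun p => extD A p ![X i p, X j p]) q := fun hA =>
    contMDiffAt_extD_apply hU hA (hX.smooth i) (hX.smooth j) hq
  have hdiv : ContMDiffAt (𝓡 (2 * d + 1)) 𝓘(ℝ, ℝ) ∞ (fun p => extD α p ![X i p, X j p] /
      extD η p ![X i p, X j p]) q :=
    contMDiffAt_iff_self.2 ((contMDiffAt_iff_self.1 (hs hα)).div
      (contMDiffAt_iff_self.1 (hs hη.smooth)) (by rw [extChartAt_to_inv]; exact hij))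
  refine hdiv.congr_of_eventuallyEq ?_
  filter_upwards [hU.mem_nhds hq, (hs hη.smooth).continuousAt.eventually_ne hij] with p hp hp0
  rw [h1 p hp, mul_div_cancel_right₀ _ hp0]

theorem exists_local_primitive_of_integrability (hd : 1 ≤ d) (hη : IsContactForm S η)
    (hα : SmoothFormOn univ α) (h : IntegrabilityCondition η α g) (q : M) :
    ∃ V : Set M, IsOpen V ∧ q ∈ V ∧ ∃ f : M → ℝ, ∀ p ∈ V,
      ContMDiffAt (𝓡 (2 * d + 1)) 𝓘(ℝ, ℝ) ∞ f p ∧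
      ∀ v : E (2 * d + 1), dFun f p v = α p ![v] - g p * η p ![v] :=
  have hg := h.contMDiffAt hd hη hα
  exists_local_primitive (ξ := fun p => α p - g p • η p) (smoothFormOn_sub_smul hα hη.smooth hg)
    (fun p v w => (extD_sub_smul hα hη.smooth hg p v w).trans (h.apply p v w)) q

end Contact

/-! ### Gluing primitives through a covering space. -/

section Gluing

variable {B F : Type*} [TopologicalSpace B] [AddCommGroup F] [TopologicalSpace F]
  [DiscreteTopology F] {V : B → Set B} {h : B → B → F}

/-- The covering space whose sections are the functions that differ from each `h i` by a locally
constant function. -/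
def primitiveBundle (hV : ∀ i, IsOpen (V i)) (hmem : ∀ i, i ∈ V i)
    (hloc : ∀ i j, ∀ p ∈ V i ∩ V j, ∀ᶠ p' in 𝓝 p, h i p' - h j p' = h i p - h j p) :
    FiberBundleCore B B F where
  baseSet := V
  isOpen_baseSet := hV
  indexAt := id
  mem_baseSet_at := hmem
  -- The coordinate over `V i` stands for H - h_i, and H - h_j = (H - h_i) + (h_i - h_j).
  coordChange i j p t := t + (h i p - h j p)
  coordChange_self i p _ t := by rw [sub_self, add_zero]
  continuousOn_coordChange i j := by
    rintro ⟨p, t⟩ ⟨hp, -⟩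
    refine ContinuousAt.continuousWithinAt ?_
    have h1 : ∀ᶠ z : B × F in 𝓝 (p, t), z.2 + (h i z.1 - h j z.1) = t + (h i p - h j p) := by
      have h2 : ∀ᶠ z : B × F in 𝓝 (p, t), z.2 = t :=
        (continuous_snd.tendsto (p, t)).eventually_mem
          ((isOpen_discrete {t}).mem_nhds (mem_singleton t))
      have h3 : ∀ᶠ z : B × F in 𝓝 (p, t), h i z.1 - h j z.1 = h i p - h j p :=
        (continuous_fst.tendsto (p, t)).eventually (hloc i j p hp)
      filter_upwards [h2, h3] with z hz hz'
      rw [hz, hz']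
    exact Tendsto.congr' (EventuallyEq.symm h1) tendsto_const_nhds
  coordChange_comp i j k p _ t := by abel

/-- On a simply connected space, functions that are locally determined up to constants glue. -/
theorem exists_eventually_sub_eq [SimplyConnectedSpace B] [LocallyPathConnectedSpace B]
    (hV : ∀ i, IsOpen (V i)) (hmem : ∀ i, i ∈ V i)
    (hloc : ∀ i j, ∀ p ∈ V i ∩ V j, ∀ᶠ p' in 𝓝 p, h i p' - h j p' = h i p - h j p) :
    ∃ H : B → F, ∀ i, ∀ p ∈ V i, ∀ᶠ p' in 𝓝 p, H p' - h i p' = H p - h i p := by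
  let Z := primitiveBundle hV hmem hloc
  have hcov : IsCoveringMap Z.proj := FiberBundle.isCoveringMap (F := F) (E := Z.Fiber)
  obtain ⟨b₀⟩ : Nonempty B := inferInstance
  -- Lifting the identity map of a simply connected base produces a global section. Adding `h p p`
  -- to its fibre coordinate at `p` recovers the glued function.
  obtain ⟨s, ⟨-, hs⟩, -⟩ := hcov.existsUnique_continuousMap_lifts (ContinuousMap.id B) b₀
    (⟨b₀, (0 : F)⟩ : Z.TotalSpace) rfl
  have hs' : ∀ p, (s p).1 = p := fun p => congrFun hs p
  let H : B → F := fun p => (show F from (s p).2) + h p p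
  refine ⟨H, fun i p hp => ?_⟩
  have h1 : ∀ p', (Z.localTriv i (s p')).2 = H p' - h i p' := by
    intro p'
    have h2 : (Z.localTriv i (s p')).2 =
      (show F from (s p').2) + (h (s p').1 (s p').1 - h i (s p').1) := rfl
    rw [h2, hs' p', ← add_sub_assoc]
  have h3 : ContinuousAt (fun p' => (Z.localTriv i (s p')).2) p := by
    have h4 : s p ∈ (Z.localTriv i).source := by
      rw [Z.mem_localTriv_source, hs' p]
      exact hp
    exact continuous_snd.continuousAt.comp
      (((Z.localTriv i).continuousAt h4).comp s.continuous.continuousAt)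
  have h5 : ∀ᶠ p' in 𝓝 p, (Z.localTriv i (s p')).2 = (Z.localTriv i (s p)).2 :=
    h3.eventually_mem ((isOpen_discrete {(Z.localTriv i (s p)).2}).mem_nhds rfl)
  filter_upwards [h5] with p' hp'
  rw [← h1, ← h1, hp']

end Gluing

/-! ### Global primitives on simply connected manifolds. -/

variable {n : ℕ} {M : Type*} [TopologicalSpace M] [ChartedSpace (E n) M] [IsManifold (𝓡 n) ∞ M]

theorem exists_global_primitive [SimplyConnectedSpace M] {ξ : DForm n M 1}
    (hloc : ∀ q : M, ∃ V : Set M, IsOpen V ∧ q ∈ V ∧ ∃ h : M → ℝ, ∀ p ∈ V,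
      ContMDiffAt (𝓡 n) 𝓘(ℝ, ℝ) ∞ h p ∧ ∀ v : E n, dFun h p v = ξ p ![v]) :
    ∃ h : M → ℝ, ∀ p, ContMDiffAt (𝓡 n) 𝓘(ℝ, ℝ) ∞ h p ∧ ∀ v : E n, dFun h p v = ξ p ![v] := by
  choose V hV hmem h hh using hloc
  have : LocallyPathConnectedSpace M := ChartedSpace.locallyPathConnectedSpace (E n) M
  have hloc : ∀ i j, ∀ p ∈ V i ∩ V j, ∀ᶠ p' in 𝓝 p, h i p' - h j p' = h i p - h j p := by
    rintro i j p hp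
    have hsm : ∀ p ∈ V i ∩ V j, ContMDiffAt (𝓡 n) 𝓘(ℝ, ℝ) ∞ (fun p => h i p - h j p) p :=
      fun p hp => (hh i p hp.1).1.sub (hh j p hp.2).1
    refine eventually_eq_of_dFun_eq_zero (f := fun p => h i p - h j p) ((hV i).inter (hV j)) hsm
      (fun p hp v => ?_) hp
    have h4 : dFun (n := n) (h i - h j) p = dFun (h i) p - dFun (h j) p :=
      mfderiv_sub ((hh i p hp.1).1.mdifferentiableAt (by simp))
        ((hh j p hp.2).1.mdifferentiableAt (by simp))
    have h5 : dFun (h i - h j) p v = dFun (h i) p v - dFun (h j) p v :=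
      congrArg (fun T : E n →L[ℝ] ℝ => T v) h4
    exact h5.trans (by rw [(hh i p hp.1).2, (hh j p hp.2).2, sub_self])
  -- The fibre is ℝ with the discrete topology: continuous sections must have locally constant
  -- coordinates.
  obtain ⟨H, hH⟩ := @exists_eventually_sub_eq M ℝ _ _ ⊥ (@DiscreteTopology.mk ℝ ⊥ rfl) V h _ _ hV hmem hloc
  refine ⟨H, fun p => ?_⟩
  have hev : H =ᶠ[𝓝 p] fun p' => h p p' + (H p - h p p) := by
    filter_upwards [hH p p (hmem p)] with p' hp'
    rw [← hp']
    ring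
  have hs : ContMDiffAt (𝓡 n) 𝓘(ℝ, ℝ) ∞ (fun p' => h p p' + (H p - h p p)) p :=
    (hh p p (hmem p)).1.add contMDiffAt_const
  refine ⟨hs.congr_of_eventuallyEq hev, fun v => ?_⟩
  have h1 : dFun (n := n) H p = dFun (fun p' => h p p' + (H p - h p p)) p := hev.mfderiv_eq
  rw [h1, dFun_self (hs.mdifferentiableAt (by simp)), ← (hh p p (hmem p)).2,
    dFun_self ((hh p p (hmem p)).1.mdifferentiableAt (by simp))]
  exact congrArg (fun T : E n →L[ℝ] ℝ => T v) (fderiv_add_const (𝕜 := ℝ) (H p - h p p))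

/-! ### Comparing orthonormal bases. -/

section OrthonormalBases

/-- In orthonormal coordinates the Gram matrix of `b'` is PᵀP with P the matrix of `b'` in `b`, so P
is orthogonal. -/
theorem det_sq_eq_one_of_orthonormal {W : Type*} [AddCommGroup W] [Module ℝ W] {k : ℕ}
    (G : LinearMap.BilinForm ℝ W) (b b' : Module.Basis (Fin k) ℝ W)
    (hb : ∀ i j, G (b i) (b j) = if i = j then 1 else 0)
    (hb' : ∀ i j, G (b' i) (b' j) = if i = j then 1 else 0) : b.det b' ^ 2 = 1 := by
  have h : (b.toMatrix b').transpose * b.toMatrix b' = 1 := by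
    ext i j
    rw [Matrix.mul_apply, Matrix.one_apply, ← hb' i j]
    conv_rhs => rw [← b.sum_repr (b' i), ← b.sum_repr (b' j)]
    simp only [map_sum, LinearMap.sum_apply, map_smul, LinearMap.smul_apply, smul_eq_mul, hb,
      mul_ite, mul_one, mul_zero, Finset.sum_ite_eq', Finset.mem_univ, if_true]
    refine Finset.sum_congr rfl fun l _ => ?_
    rw [Matrix.transpose_apply, Module.Basis.toMatrix_apply, Module.Basis.toMatrix_apply, mul_comm]
  rw [Module.Basis.det_apply, sq]
  nth_rewrite 1 [← Matrix.det_transpose]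
  rw [← Matrix.det_mul, h, Matrix.det_one]

theorem abs_topForm_eq_of_orthonormal {k : ℕ} (A : E (k + 1) [⋀^Fin (k + 1)]→L[ℝ] ℝ)
    (v : E (k + 1)) {D : Submodule ℝ (E (k + 1))} (G : LinearMap.BilinForm ℝ D)
    (b b' : Module.Basis (Fin k) ℝ D)
    (hb : ∀ i j, G (b i) (b j) = if i = j then 1 else 0)
    (hb' : ∀ i j, G (b' i) (b' j) = if i = j then 1 else 0) :
    |A (Fin.cons v fun i => (b i : E (k + 1)))| = |A (Fin.cons v fun i => (b' i : E (k + 1)))| := by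
  let A' : D [⋀^Fin k]→ₗ[ℝ] ℝ := (A.toAlternatingMap.curryLeft v).compLinearMap D.subtype
  have h1 : A' ⇑b' = A' ⇑b * b.det ⇑b' :=
    DFunLike.congr_fun (A'.eq_smul_basis_det b) ⇑b'
  have h2 : |b.det b'| = 1 := (pow_eq_one_iff_of_nonneg (abs_nonneg _) two_ne_zero).1
      (by rw [sq_abs, det_sq_eq_one_of_orthonormal G b b' hb hb'])
  have h3 : |A' ⇑b'| = |A' ⇑b| := by rw [h1, abs_mul, h2, mul_one]
  exact h3.symm

end OrthonormalBases

/-! ### The contact volume and the construction of compatible volumes. -/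

section ContactVolume

variable {d : ℕ} {M : Type*} [TopologicalSpace M] [ChartedSpace (E (2 * d + 1)) M]

/-- The form `a ∧ b ∧ ⋯ ∧ b`. -/
def contactProduct (a : E (2 * d + 1) [⋀^Fin 1]→L[ℝ] ℝ) (b : E (2 * d + 1) [⋀^Fin 2]→L[ℝ] ℝ) :
    E (2 * d + 1) [⋀^Fin (1 + 2 * d)]→ₗ[ℝ] ℝ :=
  wedge a.toAlternatingMap (wedgePow b.toAlternatingMap d)

theorem contactProduct_comp (A : E (2 * d + 1) →L[ℝ] E (2 * d + 1))
    (a : E (2 * d + 1) [⋀^Fin 1]→L[ℝ] ℝ) (b : E (2 * d + 1) [⋀^Fin 2]→L[ℝ] ℝ) :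
    (contactProduct a b).compLinearMap A.toLinearMap =
      contactProduct (a.compContinuousLinearMap A) (b.compContinuousLinearMap A) :=
  (wedge_compLinearMap _ _ _).trans
    (congrArg (wedge _) (wedgePow_compLinearMap A.toLinearMap b.toAlternatingMap d))

/-- The volume form `η ∧ (dη)^d`. -/
def contactVolume (η : DForm (2 * d + 1) M 1) : DForm (2 * d + 1) M (2 * d + 1) := fun q =>
  topCoeff (n := 2 * d + 1) (Nat.add_comm 1 (2 * d)) (contactProduct (η q) (extD η q)) •
    detForm (2 * d + 1)

theorem contactVolume_apply (η : DForm (2 * d + 1) M 1) (q : M)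
    (v : Fin (2 * d + 1) → E (2 * d + 1)) :
    contactVolume η q v = contactProduct (η q) (extD η q)
        (fun i => v (Fin.cast (Nat.add_comm 1 (2 * d)) i)) :=
  (map_cast_eq_topCoeff_mul_det (Nat.add_comm 1 (2 * d)) v).symm

variable [IsManifold (𝓡 (2 * d + 1)) ∞ M] {S : Structure (2 * d + 1) (2 * d) M}
  {η : DForm (2 * d + 1) M 1}

theorem contactVolume_ne_zero (hη : IsContactForm S η) {q : M} (h0 : ∃ v, η q ![v] ≠ 0) :
    contactVolume η q ≠ 0 := by
  intro h
  have h1 : contactVolume η q (fun i => EuclideanSpace.single i (1 : ℝ)) = 0 := by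
    rw [h]
    rfl
  have h2 : contactVolume η q (fun i => EuclideanSpace.single i (1 : ℝ)) =
      topCoeff (n := 2 * d + 1) (Nat.add_comm 1 (2 * d)) (contactProduct (η q) (extD η q)) *
      detForm (2 * d + 1) (fun i => EuclideanSpace.single i (1 : ℝ)) := rfl
  rw [detForm_single, mul_one] at h2
  exact topCoeff_contact_ne_zero (a := (η q).toAlternatingMap) (b := (extD η q).toAlternatingMap) h0
    (fun v hv hw => hη.nondegenerate q v ((hη.ker q v).2 hv)
      fun w hwD => hw w ((hη.ker q w).1 hwD)) _ (h2.symm.trans h1)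

theorem smoothFormOn_of_forall_apply {n : ℕ} {N : Type*} [TopologicalSpace N]
    [ChartedSpace (E n) N] {Ω : DForm n N n} {U : Set N} (h : ∀ (c : N) (x : E n),
      x ∈ (extChartAt (𝓡 n) c).target → (extChartAt (𝓡 n) c).symm x ∈ U →
      ∀ v, ContDiffAt ℝ ∞ (fun y => chartForm c Ω y v) x) : SmoothFormOn U Ω := by
  intro c x hx
  rw [funext fun y => topForm_eq_smul_detForm (chartForm c Ω y)]
  exact ((h c x hx.1 hx.2 _).smul contDiffAt_const).contDiffWithinAt

/-- Pull-back commutes with wedge products and exterior derivatives, so in a chart the form is the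
same polynomial expression in the coordinate expression of η and its derivative. -/
theorem smoothFormOn_contactVolume (hη : SmoothFormOn univ η) :
    SmoothFormOn univ (contactVolume η) := by
  refine smoothFormOn_of_forall_apply fun c x hx _ v => ?_
  have hA := hη.contDiffAt (n := 2 * d + 1) isOpen_univ hx (mem_univ _)
  have h1 : ∀ y ∈ (extChartAt (𝓡 (2 * d + 1)) c).target, chartForm c (contactVolume η) y v =
      contactProduct (chartForm c η y) (extDeriv (chartForm c η) y)
        (fun i => v (Fin.cast (Nat.add_comm 1 (2 * d)) i)) := by
    intro y hy
    rw [← chartForm_extD isOpen_univ hη hy (mem_univ _), chartForm_apply]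
    refine (contactVolume_apply _ _ _).trans ?_
    have h2 := contactProduct_comp (dpsi c y) (η ((extChartAt (𝓡 (2 * d + 1)) c).symm y))
      (extD η ((extChartAt (𝓡 (2 * d + 1)) c).symm y))
    exact DFunLike.congr_fun h2 fun i => v (Fin.cast (Nat.add_comm 1 (2 * d)) i)
  have h3 : ContDiffAt ℝ ∞ (fun y => contactProduct (chartForm c η y)
      (extDeriv (chartForm c η) y) (fun i => v (Fin.cast (Nat.add_comm 1 (2 * d)) i))) x := by
    refine contDiffAt_wedge (fun u => ?_) (contDiffAt_wedgePow (fun u => ?_) d) _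
    · obtain ⟨w, rfl⟩ : ∃ w : E (2 * d + 1), u = ![w] := ⟨u 0, by ext i; fin_cases i; rfl⟩
      exact contDiffAt_oneForm_field hA contDiffAt_const
    · obtain ⟨w, w', rfl⟩ : ∃ w w' : E (2 * d + 1), u = ![w, w'] :=
        ⟨u 0, u 1, by ext i; fin_cases i <;> rfl⟩
      exact contDiffAt_extDeriv_apply hA contDiffAt_const contDiffAt_const
  refine h3.congr_of_eventuallyEq ?_
  filter_upwards [target_mem_nhds hx] with y hy
  exact h1 y hy

theorem SmoothFormOn.smul {n k : ℕ} {N : Type*} [TopologicalSpace N] [ChartedSpace (E n) N]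
    [IsManifold (𝓡 n) ∞ N] {U : Set N} (hU : IsOpen U) {f : N → ℝ} {Ω : DForm n N k}
    (hf : ∀ p ∈ U, ContMDiffAt (𝓡 n) 𝓘(ℝ, ℝ) ∞ f p) (hΩ : SmoothFormOn U Ω) :
    SmoothFormOn U (fun p => f p • Ω p) := fun _ _ hx =>
  ((contDiffAt_chart_of_contMDiffAt hx.1 (hf _ hx.2)).smul
    (hΩ.contDiffAt (n := n) hU hx.1 hx.2)).contDiffWithinAt

variable {X₀ : ∀ q : M, TangentSpace (𝓡 (2 * d + 1)) q} {U V : Set M}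
  {X X' : Fin (2 * d) → ∀ p : M, TangentSpace (𝓡 (2 * d + 1)) p}
  {μ : M → Measure (Cov (2 * d + 1))} {Ω : DForm (2 * d + 1) M (2 * d + 1)}

/-- Up to sign, the density does not depend on the orthonormal frame. -/
theorem abs_frameDensity_eq (hX : IsOrthoFrame S U X) (hX' : IsOrthoFrame S V X') {p : M}
    (hp : p ∈ U) (hp' : p ∈ V) :
    |frameDensity η Ω X₀ X p| = |frameDensity η Ω X₀ X' p| := by
  obtain ⟨b, hb, hbo⟩ := hX.basis p hp
  obtain ⟨b', hb', hbo'⟩ := hX'.basis p hp'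
  have h := abs_topForm_eq_of_orthonormal (k := 2 * d) (Ω p) (X₀ p) (S.metric p) b b' hbo hbo'
  have h1 : ∀ {X : Fin (2 * d) → ∀ p : M, TangentSpace (𝓡 (2 * d + 1)) p}
      {b : Module.Basis (Fin (2 * d)) ℝ (S.D p)}, (∀ i, (b i : TangentSpace (𝓡 (2 * d + 1)) p) = X i p) →
      Ω p (fun a => fullFrame X₀ X a p) =
        Ω p (Fin.cons (X₀ p) fun i => (b i : TangentSpace (𝓡 (2 * d + 1)) p)) := by
    intro X b hb
    congr 1
    funext a
    refine Fin.cases rfl (fun i => (hb i).symm) a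
  have h2 : |Ω p (fun a => fullFrame X₀ X a p)| = |Ω p (fun a => fullFrame X₀ X' a p)| := by
    rw [h1 hb, h1 hb']
    exact h
  rw [frameDensity, frameDensity, abs_div, abs_div, h2]

/-- Multiplying η ∧ (dη)^d by e^h and dividing by the absolute value of its own density gives a
volume whose density has absolute value e^h in every orthonormal frame. The logarithmic differential
of that density is dh, which equals α on D. -/
theorem exists_isCompatibleVolumeOn [T2Space M] (hd : 1 ≤ d) (hη : IsContactForm S η)
    (hX₀ : SmoothFieldOn univ X₀) (hη0 : ∀ q, η q ![X₀ q] ≠ 0)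
    (hμ : S.IsAdapted (fun q => Submodule.span ℝ {X₀ q}) μ) (hU : IsOpen U) {g h : M → ℝ}
    (hh : ∀ p ∈ U, ContMDiffAt (𝓡 (2 * d + 1)) 𝓘(ℝ, ℝ) ∞ h p ∧
      ∀ v : E (2 * d + 1), dFun h p v = alphaForm η X₀ p ![v] - g p * η p ![v]) :
    ∃ Ω, S.IsCompatibleVolumeOn μ U Ω := by
  choose W hW hqW Y hY using fun q => exists_orthoFrame S q
  set T := contactVolume η with hT
  have hT0 : ∀ p, T p ≠ 0 := fun p => contactVolume_ne_zero hη ⟨_, hη0 p⟩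
  have hTs : SmoothFormOn univ T := smoothFormOn_contactVolume hη.smooth
  -- At each point the frame attached to that point is used. Independence of the frame up to sign
  -- compares `r` with the density in a single fixed frame near any point, and so yields smoothness.
  let r : M → ℝ := fun p => |frameDensity η T X₀ (Y p) p|
  have hr : ∀ {V : Set M} {X : Fin (2 * d) → ∀ p : M, TangentSpace (𝓡 (2 * d + 1)) p},
      IsOrthoFrame S V X → ∀ p ∈ V, r p = |frameDensity η T X₀ X p| := fun hX p hp =>
    abs_frameDensity_eq (hY p) hX (hqW p) hp
  have hr0 : ∀ p, r p ≠ 0 := fun p => abs_ne_zero.2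
    (frameDensity_ne_zero hη hη0 (hY p) (hqW p) (hT0 p))
  -- near each point, the density is smooth of constant sign
  have hsign : ∀ q, ∃ e : ℝ, |e| = 1 ∧ ∀ᶠ p in 𝓝 q, r p = e * frameDensity η T X₀ (Y q) p := by
    intro q
    have hc := (contMDiffAt_frameDensity (hW q) (hY q) hX₀ hη.smooth hη0
      (hTs.mono (subset_univ _)) (hqW q)).continuousAt
    have hev : ∀ᶠ p in 𝓝 q, r p = |frameDensity η T X₀ (Y q) p| :=
      Filter.eventually_of_mem ((hW q).mem_nhds (hqW q)) (hr (hY q))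
    rcases lt_or_gt_of_ne (frameDensity_ne_zero hη hη0 (hY q) (hqW q) (hT0 q)) with h0 | h0
    · refine ⟨-1, by simp, ?_⟩
      filter_upwards [hev, hc.eventually (eventually_lt_nhds h0)] with p hp hp'
      rw [hp, abs_of_neg hp', neg_one_mul]
    · refine ⟨1, by simp, ?_⟩
      filter_upwards [hev, hc.eventually (eventually_gt_nhds h0)] with p hp hp'
      rw [hp, abs_of_pos hp', one_mul]
  have hrs : ∀ q, ContMDiffAt (𝓡 (2 * d + 1)) 𝓘(ℝ, ℝ) ∞ r q := by
    intro q
    obtain ⟨e, -, he⟩ := hsign q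
    refine ContMDiffAt.congr_of_eventuallyEq ?_ he
    exact contMDiffAt_iff_self.2 (contDiffAt_const.mul (contMDiffAt_iff_self.1
      (contMDiffAt_frameDensity (hW q) (hY q) hX₀ hη.smooth hη0
        (hTs.mono (subset_univ _)) (hqW q))))
  let f : M → ℝ := fun p => Real.exp (h p) / r p
  have hf : ∀ p ∈ U, ContMDiffAt (𝓡 (2 * d + 1)) 𝓘(ℝ, ℝ) ∞ f p := fun p hp =>
    contMDiffAt_iff_self.2 ((contMDiffAt_iff_self.1 (hh p hp).1).exp.div
      (contMDiffAt_iff_self.1 (hrs p)) (by rw [extChartAt_to_inv]; exact hr0 p))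
  have hf0 : ∀ p, f p ≠ 0 := fun p => div_ne_zero (Real.exp_ne_zero _) (hr0 p)
  have hvol : IsVolumeOn U (fun p => f p • T p) :=
    ⟨SmoothFormOn.smul hU hf (hTs.mono (subset_univ _)), fun p _ => smul_ne_zero (hf0 p) (hT0 p)⟩
  refine ⟨fun p => f p • T p, hvol, fun φ hφ q hq => ?_⟩
  revert φ
  rw [compatibleAt_iff_alphaForm hd hη hX₀ hη0 hμ (hU.inter (hW q))
    ((hY q).mono inter_subset_right) (hvol.mono inter_subset_left) ⟨hq, hqW q⟩]
  set ρ := frameDensity η (fun p => f p • T p) X₀ (Y q) with hρ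
  have hρs : ContMDiffAt (𝓡 (2 * d + 1)) 𝓘(ℝ, ℝ) ∞ ρ q :=
    contMDiffAt_frameDensity (hU.inter (hW q)) ((hY q).mono inter_subset_right) hX₀ hη.smooth hη0
      (hvol.1.mono inter_subset_left) ⟨hq, hqW q⟩
  have hρ1 : ∀ p, ρ p = f p * frameDensity η T X₀ (Y q) p := fun p => mul_div_assoc _ _ _
  have hlog : (fun p => Real.log (ρ p)) =ᶠ[𝓝 q] h := by
    filter_upwards [(hW q).mem_nhds (hqW q)] with p hp
    have h1 : |ρ p| = Real.exp (h p) := by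
      rw [hρ1, abs_mul, ← hr (hY q) p hp, abs_div, Real.abs_exp, abs_of_nonneg (abs_nonneg _ : 0 ≤ r p),
        div_mul_cancel₀ _ (hr0 p)]
    rw [← Real.log_abs, h1, Real.log_exp]
  have hρ0 : ρ q ≠ 0 := frameDensity_ne_zero hη hη0 (hY q) (hqW q) (hvol.2 q hq)
  intro i
  have h1 := (dFun_log hρs hρ0).2 (Y q i q)
  have h2 : dFun (n := 2 * d + 1) (fun p => Real.log (ρ p)) q = dFun h q := hlog.mfderiv_eq
  have h3 : η q ![Y q i q] = 0 := (hη.ker q _).1 ((hY q).mem_D (hqW q) i)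
  have h4 := (hh q hq).2 (Y q i q)
  rw [h3, mul_zero, sub_zero] at h4
  rw [h2, h4] at h1
  rw [h1, mul_inv_cancel_left₀ hρ0]

end ContactVolume

end SubRiem

end

/-! ### The theorem. -/

theorem propositionp (d : ℕ) (hd : 1 ≤ d)
    {M : Type*} [TopologicalSpace M] [T2Space M] [SecondCountableTopology M] [ConnectedSpace M]
    [ChartedSpace (SubRiem.E (2 * d + 1)) M] [IsManifold (𝓡 (2 * d + 1)) ∞ M]
    -- a contact sub-Riemannian structure `(D, metric)` with `D = ker η`
    (S : SubRiem.Structure (2 * d + 1) (2 * d) M)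
    (η : SubRiem.DForm (2 * d + 1) M 1) (hη : SubRiem.IsContactForm S η)
    -- a complement `V = span {X₀}` of `D`
    (X₀ : ∀ q : M, TangentSpace (𝓡 (2 * d + 1)) q)
    (hX₀ : SubRiem.SmoothFieldOn univ X₀) (hηX₀ : ∀ q, η q ![X₀ q] ≠ 0)
    -- any family of measures adapted to the splitting `TM = D ⊕ V`, which defines `L^V`
    (μ : M → Measure (SubRiem.Cov (2 * d + 1)))
    (hμ : S.IsAdapted (fun q => Submodule.span ℝ {X₀ q}) μ)
    (α : SubRiem.DForm (2 * d + 1) M 1) (hα : α = SubRiem.alphaForm η X₀)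
    (g : M → ℝ) (hg : g = SubRiem.gFun hd η α) :
    -- a global compatible volume forces the integrability condition
    ((∃ Ω, S.IsCompatibleVolumeOn μ univ Ω) → SubRiem.IntegrabilityCondition η α g) ∧
    -- the integrability condition is equivalent to the local existence of compatible volumes
    (SubRiem.IntegrabilityCondition η α g ↔
      ∀ q : M, ∃ U : Set M, IsOpen U ∧ q ∈ U ∧ ∃ Ω, S.IsCompatibleVolumeOn μ U Ω) ∧
    -- on a simply connected manifold it is equivalent to the existence of a global one
    (SimplyConnectedSpace M →
      ((∃ Ω, S.IsCompatibleVolumeOn μ univ Ω) ↔ SubRiem.IntegrabilityCondition η α g)) ∧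
    -- a compatible volume (on `M` or on a connected open set) is unique up to a constant
    (∀ U : Set M, IsOpen U → IsPreconnected U →
      ∀ Ω, S.IsCompatibleVolumeOn μ U Ω →
      ∀ Ω' : SubRiem.DForm (2 * d + 1) M (2 * d + 1),
        SubRiem.IsVolumeOn U Ω' →
        (S.IsCompatibleVolumeOn μ U Ω' ↔ ∃ c : ℝ, c ≠ 0 ∧ ∀ q ∈ U, Ω' q = c • Ω q)) := by
  subst hα hg
  have hαs : SubRiem.SmoothFormOn univ (SubRiem.alphaForm η X₀) :=
    SubRiem.smoothFormOn_alphaForm hη.smooth hX₀ hηX₀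
  have hforward := SubRiem.integrability_of_isCompatibleVolumeOn hd hη hX₀ hηX₀ hμ
  have hglobal : (∃ Ω, S.IsCompatibleVolumeOn μ univ Ω) →
      SubRiem.IntegrabilityCondition η (SubRiem.alphaForm η X₀)
        (SubRiem.gFun hd η (SubRiem.alphaForm η X₀)) := fun ⟨Ω, hΩ⟩ =>
    hforward fun q => ⟨univ, isOpen_univ, mem_univ q, Ω, hΩ⟩
  refine ⟨hglobal, ⟨fun h q => ?_, hforward⟩, fun _ => ⟨hglobal, fun h => ?_⟩, ?_⟩
  · obtain ⟨V, hV, hqV, f, hf⟩ :=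
      SubRiem.exists_local_primitive_of_integrability hd hη hαs h q
    exact ⟨V, hV, hqV, SubRiem.exists_isCompatibleVolumeOn hd hη hX₀ hηX₀ hμ hV hf⟩
  · obtain ⟨f, hf⟩ := SubRiem.exists_global_primitive (n := 2 * d + 1)
      (ξ := fun p => SubRiem.alphaForm η X₀ p -
        SubRiem.gFun hd η (SubRiem.alphaForm η X₀) p • η p)
      (SubRiem.exists_local_primitive_of_integrability hd hη hαs h)
    exact SubRiem.exists_isCompatibleVolumeOn hd hη hX₀ hηX₀ hμ isOpen_univ fun p _ => hf p
  · intro U hU hUc Ω hΩ Ω' hΩ'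
    exact ⟨SubRiem.eq_smul_of_isCompatibleVolumeOn hd hη hX₀ hηX₀ hμ hU hUc hΩ,
      fun ⟨c, _, hc⟩ => SubRiem.isCompatibleVolumeOn_of_eq_smul hd hη hX₀ hηX₀ hμ hU hΩ hΩ' hc⟩
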